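/- **Setting.** Let $V$ be a finite-dimensional rational vector space, $n\ge 0$ an integer, and $Q:V\times V\to\mathbb{Q}$ a nondegenerate bilinear form with $Q(u,v)=(-1)^nQ(v,u)$. Put $V_{\mathbb R}=V\otimes\mathbb{R}$, $V_{\mathbb C}=V\otimes\mathbb{C}$, $G=\mathrm{Aut}(V_{\mathbb R},Q)$ and $\mathfrak g_{\mathbb R}=\mathrm{End}(V_{\mathbb R},Q)=\{N : Q(Nu,v)+Q(u,Nv)=0\}$. Let $\mathbf h=(h^{p,q})_{p+q=n}$ be Hodge numbers such that the period domain $D=D_{\mathbf h,Q}$ is non-empty. Here $D$ is the set of decreasing filtrations $V_{\mathbb C}=F^0\supset\dots\supset F^{n}\supset F^{n+1}=0$ with $V_{\mathbb C}=F^p\oplus\overline{F^{n+1-p}}$ for all $p$, such that the spaces $V^{p,q}=F^p\cap\overline{F^q}$ ($p+q=n$) have dimension $h^{p,q}$ and satisfy $Q(V^{p,q},V^{r,s})=0$ for $(p,q)\ne(s,r)$ and $i^{p-q}Q(v,\bar v)>0$ for $0\ne v\in V^{p,q}$. Let $\check D$ be the set of decreasing filtrations $F$ of $V_{\mathbb C}$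 with $F^0=V_{\mathbb C}$, $F^{n+1}=0$, $\dim F^p=\sum_{r\ge p}h^{r,n-r}$ and $Q(F^p,F^{n+1-p})=0$ for all $p$. A *polarized mixed Hodge structure* (PMHS) $(F,N)$ on $D$ consists of $F\in\check D$ and $N\in\mathfrak g_{\mathbb R}$ with $N^{n+1}=0$ and $N(F^p)\subset F^{p-1}$ for all $p$, such that the following holds for the filtration $W_\ell=W_{\ell-n}(N)$ of $V_{\mathbb R}$, where $W_\bullet(N)$ is the Jacobson–Morosov filtration: the finite increasing filtration with $N W_\ell(N)\subset W_{\ell-2}(N)$ for which $N^\ell:W_\ell(N)/W_{\ell-1}(N)\to W_{-\ell}(N)/W_{-\ell-1}(N)$ is an isomorphism for all $\ell\ge0$. For every $\ell$, $F$ induces a Hodge structure of weight $\ell$ on $W_\ell/W_{\ell-1}$; and for every $\ell\ge 0$, $F$ induces on $$P(N)_\ell=\ker\{N^{\ell+1}:W_{n+\ell}/W_{n+\ell-1}\to W_{n-\ell-2}/W_{n-\ell-3}\}$$ a Hodge structure of weight $n+\ell$ that is polarized by $Q(\cdot,N^\ell\cdot)$ (with the same sign conventions as above). Write $W_\ell$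 also for the complexification of $W_\ell$. The Deligne splitting $V_{\mathbb C}=\bigoplus I^{p,q}$ of $(F,N)$ is given by $$I^{p,q}=F^p\cap W_{p+q}\cap\big(\overline{F^q}\cap W_{p+q}+\overline{U^{q-1}_{p+q-2}}\big),\qquad U^a_b=\sum_{j\ge0}F^{a-j}\cap W_{b-j}.$$ The PMHS is *$\mathbb R$-split* if $\overline{I^{p,q}}=I^{q,p}$ for all $p,q$. Its *Hodge diamond* is the function $\Diamond(F,N):\mathbb Z\times\mathbb Z\to\mathbb Z_{\ge0}$, $(p,q)\mapsto\dim_{\mathbb C}I^{p,q}$. **Theorem.** (i) Let $f:\mathbb Z\times\mathbb Z\to\mathbb Z_{\ge0}$ be a function that satisfies, for all $p,q\in\mathbb Z$: 1. $\sum_{p}f(p,q)=h^{n-q,q}$ for every $q$ (a finite sum; $h^{n-q,q}=0$ unless $0\le q\le n$); 2. $f(p,q)=f(q,p)$; 3. $f(p,q)=f(n-q,n-p)$; 4. $f(p,q)\ge f(p+1,q+1)$ whenever $p+q\ge n$. Then $f=\Diamond(F,N)$ for some $\mathbb R$-split PMHS $(F,N)$ on $D$, with $N\in\mathfrak g_{\mathbb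 R}$. (ii) Let $(F_1,N_1)$ and $(F_2,N_2)$ be $\mathbb R$-split PMHS on $D$. Then $\Diamond(F_1,N_1)=\Diamond(F_2,N_2)$ if and only if $(F_2,N_2)=(g\cdot F_1,\mathrm{Ad}_gN_1)$ for some $g\in G$. -/

import Mathlib

open scoped TensorProduct

namespace PMHS

section Definitions

variable {V : Type*} [AddCommGroup V] [Module ℝ V]

/-- The complexification `V_ℂ` of a real vector space `V`. -/
abbrev Cx (V : Type*) [AddCommGroup V] [Module ℝ V] : Type _ := ℂ ⊗[ℝ] V

/-- Complex conjugation `z ⊗ v ↦ z̄ ⊗ v` on `V_ℂ`, as a conjugate-linear map. -/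
noncomputable def conj : Cx V →ₛₗ[starRingEnd ℂ] Cx V where
  toFun := LinearMap.rTensor V Complex.conjAe.toLinearMap
  map_add' := map_add _
  map_smul' := fun c x => by
    induction x using TensorProduct.induction_on with
    | zero => simp
    | tmul z v => simp [TensorProduct.smul_tmul']
    | add x y hx hy => rw [smul_add, map_add, hx, hy, map_add, smul_add]

@[simp] theorem conj_tmul (z : ℂ) (v : V) :
    conj (z ⊗ₜ[ℝ] v) = (starRingEnd ℂ z) ⊗ₜ[ℝ] v := rfl

theorem conj_conj (x : Cx V) : conj (conj x) = x := by
  induction x using TensorProduct.induction_on with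
  | zero => simp
  | tmul z v => simp
  | add x y hx hy => rw [map_add, map_add, hx, hy]

/-- The complex conjugate `S̄` of a complex subspace. As `conj` is an involution, the preimage
of `S` under `conj` is its image. -/
noncomputable def conjSub (S : Submodule ℂ (Cx V)) : Submodule ℂ (Cx V) := S.comap conj

theorem mem_conjSub {S : Submodule ℂ (Cx V)} {x : Cx V} :
    x ∈ conjSub S ↔ ∃ y ∈ S, conj y = x :=
  ⟨fun hx => ⟨conj x, hx, conj_conj x⟩, by
    rintro ⟨y, hy, rfl⟩
    change conj (conj y) ∈ S
    rwa [conj_conj]⟩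

/-! ### Hodge structures on `V` and on its subquotients

Let `A ≤ B` be real subspaces of `V`. A subspace of `B_ℂ / A_ℂ` is handled through its preimage,
a subspace of `V_ℂ` between `A_ℂ` and `B_ℂ`; in particular the zero subspace is `A_ℂ`, the whole
space is `B_ℂ`, and an element of the quotient is zero when a representative lies in `A_ℂ`.
The space `V` itself is the case `A = ⊥`, `B = ⊤`. -/

/-- The filtration `((F^p ∩ B_ℂ) + A_ℂ) / A_ℂ` induced by `F` on `B / A`. -/
noncomputable def inducedFil (A B : Submodule ℝ V) (F : ℤ → Submodule ℂ (Cx V)) (p : ℤ) :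
    Submodule ℂ (Cx V) :=
  (F p ⊓ B.baseChange ℂ) ⊔ A.baseChange ℂ

theorem inducedFil_bot_top (F : ℤ → Submodule ℂ (Cx V)) : inducedFil ⊥ ⊤ F = F := by
  funext p
  simp [inducedFil]

/-- `F` induces a Hodge structure of weight `k` on `B / A`: for every `p` the quotient is the
direct sum of the `p`-th step of the induced filtration and of the conjugate of the
`(k + 1 - p)`-th step. -/
def InducesHodgeStructure (k : ℤ) (A B : Submodule ℝ V) (F : ℤ → Submodule ℂ (Cx V)) : Prop :=
  ∀ p : ℤ,
    inducedFil A B F p ⊓ conjSub (inducedFil A B F (k + 1 - p)) = A.baseChange ℂ ∧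
    inducedFil A B F p ⊔ conjSub (inducedFil A B F (k + 1 - p)) = B.baseChange ℂ

/-- The summand of type `(p, q)` of the Hodge structure on `B / A`: the intersection of the `p`-th
step of the induced filtration with the conjugate of the `q`-th step. -/
noncomputable def hodgePiece (A B : Submodule ℝ V) (F : ℤ → Submodule ℂ (Cx V)) (p q : ℤ) :
    Submodule ℂ (Cx V) :=
  inducedFil A B F p ⊓ conjSub (inducedFil A B F q)

/-- The Hodge-Riemann bilinear relations for the weight `k` Hodge structure on `B / A`, with
respect to the bilinear form that `S` induces on `B / A`. The relations range over all
representatives, so they include that `S` vanishes on pairs of which one member lies in `A_ℂ` and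
the other in a Hodge summand. -/
structure IsPolarizedBy (k : ℤ) (A B : Submodule ℝ V) (F : ℤ → Submodule ℂ (Cx V))
    (S : LinearMap.BilinForm ℝ V) : Prop where
  orthogonal : ∀ p q r s : ℤ, p + q = k → r + s = k → (p, q) ≠ (s, r) →
    ∀ v ∈ hodgePiece A B F p q, ∀ w ∈ hodgePiece A B F r s, S.baseChange ℂ v w = 0
  positive : ∀ p q : ℤ, p + q = k → ∀ v ∈ hodgePiece A B F p q, v ∉ A.baseChange ℂ →
    (Complex.I ^ (p - q) * S.baseChange ℂ v (conj v)).im = 0 ∧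
    0 < (Complex.I ^ (p - q) * S.baseChange ℂ v (conj v)).re

/-! ### The period domain and its compact dual -/

/-- The period domain `D`: Hodge filtrations of `Q`-polarized (effective) Hodge structures of
weight `n` on `V` with Hodge numbers `h p q`, `p + q = n`. -/
def periodDomain (n : ℕ) (Q : LinearMap.BilinForm ℝ V) (h : ℤ → ℤ → ℕ) :
    Set (ℤ → Submodule ℂ (Cx V)) :=
  {F | Antitone F ∧ F 0 = ⊤ ∧ F (n + 1) = ⊥ ∧
    InducesHodgeStructure n ⊥ ⊤ F ∧
    IsPolarizedBy n ⊥ ⊤ F Q ∧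
    ∀ p q : ℤ, p + q = n → Module.finrank ℂ (hodgePiece ⊥ ⊤ F p q) = h p q}

/-- The compact dual `Ď` of `D`: `Q`-isotropic filtrations with
`dim F^p = f^p := ∑_{r ≥ p} h^{r, n - r}`. -/
def compactDual (n : ℕ) (Q : LinearMap.BilinForm ℝ V) (h : ℤ → ℤ → ℕ) :
    Set (ℤ → Submodule ℂ (Cx V)) :=
  {F | Antitone F ∧ F 0 = ⊤ ∧ F (n + 1) = ⊥ ∧
    (∀ p : ℤ, Module.finrank ℂ (F p) = ∑ r ∈ Finset.Icc p n, h r (n - r)) ∧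
    ∀ p q : ℤ, p + q = n + 1 → ∀ v ∈ F p, ∀ w ∈ F q, Q.baseChange ℂ v w = 0}

/-! ### Polarized mixed Hodge structures -/

/-- `W` is the Jacobson-Morosov filtration `W(N)` of the nilpotent endomorphism `N`: the finite
increasing filtration with `N W_ℓ ⊆ W_{ℓ-2}` for which `N^ℓ : W_ℓ / W_{ℓ-1} → W_{-ℓ} / W_{-ℓ-1}`
is an isomorphism for all `ℓ ≥ 0`. -/
structure IsJacobsonMorosov (N : Module.End ℝ V) (W : ℤ → Submodule ℝ V) : Prop where
  mono : Monotone W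
  exists_bot : ∃ a, W a = ⊥
  exists_top : ∃ b, W b = ⊤
  shift : ∀ ℓ : ℤ, ∀ v ∈ W ℓ, N v ∈ W (ℓ - 2)
  gr_injective : ∀ ℓ : ℕ, ∀ v ∈ W ℓ, (N ^ ℓ) v ∈ W (-ℓ - 1) → v ∈ W (ℓ - 1)
  gr_surjective : ∀ ℓ : ℕ, ∀ u ∈ W (-ℓ), ∃ v ∈ W ℓ, u - (N ^ ℓ) v ∈ W (-ℓ - 1)

/-- The space of `v ∈ W_{n+ℓ}` whose class in `W_{n+ℓ} / W_{n+ℓ-1}` is primitive, that is, lies in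
the kernel `P(N)_ℓ` of `N^{ℓ+1} : W_{n+ℓ} / W_{n+ℓ-1} → W_{n-ℓ-2} / W_{n-ℓ-3}`. -/
def primitive (n : ℕ) (W : ℤ → Submodule ℝ V) (N : Module.End ℝ V) (ℓ : ℕ) : Submodule ℝ V :=
  W (n + ℓ) ⊓ (W (n - ℓ - 3)).comap (N ^ (ℓ + 1))

/-- `(W, F, N)` is a `Q`-polarized mixed Hodge structure on the period domain `D` of weight `n`
with Hodge numbers `h`. -/
structure IsPMHS (n : ℕ) (Q : LinearMap.BilinForm ℝ V) (h : ℤ → ℤ → ℕ)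
    (W : ℤ → Submodule ℝ V) (F : ℤ → Submodule ℂ (Cx V)) (N : Module.End ℝ V) : Prop where
  /-- `N ∈ 𝔤_ℝ`. -/
  skew : ∀ u v, Q (N u) v + Q u (N v) = 0
  /-- `N^{n+1} = 0`. -/
  nilpotent : N ^ (n + 1) = 0
  /-- `W = W(N)[-n]`. -/
  weight : IsJacobsonMorosov N (fun ℓ => W (ℓ + n))
  /-- `F ∈ Ď`. -/
  mem_compactDual : F ∈ compactDual n Q h
  /-- `(W, F)` is a mixed Hodge structure. -/
  mixed : ∀ ℓ : ℤ, InducesHodgeStructure ℓ (W (ℓ - 1)) (W ℓ) F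
  /-- `N F^p ⊆ F^{p-1}`. -/
  transversal : ∀ p : ℤ, ∀ v ∈ F p, N.baseChange ℂ v ∈ F (p - 1)
  /-- `F` induces a Hodge structure of weight `n + ℓ` on the primitive space `P(N)_ℓ`. -/
  primitive_hodge : ∀ ℓ : ℕ,
    InducesHodgeStructure (n + ℓ) (W (n + ℓ - 1)) (primitive n W N ℓ) F
  /-- The Hodge structure on `P(N)_ℓ` is polarized by `(u, v) ↦ Q (u, N^ℓ v)`. -/
  primitive_polarized : ∀ ℓ : ℕ,
    IsPolarizedBy (n + ℓ) (W (n + ℓ - 1)) (primitive n W N ℓ) F (Q.compRight (N ^ ℓ))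

/-! ### The Deligne splitting and the Hodge diamond -/

/-- `U^a_b = ∑_{j ≥ 0} F^{a-j} ∩ W_{b-j}`. -/
noncomputable def deligneU (W : ℤ → Submodule ℝ V) (F : ℤ → Submodule ℂ (Cx V)) (a b : ℤ) :
    Submodule ℂ (Cx V) :=
  ⨆ j : ℕ, F (a - j) ⊓ (W (b - j)).baseChange ℂ

/-- The Deligne splitting:
`I^{p,q} = F^p ∩ W_{p+q} ∩ (conj F^q ∩ W_{p+q} + conj U^{q-1}_{p+q-2})`. -/
noncomputable def deligneI (W : ℤ → Submodule ℝ V) (F : ℤ → Submodule ℂ (Cx V)) (p q : ℤ) :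
    Submodule ℂ (Cx V) :=
  F p ⊓ (W (p + q)).baseChange ℂ ⊓
    ((conjSub (F q) ⊓ (W (p + q)).baseChange ℂ) ⊔ conjSub (deligneU W F (q - 1) (p + q - 2)))

/-- The mixed Hodge structure is `ℝ`-split: the conjugate of `I^{p,q}` is `I^{q,p}`. -/
def IsRSplit (W : ℤ → Submodule ℝ V) (F : ℤ → Submodule ℂ (Cx V)) : Prop :=
  ∀ p q : ℤ, conjSub (deligneI W F p q) = deligneI W F q p

/-- The Hodge diamond `(p, q) ↦ dim I^{p,q}`. -/
noncomputable def hodgeDiamond (W : ℤ → Submodule ℝ V) (F : ℤ → Submodule ℂ (Cx V)) :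
    ℤ × ℤ → ℕ :=
  fun pq => Module.finrank ℂ (deligneI W F pq.1 pq.2)

/-- The four conditions on a Hodge diamond for weight `n` and Hodge numbers `h`. -/
structure DiamondConditions (n : ℕ) (h : ℤ → ℤ → ℕ) (f : ℤ × ℤ → ℕ) : Prop where
  column_finite : ∀ q : ℤ, {p : ℤ | f (p, q) ≠ 0}.Finite
  column_sum : ∀ q : ℤ, ∑ᶠ p : ℤ, f (p, q) = h (n - q) q
  symm : ∀ p q : ℤ, f (p, q) = f (q, p)
  antisymm : ∀ p q : ℤ, f (p, q) = f (n - q, n - p)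
  mono : ∀ p q : ℤ, n ≤ p + q → f (p + 1, q + 1) ≤ f (p, q)

end Definitions

end PMHS

/-!
An `ℝ`-split polarized mixed Hodge structure is determined up to isometry by its Hodge diamond
because it has a basis in which `Q`, the complex conjugation, `N` and `F` are given by formulas
that involve the diamond alone. Such a basis is called adapted (`PMHS.IsAdapted`); its index set
`PMHS.Idx n g` consists of Jordan strings, with `g (p, q)` strings that start in bidegree `(p, q)`,
`p + q ≥ n`, and descend along the diagonal to `(n - q, n - p)`. Conjugation exchanges the strings
that start at `(p, q)` and `(q, p)`, and `Q` pairs each string with its conjugate, read backwards,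
with the signs `PMHS.Idx.sgn`. The numbers `g (p, q) = f (p, q) - f (p + 1, q + 1)` and the diamond
`f` determine each other; here the symmetry and monotonicity conditions on `f` enter
(`PMHS.Idx.cnt_stringsOf`, `PMHS.Idx.stringsOf_cnt`).

*Existence of adapted bases.* When the structure is split over `ℝ`, the summand `I^{p,q}` of the
Deligne splitting is `F^p ∩ conj F^q ∩ W_{p+q}`. The Lefschetz decomposition writes the bigraded
space as the sum of the `N`-translates of its primitive parts. The polarizations are positive
definite Hermitian forms on the primitive parts, so these have orthonormal bases compatible with
conjugation (`PMHS.exists_orthonormal_conj`). Translating these by `N` gives an adapted basis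
(`PMHS.HasBigrading.exists_isAdapted`). The linear map that matches two adapted bases of the same
type commutes with conjugation, preserves `Q`, and carries `N` and `F` along
(`PMHS.IsAdapted.exists_isometry`). Conversely an isometry preserves the diamond, since the weight
filtration is determined by `N` (`PMHS.IsJacobsonMorosov.unique`).

*Existence of structures.* The formulas attached to any adapted basis define an `ℝ`-split polarized
mixed Hodge structure with the expected diamond (`PMHS.IsAdapted.isPMHS`,
`PMHS.IsAdapted.hodgeDiamond_eq`). It remains to find an adapted basis of the type prescribed by `f`
in the given space. A point of the period domain is the case `N = 0`, so it supplies an adapted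
basis of another type with the same Hodge numbers, that is, the same column sums. An adapted basis
gives a positive definite Hermitian form, and comparing it with `Q` gives a real operator `T` with
`T ^ 2 = (-1) ^ n` that plays the role of the Weil operator. The isomorphism class of `Q` depends
only on the dimension and on the trace of `T` (`PMHS.exists_weil_eigenbasis`). The trace receives
a contribution only from the middles of the strings of odd length, and it is also an alternating sum
of the column sums (`PMHS.Idx.sum_sgn_refl`). Therefore it depends on the Hodge numbers only, and
adapted bases of all types with the same Hodge numbers exist in the same space
(`PMHS.IsAdapted.exists_of_col_eq`).
-/

namespace PMHS

/-! ### Complexification of real vector spaces -/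

section Complexification

variable {E : Type*} [AddCommGroup E] [Module ℝ E]

/-- The real part of a vector of `E_ℂ`. -/
noncomputable def rePart : Cx E →ₗ[ℝ] E :=
  (TensorProduct.lid ℝ E).toLinearMap ∘ₗ LinearMap.rTensor E Complex.reLm

/-- The imaginary part of a vector of `E_ℂ`. -/
noncomputable def imPart : Cx E →ₗ[ℝ] E :=
  (TensorProduct.lid ℝ E).toLinearMap ∘ₗ LinearMap.rTensor E Complex.imLm

@[simp] theorem rePart_tmul (z : ℂ) (v : E) : rePart (z ⊗ₜ[ℝ] v) = z.re • v := by
  simp [rePart]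

@[simp] theorem imPart_tmul (z : ℂ) (v : E) : imPart (z ⊗ₜ[ℝ] v) = z.im • v := by
  simp [imPart]

theorem one_tmul_injective {a b : E} (h : (1 : ℂ) ⊗ₜ[ℝ] a = (1 : ℂ) ⊗ₜ[ℝ] b) : a = b := by
  simpa using congrArg rePart h

theorem re_add_im (x : Cx E) :
    (1 : ℂ) ⊗ₜ[ℝ] rePart x + Complex.I • ((1 : ℂ) ⊗ₜ[ℝ] imPart x) = x := by
  induction x using TensorProduct.induction_on with
  | zero => simp
  | tmul z v =>
    rw [rePart_tmul, imPart_tmul, TensorProduct.smul_tmul', ← TensorProduct.smul_tmul,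
      ← TensorProduct.smul_tmul, ← TensorProduct.add_tmul]
    congr 1
    apply Complex.ext <;> simp
  | add x y hx hy =>
    rw [map_add, map_add, TensorProduct.tmul_add, TensorProduct.tmul_add, smul_add]
    nth_rewrite 3 [← hx]
    nth_rewrite 3 [← hy]
    abel

theorem one_tmul_rePart (x : Cx E) :
    (1 : ℂ) ⊗ₜ[ℝ] rePart x = (1 / 2 : ℂ) • (x + conj x) := by
  nth_rewrite 2 3 [← re_add_im x]
  rw [map_add, LinearMap.map_smulₛₗ, conj_tmul, conj_tmul, Complex.conj_I, map_one]
  module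

theorem I_smul_one_tmul_imPart (x : Cx E) :
    Complex.I • ((1 : ℂ) ⊗ₜ[ℝ] imPart x) = (1 / 2 : ℂ) • (x - conj x) := by
  nth_rewrite 2 3 [← re_add_im x]
  rw [map_add, LinearMap.map_smulₛₗ, conj_tmul, conj_tmul, Complex.conj_I, map_one]
  module

theorem one_tmul_rePart_of_conj_eq {x : Cx E} (hx : conj x = x) :
    (1 : ℂ) ⊗ₜ[ℝ] rePart x = x := by
  rw [one_tmul_rePart, hx]
  module

theorem mem_baseChange {R : Submodule ℝ E} {x : Cx E} :
    x ∈ R.baseChange ℂ ↔ rePart x ∈ R ∧ imPart x ∈ R := by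
  constructor
  · intro hx
    have key : R.baseChange ℂ ≤
        { carrier := {x : Cx E | rePart x ∈ R ∧ imPart x ∈ R}
          add_mem' := by
            rintro a b ⟨h1, h2⟩ ⟨h3, h4⟩
            exact ⟨by rw [map_add]; exact R.add_mem h1 h3, by rw [map_add]; exact R.add_mem h2 h4⟩
          zero_mem' := by simp
          smul_mem' := by
            rintro c x ⟨h1, h2⟩
            have : c • x = ((c * 1) ⊗ₜ[ℝ] rePart x + (c * Complex.I) ⊗ₜ[ℝ] imPart x : Cx E) := by
              nth_rewrite 1 [← re_add_im x]
              simp [TensorProduct.smul_tmul']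
            simp only [Set.mem_ofPred_eq, this, map_add, rePart_tmul, imPart_tmul]
            exact ⟨R.add_mem (R.smul_mem _ h1) (R.smul_mem _ h2),
              R.add_mem (R.smul_mem _ h1) (R.smul_mem _ h2)⟩ } := by
      rw [Submodule.baseChange_eq_span, Submodule.span_le]
      rintro _ ⟨a, ha, rfl⟩
      have ha' : a ∈ R := ha
      change rePart ((1 : ℂ) ⊗ₜ[ℝ] a) ∈ R ∧ imPart ((1 : ℂ) ⊗ₜ[ℝ] a) ∈ R
      simp [ha']
    exact key hx
  · rintro ⟨h1, h2⟩
    rw [← re_add_im x]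
    exact Submodule.add_mem _ (Submodule.tmul_mem_baseChange_of_mem _ h1)
      (Submodule.smul_mem _ _ (Submodule.tmul_mem_baseChange_of_mem _ h2))

@[simp] theorem one_tmul_mem_baseChange {R : Submodule ℝ E} {a : E} :
    (1 : ℂ) ⊗ₜ[ℝ] a ∈ R.baseChange ℂ ↔ a ∈ R := by
  simp [mem_baseChange]

@[simp] theorem rePart_conj (x : Cx E) : rePart (conj x) = rePart x := by
  induction x using TensorProduct.induction_on with
  | zero => simp
  | tmul z v => simp
  | add x y hx hy => rw [map_add, map_add, hx, hy, map_add]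

@[simp] theorem imPart_conj (x : Cx E) : imPart (conj x) = - imPart x := by
  induction x using TensorProduct.induction_on with
  | zero => simp
  | tmul z v => simp
  | add x y hx hy => rw [map_add, map_add, hx, hy, map_add, neg_add]

theorem conj_mem_baseChange {R : Submodule ℝ E} {x : Cx E} :
    conj x ∈ R.baseChange ℂ ↔ x ∈ R.baseChange ℂ := by
  simp [mem_baseChange]

theorem conjSub_baseChange (R : Submodule ℝ E) : conjSub (R.baseChange ℂ) = R.baseChange ℂ :=
  Submodule.ext fun _ => conj_mem_baseChange

/-- The real points of a complex subspace of `E_ℂ`. -/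
noncomputable def realPoints (S : Submodule ℂ (Cx E)) : Submodule ℝ E :=
  (S.restrictScalars ℝ).comap (TensorProduct.mk ℝ ℂ E 1)

theorem mem_realPoints {S : Submodule ℂ (Cx E)} {a : E} :
    a ∈ realPoints S ↔ (1 : ℂ) ⊗ₜ[ℝ] a ∈ S := Iff.rfl

theorem baseChange_realPoints {S : Submodule ℂ (Cx E)} (hS : conjSub S = S) :
    (realPoints S).baseChange ℂ = S := by
  ext x
  rw [mem_baseChange, mem_realPoints, mem_realPoints]
  constructor
  · rintro ⟨h1, h2⟩
    rw [← re_add_im x]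
    exact S.add_mem h1 (S.smul_mem _ h2)
  · intro hx
    have hc : conj x ∈ S := by rw [← hS] at hx; exact hx
    have h2 : Complex.I • ((1 : ℂ) ⊗ₜ[ℝ] imPart x) ∈ S := by
      rw [I_smul_one_tmul_imPart]
      exact S.smul_mem _ (S.sub_mem hx hc)
    refine ⟨?_, (Submodule.smul_mem_iff _ Complex.I_ne_zero).1 h2⟩
    rw [one_tmul_rePart]
    exact S.smul_mem _ (S.add_mem hx hc)

theorem baseChange_injective {R S : Submodule ℝ E} (h : R.baseChange ℂ = S.baseChange ℂ) :
    R = S := by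
  ext a
  rw [← one_tmul_mem_baseChange, h, one_tmul_mem_baseChange]

theorem baseChange_mono {R S : Submodule ℝ E} (h : R ≤ S) :
    R.baseChange ℂ ≤ S.baseChange ℂ := by
  intro x
  rw [mem_baseChange, mem_baseChange]
  exact fun ⟨h1, h2⟩ => ⟨h h1, h h2⟩

theorem baseChange_inf (R S : Submodule ℝ E) :
    (R ⊓ S).baseChange ℂ = R.baseChange ℂ ⊓ S.baseChange ℂ := by
  ext x
  simp only [mem_baseChange, Submodule.mem_inf]
  tauto

theorem rePart_baseChange (N : Module.End ℝ E) (x : Cx E) :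
    rePart (N.baseChange ℂ x) = N (rePart x) := by
  induction x using TensorProduct.induction_on with
  | zero => simp
  | tmul z v => simp
  | add x y hx hy => rw [map_add, map_add, hx, hy, map_add, map_add]

theorem imPart_baseChange (N : Module.End ℝ E) (x : Cx E) :
    imPart (N.baseChange ℂ x) = N (imPart x) := by
  induction x using TensorProduct.induction_on with
  | zero => simp
  | tmul z v => simp
  | add x y hx hy => rw [map_add, map_add, hx, hy, map_add, map_add]

theorem conj_baseChange (N : Module.End ℝ E) (x : Cx E) :
    conj (N.baseChange ℂ x) = N.baseChange ℂ (conj x) := by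
  induction x using TensorProduct.induction_on with
  | zero => simp
  | tmul z v => simp
  | add x y hx hy => rw [map_add, map_add, hx, hy, map_add, map_add]

theorem baseChange_pow_apply (N : Module.End ℝ E) (m : ℕ) (x : Cx E) :
    (N ^ m).baseChange ℂ x = (N.baseChange ℂ ^ m) x := by
  rw [LinearMap.baseChange_pow]

theorem conj_baseChange_pow (N : Module.End ℝ E) (m : ℕ) (x : Cx E) :
    conj ((N.baseChange ℂ ^ m) x) = (N.baseChange ℂ ^ m) (conj x) := by
  rw [← baseChange_pow_apply, conj_baseChange, baseChange_pow_apply]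

theorem baseChange_comap (R : Submodule ℝ E) (N : Module.End ℝ E) :
    (R.comap N).baseChange ℂ = (R.baseChange ℂ).comap (N.baseChange ℂ) := by
  ext x
  simp only [mem_baseChange, Submodule.mem_comap, rePart_baseChange, imPart_baseChange]

variable (Q : LinearMap.BilinForm ℝ E)

theorem baseChange_one_tmul (u v : E) :
    Q.baseChange ℂ ((1 : ℂ) ⊗ₜ[ℝ] u) ((1 : ℂ) ⊗ₜ[ℝ] v) = (Q u v : ℂ) := by
  simp

theorem form_conj (x y : Cx E) :
    Q.baseChange ℂ (conj x) (conj y) = starRingEnd ℂ (Q.baseChange ℂ x y) := by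
  induction x using TensorProduct.induction_on with
  | zero => simp
  | add x x' hx hx' => simp only [map_add, LinearMap.add_apply, hx, hx']
  | tmul z v =>
    induction y using TensorProduct.induction_on with
    | zero => simp
    | tmul w u => simp
    | add y y' hy hy' => simp only [map_add, hy, hy']

theorem form_symm {ε : ℝ} (hQ : ∀ u v, Q u v = ε * Q v u) (x y : Cx E) :
    Q.baseChange ℂ x y = ε * Q.baseChange ℂ y x := by
  induction x using TensorProduct.induction_on with
  | zero => simp
  | add x x' hx hx' => simp only [map_add, LinearMap.add_apply, hx, hx', mul_add]
  | tmul z v =>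
    induction y using TensorProduct.induction_on with
    | zero => simp
    | tmul w u =>
      simp [hQ v u]
      ring
    | add y y' hy hy' => simp only [map_add, LinearMap.add_apply, hy, hy', mul_add]

theorem form_skew {N : Module.End ℝ E} (hN : ∀ u v, Q (N u) v + Q u (N v) = 0) (x y : Cx E) :
    Q.baseChange ℂ (N.baseChange ℂ x) y = - Q.baseChange ℂ x (N.baseChange ℂ y) := by
  induction x using TensorProduct.induction_on with
  | zero => simp
  | add x x' hx hx' => simp only [map_add, LinearMap.add_apply, hx, hx', neg_add]
  | tmul z v =>
    induction y using TensorProduct.induction_on with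
    | zero => simp
    | tmul w u =>
      have := eq_neg_of_add_eq_zero_left (hN v u)
      simp [this]
    | add y y' hy hy' => simp only [map_add, hy, hy', neg_add]

theorem form_skew_pow {N : Module.End ℝ E} (hN : ∀ u v, Q (N u) v + Q u (N v) = 0) (m : ℕ)
    (x y : Cx E) :
    Q.baseChange ℂ ((N.baseChange ℂ ^ m) x) y
      = (-1) ^ m * Q.baseChange ℂ x ((N.baseChange ℂ ^ m) y) := by
  induction m generalizing x with
  | zero => simp
  | succ m ih =>
    rw [pow_succ, Module.End.mul_apply, ih, form_skew Q hN, ← Module.End.mul_apply,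
      ← pow_succ', ← pow_succ, pow_succ (-1 : ℂ)]
    ring

theorem form_compRight (N : Module.End ℝ E) (x y : Cx E) :
    LinearMap.BilinForm.baseChange ℂ (Q.compRight N) x y
      = Q.baseChange ℂ x (N.baseChange ℂ y) := by
  induction x using TensorProduct.induction_on with
  | zero => simp
  | add x x' hx hx' => simp only [map_add, LinearMap.add_apply, hx, hx']
  | tmul z v =>
    induction y using TensorProduct.induction_on with
    | zero => simp
    | tmul w u => simp
    | add y y' hy hy' => simp only [map_add, hy, hy']

/-- The real linear map underlying a complex linear map of `E_ℂ`; it is a descent of `L` when `L`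
commutes with `conj`. -/
noncomputable def descend (L : Cx E →ₗ[ℂ] Cx E) : E →ₗ[ℝ] E :=
  rePart ∘ₗ L.restrictScalars ℝ ∘ₗ TensorProduct.mk ℝ ℂ E 1

theorem one_tmul_descend {L : Cx E →ₗ[ℂ] Cx E} (hL : ∀ x, conj (L x) = L (conj x)) (a : E) :
    (1 : ℂ) ⊗ₜ[ℝ] descend L a = L ((1 : ℂ) ⊗ₜ[ℝ] a) := by
  refine one_tmul_rePart_of_conj_eq (x := L ((1 : ℂ) ⊗ₜ[ℝ] a)) ?_
  rw [hL, conj_tmul, map_one]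

theorem baseChange_descend {L : Cx E →ₗ[ℂ] Cx E} (hL : ∀ x, conj (L x) = L (conj x)) :
    (descend L).baseChange ℂ = L := by
  ext a
  simpa using one_tmul_descend hL a

/-- The real linear automorphism underlying an automorphism of `E_ℂ` that commutes with `conj`. -/
noncomputable def descendEquiv (Φ : Cx E ≃ₗ[ℂ] Cx E) (hΦ : ∀ x, conj (Φ x) = Φ (conj x)) :
    E ≃ₗ[ℝ] E :=
  have hΨ : ∀ x, conj (Φ.symm.toLinearMap x) = Φ.symm.toLinearMap (conj x) := fun x => by
    apply Φ.injective
    simp [← hΦ]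
  LinearEquiv.ofLinearMap (descend Φ.toLinearMap) (descend Φ.symm.toLinearMap)
    (LinearMap.ext fun a => one_tmul_injective (by
      rw [LinearMap.comp_apply, one_tmul_descend (L := Φ.toLinearMap) hΦ, one_tmul_descend hΨ]
      simp))
    (LinearMap.ext fun a => one_tmul_injective (by
      rw [LinearMap.comp_apply, one_tmul_descend hΨ, one_tmul_descend (L := Φ.toLinearMap) hΦ]
      simp))

theorem baseChange_descendEquiv (Φ : Cx E ≃ₗ[ℂ] Cx E) (hΦ : ∀ x, conj (Φ x) = Φ (conj x)) :
    (descendEquiv Φ hΦ).toLinearMap.baseChange ℂ = Φ.toLinearMap :=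
  baseChange_descend (L := Φ.toLinearMap) hΦ

end Complexification

/-! ### Orthonormal families adapted to a complex conjugation -/

/-- `B` is a Hermitian form on `X`: conjugate-linear in the first variable, with
`B u v` conjugate to `B v u`. -/
structure IsHermitianForm {𝕜 X : Type*} [RCLike 𝕜] [AddCommGroup X] [Module 𝕜 X]
    (B : X → X → 𝕜) : Prop where
  symm : ∀ u v, starRingEnd 𝕜 (B v u) = B u v
  add_left : ∀ u v w, B (u + v) w = B u w + B v w
  smul_left : ∀ (c : 𝕜) u v, B (c • u) v = starRingEnd 𝕜 c * B u v

namespace IsHermitianForm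

variable {𝕜 X : Type*} [RCLike 𝕜] [AddCommGroup X] [Module 𝕜 X] {B : X → X → 𝕜}

theorem zero_left (h : IsHermitianForm B) (v : X) : B 0 v = 0 := by
  have := h.smul_left 0 0 v
  simpa using this

theorem add_right (h : IsHermitianForm B) (u v w : X) : B u (v + w) = B u v + B u w := by
  rw [← h.symm, h.add_left, map_add, h.symm, h.symm]

theorem smul_right (h : IsHermitianForm B) (c : 𝕜) (u v : X) : B u (c • v) = c * B u v := by
  rw [← h.symm, h.smul_left, map_mul, h.symm, RCLike.conj_conj]

theorem zero_right (h : IsHermitianForm B) (u : X) : B u 0 = 0 := by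
  rw [← h.symm, h.zero_left, map_zero]

theorem sum_right (h : IsHermitianForm B) {ι : Type*} (s : Finset ι) (f : ι → X) (v : X) :
    B v (∑ i ∈ s, f i) = ∑ i ∈ s, B v (f i) := by
  classical
  induction s using Finset.induction_on with
  | empty => simpa using h.zero_right v
  | insert a s ha ih => rw [Finset.sum_insert ha, Finset.sum_insert ha, h.add_right, ih]

/-- Orthonormal vectors are linearly independent, whether or not `B` is definite. -/
theorem linearIndependent (h : IsHermitianForm B) {ι : Type*} {v : ι → X} [DecidableEq ι]
    (hv : ∀ i j, B (v i) (v j) = if i = j then 1 else 0) : LinearIndependent 𝕜 v := by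
  rw [linearIndependent_iff']
  intro s g hg i hi
  have := h.sum_right s (fun j => g j • v j) (v i)
  rw [hg, h.zero_right] at this
  simpa [h.smul_right, hv, hi] using this.symm

theorem exists_orthonormal (h : IsHermitianForm B) (Y : Submodule 𝕜 X) [FiniteDimensional 𝕜 Y]
    (pos : ∀ u ∈ Y, u ≠ 0 → 0 < RCLike.re (B u u)) :
    ∃ (m : ℕ) (b : ℕ → X), (∀ k < m, b k ∈ Y) ∧
      (∀ k < m, ∀ l < m, B (b k) (b l) = if k = l then 1 else 0) ∧
      Y ≤ Submodule.span 𝕜 (b '' {k | k < m}) := by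
  let core : InnerProductSpace.Core 𝕜 Y :=
    { inner := fun u v => B u v
      conj_inner_symm := fun u v => h.symm u v
      re_inner_nonneg := fun u => by
        by_cases hu : (u : X) = 0
        · rw [hu, h.zero_left, map_zero]
        · exact (pos u u.2 hu).le
      add_left := fun u v w => h.add_left u v w
      smul_left := fun u v c => h.smul_left c u v
      definite := fun u hu => by
        by_contra hne
        have := pos u u.2 (fun h0 => hne (Subtype.ext h0))
        have hu' : B u u = 0 := hu
        rw [hu', map_zero] at this
        exact lt_irrefl _ this }
  let : NormedAddCommGroup Y := core.toNormedAddCommGroup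
  let : InnerProductSpace 𝕜 Y := InnerProductSpace.ofCore core.toCore
  let o := stdOrthonormalBasis 𝕜 Y
  have ho : ∀ k l, B (o k : X) (o l) = if k = l then 1 else 0 :=
    orthonormal_iff_ite.1 o.orthonormal
  refine ⟨Module.finrank 𝕜 Y,
    fun k => if hk : k < Module.finrank 𝕜 Y then (o ⟨k, hk⟩ : X) else 0, ?_, ?_, ?_⟩
  · intro k hk
    simp only [dif_pos hk]
    exact (o ⟨k, hk⟩).2
  · intro k hk l hl
    simp only [dif_pos hk, dif_pos hl, ho]
    simp
  · intro y hy
    have : (⟨y, hy⟩ : Y) = ∑ i, o.repr ⟨y, hy⟩ i • o i := (o.sum_repr _).symm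
    have hy' : y = ∑ i, o.repr ⟨y, hy⟩ i • (o i : X) := by
      have := congrArg Subtype.val this
      simpa using this
    rw [hy']
    refine Submodule.sum_mem _ fun i _ => Submodule.smul_mem _ _ (Submodule.subset_span ?_)
    exact ⟨i, i.2, dif_pos i.2⟩

end IsHermitianForm

variable {X : Type*} [AddCommGroup X] [Module ℂ X]

/-- A positive definite Hermitian form that is compatible with a complex conjugation `s` admits an
orthonormal basis of vectors fixed by `s`: an orthonormal basis of the real points. -/
theorem exists_orthonormal_of_stable [FiniteDimensional ℂ X] {B : X → X → ℂ}
    (h : IsHermitianForm B) (s : X →ₛₗ[starRingEnd ℂ] X) (hs : ∀ x, s (s x) = x)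
    (Y : Submodule ℂ X) (hY : ∀ y ∈ Y, s y ∈ Y)
    (hB : ∀ u v, B (s u) (s v) = starRingEnd ℂ (B u v))
    (pos : ∀ u ∈ Y, u ≠ 0 → 0 < (B u u).re) :
    ∃ (m : ℕ) (b : ℕ → X), (∀ k < m, b k ∈ Y) ∧
      (∀ k < m, ∀ l < m, B (b k) (b l) = if k = l then 1 else 0) ∧
      Y ≤ Submodule.span ℂ (b '' {k | k < m}) ∧ ∀ k < m, s (b k) = b k := by
  let : Module ℝ X := Module.complexToReal X
  have : FiniteDimensional ℝ X := Module.Finite.trans ℂ X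
  let Y' : Submodule ℝ X :=
    { carrier := {y | y ∈ Y ∧ s y = y}
      add_mem' := fun ⟨h1, h2⟩ ⟨h3, h4⟩ => ⟨Y.add_mem h1 h3, by rw [map_add, h2, h4]⟩
      zero_mem' := ⟨Y.zero_mem, map_zero s⟩
      smul_mem' := fun c y ⟨h1, h2⟩ => by
        have : c • y = (c : ℂ) • y := rfl
        rw [Set.mem_ofPred_eq, this]
        exact ⟨Y.smul_mem _ h1, by rw [LinearMap.map_smulₛₗ, h2, Complex.conj_ofReal]⟩ }
  have h' : IsHermitianForm (𝕜 := ℝ) (fun u v : X => (B u v).re) :=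
    { symm := fun u v => by simpa using congrArg Complex.re (h.symm u v)
      add_left := fun u v w => by simp [h.add_left]
      smul_left := fun c u v => by
        change (B ((c : ℂ) • u) v).re = _
        rw [h.smul_left]
        simp }
  obtain ⟨m, b, hbY, hbB, hbs⟩ := h'.exists_orthonormal Y' fun u hu hu0 => pos u hu.1 hu0
  refine ⟨m, b, fun k hk => (hbY k hk).1, fun k hk l hl => ?_, ?_, fun k hk => (hbY k hk).2⟩
  · have him : (B (b k) (b l)).im = 0 := by
      have := hB (b k) (b l)
      rw [(hbY k hk).2, (hbY l hl).2] at this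
      exact Complex.conj_eq_iff_im.1 this.symm
    have hre := hbB k hk l hl
    apply Complex.ext
    · rw [hre]; split_ifs <;> simp
    · rw [him]; split_ifs <;> simp
  · have key : ∀ y ∈ Y', y ∈ Submodule.span ℂ (b '' {k | k < m}) := fun y hy =>
      Submodule.span_le_restrictScalars ℝ ℂ _ (hbs hy)
    intro y hy
    have e : y = (1 / 2 : ℂ) • (y + s y) + (-Complex.I / 2) • (Complex.I • (y - s y)) := by
      rw [smul_smul]
      have : -Complex.I / 2 * Complex.I = 1 / 2 := by
        rw [div_mul_eq_mul_div, neg_mul, Complex.I_mul_I, neg_neg]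
      rw [this]
      module
    rw [e]
    refine Submodule.add_mem _ (Submodule.smul_mem _ _ (key _ ⟨Y.add_mem hy (hY y hy), ?_⟩))
      (Submodule.smul_mem _ _ (key _ ⟨Y.smul_mem _ (Y.sub_mem hy (hY y hy)), ?_⟩))
    · rw [map_add, hs, add_comm]
    · rw [LinearMap.map_smulₛₗ, map_sub, hs, Complex.conj_I]
      module

/-- Let a complex conjugation `s` permute a family of subspaces `Y a` through an involution `σ` of
the index set, and let `B a` be compatible positive definite Hermitian forms on the `Y a`. Then the
`Y a` have orthonormal bases that `s` permutes accordingly. For `σ a ≠ a` any orthonormal basis of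
one of the two spaces determines that of the other (`pick` selects one of the two indices), and
for `σ a = a` the basis consists of real vectors. -/
theorem exists_orthonormal_conj [FiniteDimensional ℂ X] {A : Type*} [DecidableEq A]
    (s : X →ₛₗ[starRingEnd ℂ] X) (hs : ∀ x, s (s x) = x)
    (σ : A → A) (hσ : ∀ a, σ (σ a) = a) (pick : A → Prop)
    (hpick : ∀ a, σ a ≠ a → (pick (σ a) ↔ ¬ pick a))
    (Y : A → Submodule ℂ X) (hY : ∀ a, ∀ y ∈ Y a, s y ∈ Y (σ a))
    (B : A → X → X → ℂ) (h : ∀ a, IsHermitianForm (B a))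
    (hB : ∀ a u v, B (σ a) (s u) (s v) = starRingEnd ℂ (B a u v))
    (pos : ∀ a, ∀ u ∈ Y a, u ≠ 0 → 0 < (B a u u).re) :
    ∃ (m : A → ℕ) (b : A → ℕ → X), (∀ a, m (σ a) = m a) ∧ (∀ a, ∀ k < m a, b a k ∈ Y a) ∧
      (∀ a, ∀ k < m a, ∀ l < m a, B a (b a k) (b a l) = if k = l then 1 else 0) ∧
      (∀ a, Y a ≤ Submodule.span ℂ (b a '' {k | k < m a})) ∧
      ∀ a, ∀ k < m a, s (b a k) = b (σ a) k := by
  classical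
  have h1 := fun a => (h a).exists_orthonormal (Y a) (pos a)
  choose m₁ b₁ hm₁ ho₁ hs₁ using h1
  have h2 : ∀ a, ∃ (m : ℕ) (b : ℕ → X), σ a = a → (∀ k < m, b k ∈ Y a) ∧
      (∀ k < m, ∀ l < m, B a (b k) (b l) = if k = l then 1 else 0) ∧
      Y a ≤ Submodule.span ℂ (b '' {k | k < m}) ∧ ∀ k < m, s (b k) = b k := fun a => by
    by_cases ha : σ a = a
    · obtain ⟨m, b, hh⟩ := exists_orthonormal_of_stable (h a) s hs (Y a)
        (fun y hy => by have := hY a y hy; rwa [ha] at this)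
        (fun u v => by have := hB a u v; rwa [ha] at this) (pos a)
      exact ⟨m, b, fun _ => hh⟩
    · exact ⟨0, 0, fun h => absurd h ha⟩
  choose m₂ b₂ hh₂ using h2
  let m : A → ℕ := fun a => if σ a = a then m₂ a else if pick a then m₁ a else m₁ (σ a)
  let b : A → ℕ → X := fun a => if σ a = a then b₂ a else if pick a then b₁ a else
    fun k => s (b₁ (σ a) k)
  -- Fixed indices carry bases of real vectors; of two exchanged indices, the one that `pick`
  -- selects carries an arbitrary basis, and the other one its conjugate.
  have cases : ∀ a, (σ a = a ∧ m a = m₂ a ∧ b a = b₂ a) ∨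
      (σ a ≠ a ∧ pick a ∧ m a = m₁ a ∧ b a = b₁ a) ∨
      (σ a ≠ a ∧ pick (σ a) ∧ m a = m₁ (σ a) ∧ b a = fun k => s (b₁ (σ a) k)) := fun a => by
    by_cases h1 : σ a = a
    · exact Or.inl ⟨h1, if_pos h1, if_pos h1⟩
    · by_cases h2 : pick a
      · refine Or.inr (Or.inl ⟨h1, h2, ?_, ?_⟩) <;> simp only [m, b, if_neg h1, if_pos h2]
      · refine Or.inr (Or.inr ⟨h1, (hpick a h1).2 h2, ?_, ?_⟩) <;>
          simp only [m, b, if_neg h1, if_neg h2]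
  refine ⟨m, b, fun a => ?_, fun a => ?_, fun a => ?_, fun a => ?_, fun a => ?_⟩
  · by_cases h1 : σ a = a
    · rw [h1]
    · have h1' : σ (σ a) ≠ σ a := fun h => h1 (by rw [hσ] at h; exact h.symm)
      have := hpick a h1
      by_cases h2 : pick a <;> simp_all [m]
  · rcases cases a with ⟨h1, hm, hb⟩ | ⟨h1, h2, hm, hb⟩ | ⟨h1, h2, hm, hb⟩ <;> rw [hm, hb]
    · exact (hh₂ a h1).1
    · exact hm₁ a
    · intro k hk
      have := hY _ _ (hm₁ (σ a) k hk)
      rwa [hσ] at this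
  · rcases cases a with ⟨h1, hm, hb⟩ | ⟨h1, h2, hm, hb⟩ | ⟨h1, h2, hm, hb⟩ <;> rw [hm, hb]
    · exact (hh₂ a h1).2.1
    · exact ho₁ a
    · intro k hk l hl
      have := hB (σ a) (b₁ (σ a) k) (b₁ (σ a) l)
      rw [hσ] at this
      rw [this, ho₁ (σ a) k hk l hl]
      split_ifs <;> simp
  · rcases cases a with ⟨h1, hm, hb⟩ | ⟨h1, h2, hm, hb⟩ | ⟨h1, h2, hm, hb⟩ <;> rw [hm, hb]
    · exact (hh₂ a h1).2.2.1
    · exact hs₁ a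
    · intro y hy
      have h3 : s y ∈ Submodule.span ℂ (b₁ (σ a) '' {k | k < m₁ (σ a)}) := hs₁ _ (hY a y hy)
      have h4 := Submodule.mem_map_of_mem (f := s) h3
      rw [hs, Submodule.map_span, ← Set.image_comp] at h4
      exact h4
  · intro k hk
    have h1' : σ a ≠ a → σ (σ a) ≠ σ a := fun h1 h => h1 (by rw [hσ] at h; exact h.symm)
    rcases cases a with ⟨h1, hm, hb⟩ | ⟨h1, h2, hm, hb⟩ | ⟨h1, h2, hm, hb⟩
    · rw [hm] at hk
      rw [hb, h1, hb]
      exact (hh₂ a h1).2.2.2 k hk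
    · rcases cases (σ a) with ⟨h4, -, -⟩ | ⟨-, h3, -⟩ | ⟨-, -, -, hb'⟩
      · exact absurd h4 (h1' h1)
      · exact absurd h2 ((hpick a h1).1 h3)
      · rw [hb, hb', hσ]
    · rcases cases (σ a) with ⟨h3, -, -⟩ | ⟨-, -, -, hb'⟩ | ⟨-, h3, -⟩
      · exact absurd h3 (h1' h1)
      · rw [hb, hb', hs]
      · rw [hσ] at h3
        exact absurd h3 ((hpick a h1).1 h2)

/-! ### The index set of a basis of Jordan strings -/

/-- The bidegrees `(p, q)` in which a Jordan string of a limiting mixed Hodge structure of weight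
`n` may start. -/
noncomputable def tops (n : ℕ) : Finset (ℤ × ℤ) :=
  (Finset.Icc 0 (n : ℤ) ×ˢ Finset.Icc 0 (n : ℤ)).filter fun x => (n : ℤ) ≤ x.1 + x.2

/-- A Jordan string starting in bidegree `x` consists of `len n x + 1` vectors. -/
def len (n : ℕ) (x : ℤ × ℤ) : ℕ := (x.1 + x.2 - n).toNat

/-- Indices of a basis made of `g x` Jordan strings starting in each bidegree `x`. The index
`⟨(p, q), (k, j)⟩` stands for the `j`-th vector, of bidegree `(p - j, q - j)`, in the `k`-th string
starting in bidegree `(p, q)`. -/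
noncomputable def idxFinset (n : ℕ) (g : ℤ × ℤ → ℕ) : Finset (Σ _ : ℤ × ℤ, ℕ × ℕ) :=
  (tops n).sigma fun x => Finset.range (g x) ×ˢ Finset.range (len n x + 1)

/-- The type of the indices in `idxFinset`. -/
abbrev Idx (n : ℕ) (g : ℤ × ℤ → ℕ) : Type := {i // i ∈ idxFinset n g}

namespace Idx

variable {n : ℕ} {g : ℤ × ℤ → ℕ}

/-- The bidegree in which the string starts. -/
def top (i : Idx n g) : ℤ × ℤ := i.1.1

/-- The number of the string among those that start in the same bidegree. -/
def str (i : Idx n g) : ℕ := i.1.2.1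

/-- The position in the string. -/
def ht (i : Idx n g) : ℕ := i.1.2.2

/-- The first entry of the bidegree. -/
def fst (i : Idx n g) : ℤ := i.top.1 - i.ht

/-- The second entry of the bidegree. -/
def snd (i : Idx n g) : ℤ := i.top.2 - i.ht

theorem mem_idxFinset {x : ℤ × ℤ} {k j : ℕ} :
    (⟨x, (k, j)⟩ : Σ _ : ℤ × ℤ, ℕ × ℕ) ∈ idxFinset n g ↔
      ((0 ≤ x.1 ∧ x.1 ≤ n) ∧ (0 ≤ x.2 ∧ x.2 ≤ n) ∧ (n : ℤ) ≤ x.1 + x.2) ∧ k < g x ∧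
        j ≤ len n x := by
  simp [idxFinset, tops, and_assoc]

theorem len_cast {x : ℤ × ℤ} (h : (n : ℤ) ≤ x.1 + x.2) : (len n x : ℤ) = x.1 + x.2 - n := by
  rw [len, Int.toNat_of_nonneg (by omega)]

theorem spec (i : Idx n g) : ((0 ≤ i.top.1 ∧ i.top.1 ≤ n) ∧ (0 ≤ i.top.2 ∧ i.top.2 ≤ n) ∧
    (n : ℤ) ≤ i.top.1 + i.top.2) ∧ i.str < g i.top ∧ i.ht ≤ len n i.top :=
  mem_idxFinset.1 i.2

/-- The numerical constraints on an index, in the form in which `omega` uses them. -/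
theorem bounds (i : Idx n g) : (len n i.top : ℤ) = i.top.1 + i.top.2 - n ∧ i.ht ≤ len n i.top ∧
    0 ≤ i.top.1 ∧ i.top.1 ≤ n ∧ 0 ≤ i.top.2 ∧ i.top.2 ≤ n ∧ i.fst = i.top.1 - i.ht ∧
    i.snd = i.top.2 - i.ht :=
  ⟨len_cast i.spec.1.2.2, i.spec.2.2, i.spec.1.1.1, i.spec.1.1.2, i.spec.1.2.1.1, i.spec.1.2.1.2,
    rfl, rfl⟩

theorem ext' {i i' : Idx n g} (h1 : i.top = i'.top) (h2 : i.str = i'.str) (h3 : i.ht = i'.ht) :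
    i = i' := by
  obtain ⟨⟨x, k, j⟩, hi⟩ := i
  obtain ⟨⟨x', k', j'⟩, hi'⟩ := i'
  simp only [top, str, ht] at h1 h2 h3
  subst h1 h2 h3
  rfl

/-- The reflection of a string about its middle. -/
def refl (i : Idx n g) : Idx n g :=
  ⟨⟨i.top, (i.str, len n i.top - i.ht)⟩,
    mem_idxFinset.2 ⟨i.spec.1, i.spec.2.1, Nat.sub_le _ _⟩⟩

@[simp] theorem refl_top (i : Idx n g) : i.refl.top = i.top := rfl
@[simp] theorem refl_ht (i : Idx n g) : i.refl.ht = len n i.top - i.ht := rfl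

@[simp] theorem refl_refl (i : Idx n g) : i.refl.refl = i :=
  ext' rfl rfl (Nat.sub_sub_self i.spec.2.2)

/-- The index of the complex conjugate vector. -/
def swap (hg : ∀ x, g x.swap = g x) (i : Idx n g) : Idx n g :=
  ⟨⟨i.top.swap, (i.str, i.ht)⟩, mem_idxFinset.2 (by
    obtain ⟨⟨h1, h2, h3⟩, h4, h5⟩ := i.spec
    refine ⟨⟨h2, h1, by simpa [add_comm] using h3⟩, by rwa [hg], ?_⟩
    simpa [len, add_comm] using h5)⟩

variable (hg : ∀ x, g x.swap = g x)

@[simp] theorem swap_top (i : Idx n g) : (i.swap hg).top = i.top.swap := rfl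
@[simp] theorem swap_ht (i : Idx n g) : (i.swap hg).ht = i.ht := rfl
@[simp] theorem swap_fst (i : Idx n g) : (i.swap hg).fst = i.snd := rfl
@[simp] theorem swap_snd (i : Idx n g) : (i.swap hg).snd = i.fst := rfl
@[simp] theorem len_swap (n : ℕ) (x : ℤ × ℤ) : len n x.swap = len n x := by
  simp [len, add_comm]

@[simp] theorem swap_swap (i : Idx n g) : (i.swap hg).swap hg = i := ext' rfl rfl rfl

theorem swap_injective : Function.Injective (swap hg : Idx n g → Idx n g) :=
  Function.LeftInverse.injective (swap_swap hg)

theorem refl_injective : Function.Injective (refl : Idx n g → Idx n g) :=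
  Function.LeftInverse.injective refl_refl

theorem refl_swap (i : Idx n g) : (i.swap hg).refl = i.refl.swap hg :=
  ext' rfl rfl (by simp)

/-- The index `m` steps further down the string. -/
def down (i : Idx n g) (m : ℕ) (h : i.ht + m ≤ len n i.top) : Idx n g :=
  ⟨⟨i.top, (i.str, i.ht + m)⟩, mem_idxFinset.2 ⟨i.spec.1, i.spec.2.1, h⟩⟩

@[simp] theorem down_top (i : Idx n g) (m : ℕ) (h) : (i.down m h).top = i.top := rfl
@[simp] theorem down_ht (i : Idx n g) (m : ℕ) (h) : (i.down m h).ht = i.ht + m := rfl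

/-- The index `m` steps up the string. -/
def up (i : Idx n g) (m : ℕ) : Idx n g :=
  ⟨⟨i.top, (i.str, i.ht - m)⟩, mem_idxFinset.2 ⟨i.spec.1, i.spec.2.1,
    (Nat.sub_le _ _).trans i.spec.2.2⟩⟩

@[simp] theorem up_top (i : Idx n g) (m : ℕ) : (i.up m).top = i.top := rfl
@[simp] theorem up_ht (i : Idx n g) (m : ℕ) : (i.up m).ht = i.ht - m := rfl

/-- The number of basis vectors of bidegree `x`. -/
noncomputable def cnt (n : ℕ) (g : ℤ × ℤ → ℕ) (x : ℤ × ℤ) : ℕ :=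
  (Finset.univ.filter fun i : Idx n g => (i.fst, i.snd) = x).card

theorem cnt_eq_zero {a b : ℤ} (h : a < 0 ∨ n < a ∨ b < 0 ∨ n < b) : cnt n g (a, b) = 0 := by
  rw [cnt, Finset.card_eq_zero, Finset.filter_eq_empty_iff]
  intro i _ hi
  have := i.bounds
  rw [Prod.mk.injEq] at hi
  omega

theorem cnt_antisymm (a b : ℤ) : cnt n g (n - b, n - a) = cnt n g (a, b) := by
  refine Finset.card_nbij' refl refl ?_ ?_ (fun i _ => i.refl_refl) (fun i _ => i.refl_refl)
  all_goals
    intro i hi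
    have hb := i.bounds
    have hb' := i.refl.bounds
    simp only [Finset.coe_filter, Finset.mem_univ, true_and, Set.mem_ofPred_eq,
      Prod.mk.injEq, refl_top, refl_ht] at hi hb' ⊢
    omega

theorem cnt_eq_add {a b : ℤ} (h : (n : ℤ) ≤ a + b) (hg : (a, b) ∉ tops n → g (a, b) = 0) :
    cnt n g (a, b) = g (a, b) + cnt n g (a + 1, b + 1) := by
  classical
  have e : (Finset.univ.filter fun i : Idx n g => (i.fst, i.snd) = (a, b)).card =
      (Finset.univ.filter fun i : Idx n g => i.top = (a, b) ∧ i.ht = 0).card +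
      (Finset.univ.filter fun i : Idx n g => (i.fst, i.snd) = (a, b) ∧ i.ht ≠ 0).card := by
    rw [← Finset.card_filter_add_card_filter_not (p := fun i : Idx n g => i.ht = 0)]
    congr 2
    · ext i
      have := i.bounds
      simp only [Finset.mem_filter, Finset.mem_univ, true_and, Prod.ext_iff]
      omega
    · rw [Finset.filter_filter]
  rw [cnt, e]
  congr 1
  · rw [← Finset.card_range (g (a, b))]
    refine Finset.card_nbij str ?_ ?_ ?_
    · intro i hi
      simp only [Finset.coe_filter, Finset.mem_univ, true_and, Set.mem_ofPred_eq] at hi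
      simpa [hi.1] using i.spec.2.1
    · intro i hi i' hi' hs
      simp only [Finset.coe_filter, Finset.mem_univ, true_and, Set.mem_ofPred_eq] at hi hi'
      exact ext' (hi.1.trans hi'.1.symm) hs (hi.2.trans hi'.2.symm)
    · intro k hk
      have hk' : k < g (a, b) := by simpa using hk
      have ht : (a, b) ∈ tops n := by
        by_contra hh
        rw [hg hh] at hk'
        omega
      have hs : 0 ≤ a ∧ a ≤ n ∧ 0 ≤ b ∧ b ≤ n := by
        simp [tops] at ht
        omega
      exact ⟨⟨⟨(a, b), (k, 0)⟩, mem_idxFinset.2 ⟨⟨⟨hs.1, hs.2.1⟩, hs.2.2, h⟩, hk', Nat.zero_le _⟩⟩,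
        Finset.mem_coe.2 (Finset.mem_filter.2 ⟨Finset.mem_univ _, rfl, rfl⟩), rfl⟩
  · rw [cnt]
    refine Finset.card_bij' (fun i _ => i.up 1) (fun i hi => i.down 1 (by
        have := i.bounds
        simp only [Finset.mem_filter, Finset.mem_univ, true_and, Prod.mk.injEq] at hi
        omega)) ?_ ?_ ?_ ?_
    · intro i hi
      have hb := i.bounds
      have hb' := (i.up 1).bounds
      simp only [Finset.mem_filter, Finset.mem_univ, true_and, Prod.mk.injEq, up_top, up_ht]
        at hi hb' ⊢
      omega
    · intro i hi
      have hb := i.bounds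
      simp only [Finset.mem_filter, Finset.mem_univ, true_and, Prod.mk.injEq] at hi
      have hb' := (i.down 1 (by omega)).bounds
      simp only [Finset.mem_filter, Finset.mem_univ, true_and, Prod.mk.injEq, down_top, down_ht]
        at hi hb' ⊢
      omega
    · intro i hi
      simp only [Finset.mem_filter, Finset.mem_univ, true_and, Prod.mk.injEq] at hi
      exact ext' rfl rfl (by simp; omega)
    · intro i hi
      exact ext' rfl rfl (by simp)

/-- The number of strings that start in each bidegree when the number of basis vectors of
bidegree `x` is to be `f x`. -/
noncomputable def stringsOf (n : ℕ) (f : ℤ × ℤ → ℕ) (x : ℤ × ℤ) : ℕ :=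
  if x ∈ tops n then f x - f (x.1 + 1, x.2 + 1) else 0

theorem cnt_stringsOf {f : ℤ × ℤ → ℕ}
    (h0 : ∀ a b : ℤ, (a < 0 ∨ n < a ∨ b < 0 ∨ n < b) → f (a, b) = 0)
    (anti : ∀ a b : ℤ, f (n - b, n - a) = f (a, b))
    (mono : ∀ a b : ℤ, (n : ℤ) ≤ a + b → f (a + 1, b + 1) ≤ f (a, b)) :
    cnt n (stringsOf n f) = f := by
  have key : ∀ (m : ℕ) (a b : ℤ), (n : ℤ) ≤ a + b → n - a < m →
      cnt n (stringsOf n f) (a, b) = f (a, b) := by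
    intro m
    induction m with
    | zero =>
      intro a b _ h
      rw [cnt_eq_zero (by omega), h0 a b (by omega)]
    | succ m ih =>
      intro a b h h'
      by_cases ht : (a, b) ∈ tops n
      · rw [cnt_eq_add h (fun h => absurd ht h), ih _ _ (by omega) (by omega), stringsOf, if_pos ht]
        have := mono a b h
        dsimp only
        omega
      · have : a < 0 ∨ n < a ∨ b < 0 ∨ n < b := by
          simp [tops] at ht
          by_contra hc
          exact absurd h (not_le.2 (ht (by omega) (by omega) (by omega) (by omega)))
        rw [cnt_eq_zero this, h0 a b this]
  funext ⟨a, b⟩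
  by_cases h : (n : ℤ) ≤ a + b
  · exact key ((n - a).toNat + 1) a b h (by omega)
  · rw [← cnt_antisymm, ← anti]
    exact key ((n - (n - b)).toNat + 1) _ _ (by omega) (by omega)

theorem stringsOf_cnt (hg : ∀ x, x ∉ tops n → g x = 0) : stringsOf n (cnt n g) = g := by
  funext ⟨a, b⟩
  rw [stringsOf]
  split_ifs with h
  · have h' : (n : ℤ) ≤ a + b := by
      simp [tops] at h
      omega
    rw [cnt_eq_add h' (hg _)]
    simp
  · exact (hg _ h).symm

/-- The number of basis vectors whose bidegree has first entry `r`. -/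
noncomputable def col (n : ℕ) (g : ℤ × ℤ → ℕ) (r : ℤ) : ℕ :=
  (Finset.univ.filter fun i : Idx n g => i.fst = r).card

theorem col_eq_sum_cnt (r : ℤ) : col n g r = ∑ b ∈ Finset.Icc 0 (n : ℤ), cnt n g (r, b) := by
  rw [col, Finset.card_eq_sum_card_fiberwise (f := snd) (t := Finset.Icc 0 (n : ℤ))]
  · refine Finset.sum_congr rfl fun b _ => ?_
    rw [cnt, Finset.filter_filter]
    simp only [Prod.mk.injEq]
  · intro i _
    have := i.bounds
    simp only [Finset.coe_Icc, Set.mem_Icc]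
    omega

theorem sum_fst {M : Type*} [AddCommMonoid M] (φ : ℤ → M) :
    ∑ i : Idx n g, φ i.fst = ∑ r ∈ Finset.Icc 0 (n : ℤ), col n g r • φ r := by
  rw [← Finset.sum_fiberwise_of_maps_to (g := fst) (t := Finset.Icc 0 (n : ℤ))]
  · refine Finset.sum_congr rfl fun r _ => ?_
    rw [Finset.sum_congr rfl (g := fun _ => φ r), Finset.sum_const, col]
    intro i hi
    rw [(Finset.mem_filter.1 hi).2]
  · intro i _
    have := i.bounds
    simp only [Finset.mem_Icc]
    omega

theorem card_eq_sum_col : Fintype.card (Idx n g) = ∑ r ∈ Finset.Icc 0 (n : ℤ), col n g r := by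
  have := sum_fst (n := n) (g := g) (fun _ => 1)
  simpa using this

theorem card_le_fst (p : ℤ) : (Finset.univ.filter fun i : Idx n g => p ≤ i.fst).card =
    ∑ r ∈ Finset.Icc p n, col n g r := by
  rw [Finset.card_eq_sum_card_fiberwise (f := fst) (t := Finset.Icc p (n : ℤ))]
  · refine Finset.sum_congr rfl fun b hb => ?_
    rw [Finset.mem_Icc] at hb
    rw [col, Finset.filter_filter]
    congr 1
    ext i
    simp only [Finset.mem_filter, Finset.mem_univ, true_and]
    omega
  · intro i hi
    have := i.bounds
    simp only [Finset.coe_filter, Finset.mem_univ, true_and, Set.mem_ofPred_eq] at hi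
    simp only [Finset.coe_Icc, Set.mem_Icc]
    omega

/-- The sign `Q(c_i, c_i')` in an adapted basis, where `i'` is the index dual to `i`. -/
noncomputable def sgn (i : Idx n g) : ℂ := (-1) ^ i.ht * Complex.I ^ (i.top.2 - i.top.1)

/-- On a string of odd length the signs alternate and sum to the sign of the middle vector, and on
a string of even length they cancel. -/
theorem sum_sgn_refl : ∑ i : Idx n g, (if i.refl = i then starRingEnd ℂ (i.refl.sgn) else 0) =
    ∑ i : Idx n g, Complex.I ^ (2 * i.fst - n) := by
  have hI := Complex.I_ne_zero
  have e1 : ∀ i : Idx n g, (if i.refl = i then starRingEnd ℂ (i.refl.sgn) else 0) =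
      (fun i : (Σ _ : ℤ × ℤ, ℕ × ℕ) => if len n i.1 = 2 * i.2.2 then
        (-1) ^ i.2.2 * Complex.I ^ (i.1.1 - i.1.2) else 0) i.1 := by
    intro i
    have hb := i.bounds
    change _ = if len n i.top = 2 * i.ht then (-1) ^ i.ht * Complex.I ^ (i.top.1 - i.top.2) else 0
    by_cases h : i.refl = i
    · have h' := congrArg ht h
      rw [refl_ht] at h'
      rw [if_pos h, if_pos (by omega), h, sgn, map_mul, map_pow, map_zpow₀, map_neg, map_one,
        Complex.conj_I, ← Complex.inv_I, inv_zpow, ← zpow_neg]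
      congr 2
      ring
    · rw [if_neg h, if_neg]
      intro hl
      exact h (ext' rfl rfl (by rw [refl_ht]; omega))
  have e2 : ∀ i : Idx n g, Complex.I ^ (2 * i.fst - n) =
      (fun i : (Σ _ : ℤ × ℤ, ℕ × ℕ) => Complex.I ^ (2 * (i.1.1 - i.2.2) - (n : ℤ))) i.1 :=
    fun i => rfl
  rw [Finset.sum_congr rfl fun i _ => e1 i, Finset.sum_congr rfl fun i _ => e2 i]
  rw [Finset.univ_eq_attach, Finset.sum_attach (idxFinset n g) fun i =>
      if len n i.1 = 2 * i.2.2 then (-1) ^ i.2.2 * Complex.I ^ (i.1.1 - i.1.2) else 0,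
    Finset.sum_attach (idxFinset n g) fun i => Complex.I ^ (2 * (i.1.1 - i.2.2) - (n : ℤ)),
    idxFinset, Finset.sum_sigma, Finset.sum_sigma]
  refine Finset.sum_congr rfl fun x hx => ?_
  rw [Finset.sum_product, Finset.sum_product]
  refine Finset.sum_congr rfl fun k _ => ?_
  dsimp only
  have hx' : (n : ℤ) ≤ x.1 + x.2 := (Finset.mem_filter.1 hx).2
  have hl := len_cast hx'
  have e3 : ∀ j : ℕ, Complex.I ^ (2 * (x.1 - (j : ℤ)) - (n : ℤ)) =
      Complex.I ^ (x.1 - x.2) * Complex.I ^ (len n x) * (-1) ^ j := by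
    intro j
    have h1 : (-1 : ℂ) ^ j = Complex.I ^ (-2 * (j : ℤ)) := by
      rw [zpow_mul]
      have : Complex.I ^ (-2 : ℤ) = -1 := by
        rw [zpow_neg]
        norm_num [zpow_two]
      rw [this, zpow_natCast]
    rw [h1, ← zpow_natCast, hl, ← zpow_add₀ hI, ← zpow_add₀ hI]
    congr 1
    ring
  rw [Finset.sum_congr rfl fun j _ => e3 j, ← Finset.mul_sum, neg_one_geom_sum]
  rcases Nat.even_or_odd' (len n x) with ⟨m, hm | hm⟩
  · rw [Finset.sum_eq_single m, if_pos hm, if_neg (by simp [hm, parity_simps]), hm, pow_mul,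
      Complex.I_sq]
    · ring
    · intro j _ hj
      rw [if_neg (by omega)]
    · intro hh
      simp at hh
      omega
  · rw [if_pos (by simp [hm, parity_simps]), mul_zero]
    refine Finset.sum_eq_zero fun j _ => if_neg (by omega)

end Idx

/-! ### Subspaces spanned by parts of a basis -/

section SpanPart

variable {X ι : Type*} [AddCommGroup X] [Module ℂ X]

/-- The span of the basis vectors with index in `A`. -/
noncomputable def spanPart (c : Module.Basis ι ℂ X) (A : Set ι) : Submodule ℂ X :=
  Submodule.span ℂ (c '' A)

variable (c : Module.Basis ι ℂ X)

theorem mem_spanPart {A : Set ι} {x : X} :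
    x ∈ spanPart c A ↔ ∀ i, c.repr x i ≠ 0 → i ∈ A := by
  rw [spanPart, Module.Basis.mem_span_image]
  simp [Set.subset_def]

theorem spanPart_inf (A B : Set ι) : spanPart c A ⊓ spanPart c B = spanPart c (A ∩ B) := by
  ext x
  simp only [Submodule.mem_inf, mem_spanPart, Set.mem_inter_iff]
  exact ⟨fun h i hi => ⟨h.1 i hi, h.2 i hi⟩,
    fun h => ⟨fun i hi => (h i hi).1, fun i hi => (h i hi).2⟩⟩

theorem spanPart_sup (A B : Set ι) : spanPart c A ⊔ spanPart c B = spanPart c (A ∪ B) := by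
  rw [spanPart, spanPart, spanPart, Set.image_union, Submodule.span_union]

theorem spanPart_iSup {κ : Type*} (A : κ → Set ι) :
    ⨆ k, spanPart c (A k) = spanPart c (⋃ k, A k) := by
  simp only [spanPart, Set.image_iUnion, Submodule.span_iUnion]

theorem spanPart_mono {A B : Set ι} (h : A ⊆ B) : spanPart c A ≤ spanPart c B :=
  Submodule.span_mono (Set.image_mono h)

theorem spanPart_univ {A : Set ι} (h : ∀ i, i ∈ A) : spanPart c A = ⊤ := by
  rw [Set.eq_univ_of_forall h, spanPart, Set.image_univ, c.span_eq]

theorem spanPart_empty {A : Set ι} (h : ∀ i, i ∉ A) : spanPart c A = ⊥ := by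
  rw [Set.eq_empty_of_forall_notMem h, spanPart, Set.image_empty, Submodule.span_empty]

theorem finrank_spanPart [Fintype ι] (P : ι → Prop) [DecidablePred P] :
    Module.finrank ℂ (spanPart c {i | P i}) = (Finset.univ.filter P).card := by
  have e : c '' {i | P i} = Set.range (c ∘ Subtype.val : {i // P i} → X) := by
    ext x
    simp
  rw [spanPart, e, finrank_span_eq_card (c.linearIndependent.comp _ Subtype.val_injective),
    Fintype.card_subtype]

@[elab_as_elim]
theorem basis_induction {P : X → Prop} (x : X) (zero : P 0) (basis : ∀ i, P (c i))
    (add : ∀ x y, P x → P y → P (x + y)) (smul : ∀ (a : ℂ) x, P x → P (a • x)) : P x :=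
  Submodule.span_induction (p := fun x _ => P x) (by rintro _ ⟨i, rfl⟩; exact basis i) zero
    (fun x y _ _ => add x y) (fun a x _ => smul a x) (c.mem_span x)

end SpanPart

/-! ### From an adapted basis to a polarized mixed Hodge structure -/

section Adapted

variable {E : Type*} [AddCommGroup E] [Module ℝ E] {n : ℕ} {g : ℤ × ℤ → ℕ}

/-- A basis of `E_ℂ` indexed by Jordan strings is adapted to the real structure and to `Q` if
conjugation exchanges the strings starting in bidegrees `(p, q)` and `(q, p)`, and each string is
paired with the conjugate string, read backwards, with the signs `sgn`. -/
structure IsAdapted (Q : LinearMap.BilinForm ℝ E) (hg : ∀ x, g x.swap = g x)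
    (c : Module.Basis (Idx n g) ℂ (Cx E)) : Prop where
  conj_basis : ∀ i, conj (c i) = c (i.swap hg)
  form_basis : ∀ i i', Q.baseChange ℂ (c i) (c i') = if i' = i.refl.swap hg then i.sgn else 0

/-- The nilpotent operator that moves each basis vector one step down its Jordan string. -/
noncomputable def stringShift (c : Module.Basis (Idx n g) ℂ (Cx E)) : Module.End ℂ (Cx E) :=
  c.constr ℂ fun i => if h : i.ht + 1 ≤ len n i.top then c (i.down 1 h) else 0

theorem stringShift_basis (c : Module.Basis (Idx n g) ℂ (Cx E)) (i : Idx n g) :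
    stringShift c (c i) = if h : i.ht + 1 ≤ len n i.top then c (i.down 1 h) else 0 := by
  rw [stringShift, Module.Basis.constr_basis]

theorem stringShift_pow_basis (c : Module.Basis (Idx n g) ℂ (Cx E)) (m : ℕ) (i : Idx n g) :
    (stringShift c ^ m) (c i) = if h : i.ht + m ≤ len n i.top then c (i.down m h) else 0 := by
  induction m with
  | zero => simp [Idx.down, i.spec.2.2]; rfl
  | succ m ih =>
    rw [pow_succ', Module.End.mul_apply, ih]
    by_cases h : i.ht + m ≤ len n i.top
    · rw [dif_pos h, stringShift_basis]
      by_cases h' : i.ht + (m + 1) ≤ len n i.top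
      · rw [dif_pos h', dif_pos (by simpa [add_assoc] using h')]
        rfl
      · rw [dif_neg h', dif_neg (by simpa [add_assoc] using h')]
    · rw [dif_neg h, dif_neg (by omega), map_zero]

theorem repr_stringShift_pow (c : Module.Basis (Idx n g) ℂ (Cx E)) (m : ℕ) (x : Cx E)
    (i : Idx n g) :
    c.repr ((stringShift c ^ m) x) i = if m ≤ i.ht then c.repr x (i.up m) else 0 := by
  induction x using basis_induction c with
  | zero => simp
  | add x y hx hy =>
    rw [map_add, map_add, Finsupp.add_apply, hx, hy, map_add, Finsupp.add_apply]
    split_ifs <;> simp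
  | smul a x hx =>
    rw [map_smul, map_smul, Finsupp.smul_apply, hx, map_smul, Finsupp.smul_apply]
    split_ifs <;> simp
  | basis i' =>
    rw [stringShift_pow_basis, Module.Basis.repr_self]
    have hi := i.spec.2.2
    by_cases h : i'.ht + m ≤ len n i'.top
    · rw [dif_pos h, Module.Basis.repr_self]
      by_cases e : i'.down m h = i
      · subst e
        rw [Finsupp.single_eq_same, if_pos (by simp),
          show (i'.down m h).up m = i' from Idx.ext' rfl rfl (by simp), Finsupp.single_eq_same]
      · rw [Finsupp.single_apply, if_neg e]
        split_ifs with h2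
        · rw [Finsupp.single_apply, if_neg]
          rintro rfl
          exact e (Idx.ext' rfl rfl (by simp [h2]))
        · rfl
    · rw [dif_neg h, map_zero, Finsupp.zero_apply]
      split_ifs with h2
      · rw [Finsupp.single_apply, if_neg]
        rintro rfl
        simp only [Idx.up_ht, Idx.up_top] at h
        omega
      · rfl

theorem comap_stringShift_pow (c : Module.Basis (Idx n g) ℂ (Cx E)) (m : ℕ) (A : Set (Idx n g)) :
    (spanPart c A).comap (stringShift c ^ m) =
      spanPart c {i | ∀ h : i.ht + m ≤ len n i.top, i.down m h ∈ A} := by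
  ext x
  simp only [Submodule.mem_comap, mem_spanPart, repr_stringShift_pow, Set.mem_ofPred_eq]
  constructor
  · intro hx i hi h
    refine hx _ ?_
    rw [if_pos (by simp), show (i.down m h).up m = i from Idx.ext' rfl rfl (by simp)]
    exact hi
  · intro hx i hi
    have hle := i.spec.2.2
    split_ifs at hi with h
    · have := hx _ hi (by simp only [Idx.up_ht, Idx.up_top]; omega)
      rwa [show (i.up m).down m _ = i from Idx.ext' rfl rfl (by simp [h])] at this
    · exact absurd rfl hi

namespace IsAdapted

variable {Q : LinearMap.BilinForm ℝ E} {hg : ∀ x, g x.swap = g x}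
  {c : Module.Basis (Idx n g) ℂ (Cx E)} (hc : IsAdapted Q hg c)
include hc

theorem repr_conj (x : Cx E) (i : Idx n g) :
    c.repr (conj x) i = starRingEnd ℂ (c.repr x (i.swap hg)) := by
  induction x using basis_induction c with
  | zero => simp
  | add x y hx hy => simp only [map_add, Finsupp.add_apply, hx, hy]
  | smul a x hx => simp [LinearMap.map_smulₛₗ, hx]
  | basis i' =>
    rw [hc.conj_basis, Module.Basis.repr_self, Module.Basis.repr_self, Finsupp.single_apply,
      Finsupp.single_apply]
    by_cases e : i'.swap hg = i
    · rw [if_pos e, if_pos (by rw [← e, Idx.swap_swap]), map_one]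
    · rw [if_neg e, if_neg (fun h => e (by rw [h, Idx.swap_swap])), map_zero]

theorem conjSub_spanPart (A : Set (Idx n g)) :
    conjSub (spanPart c A) = spanPart c {i | i.swap hg ∈ A} := by
  ext x
  change conj x ∈ spanPart c A ↔ _
  simp only [mem_spanPart, hc.repr_conj, Set.mem_ofPred_eq]
  constructor
  · intro h i hi
    exact h _ (by simpa using hi)
  · intro h i hi
    have := h (i.swap hg) (by simpa using hi)
    simpa using this

theorem form_eq_sum (x y : Cx E) : Q.baseChange ℂ x y =
    ∑ i, c.repr x i * c.repr y (i.refl.swap hg) * i.sgn := by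
  induction x using basis_induction c with
  | zero => simp
  | add x x' hx hx' =>
    simp only [map_add, LinearMap.add_apply, Finsupp.add_apply, hx, hx', add_mul,
      Finset.sum_add_distrib]
  | smul a x hx =>
    simp only [map_smul, LinearMap.smul_apply, Finsupp.smul_apply, hx, smul_eq_mul, mul_assoc,
      Finset.mul_sum]
  | basis i₀ =>
    rw [Finset.sum_eq_single i₀ (fun i _ hi => by simp [hi.symm])
      (fun h => absurd (Finset.mem_univ _) h)]
    induction y using basis_induction c with
    | zero => simp
    | add y y' hy hy' => simp only [map_add, Finsupp.add_apply, hy, hy', mul_add, add_mul]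
    | smul a y hy =>
      simp only [map_smul, Finsupp.smul_apply, hy, smul_eq_mul]
      ring
    | basis i' =>
      rw [hc.form_basis, Module.Basis.repr_self, Module.Basis.repr_self, Finsupp.single_eq_same,
        Finsupp.single_apply]
      split_ifs <;> simp

theorem conj_stringShift (x : Cx E) : conj (stringShift c x) = stringShift c (conj x) := by
  apply c.repr.injective
  ext i
  have h := fun x => repr_stringShift_pow c 1 x
  simp only [pow_one] at h
  rw [hc.repr_conj, h, h, Idx.swap_ht]
  split_ifs
  · rw [hc.repr_conj]
    rfl
  · simp

end IsAdapted

end Adapted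

section Standard

variable {E : Type*} [AddCommGroup E] [Module ℝ E] {n : ℕ} {g : ℤ × ℤ → ℕ}

/-- The Hodge filtration defined by the bidegrees of an adapted basis. -/
noncomputable def stdF (c : Module.Basis (Idx n g) ℂ (Cx E)) (p : ℤ) : Submodule ℂ (Cx E) :=
  spanPart c {i | p ≤ i.fst}

/-- The weight filtration defined by the bidegrees of an adapted basis. -/
noncomputable def stdW (c : Module.Basis (Idx n g) ℂ (Cx E)) (k : ℤ) : Submodule ℝ E :=
  realPoints (spanPart c {i | i.fst + i.snd ≤ k})

/-- The real nilpotent operator that moves down the strings of an adapted basis. -/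
noncomputable def stdN (c : Module.Basis (Idx n g) ℂ (Cx E)) : Module.End ℝ E :=
  descend (stringShift c)

namespace IsAdapted

variable {Q : LinearMap.BilinForm ℝ E} {hg : ∀ x, g x.swap = g x}
  {c : Module.Basis (Idx n g) ℂ (Cx E)} (hc : IsAdapted Q hg c)
include hc

theorem baseChange_stdN : (stdN c).baseChange ℂ = stringShift c :=
  baseChange_descend hc.conj_stringShift

theorem baseChange_stdN_pow (m : ℕ) : (stdN c ^ m).baseChange ℂ = stringShift c ^ m := by
  rw [LinearMap.baseChange_pow, hc.baseChange_stdN]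

theorem baseChange_stdW (k : ℤ) :
    (stdW c k).baseChange ℂ = spanPart c {i | i.fst + i.snd ≤ k} := by
  refine baseChange_realPoints ?_
  rw [hc.conjSub_spanPart]
  congr 1
  ext i
  simp only [Set.mem_ofPred_eq, Idx.swap_fst, Idx.swap_snd]
  omega

theorem baseChange_primitive (ℓ : ℕ) : (primitive n (stdW c) (stdN c) ℓ).baseChange ℂ =
    spanPart c {i | i.fst + i.snd ≤ n + ℓ - 1 ∨ (i.fst + i.snd = n + ℓ ∧ i.ht = 0)} := by
  rw [primitive, baseChange_inf, baseChange_comap, hc.baseChange_stdN_pow, hc.baseChange_stdW,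
    hc.baseChange_stdW, comap_stringShift_pow, spanPart_inf]
  congr 1
  ext i
  have hb := i.bounds
  simp only [Set.mem_inter_iff, Set.mem_ofPred_eq]
  constructor
  · rintro ⟨h1, h2⟩
    by_cases h : i.ht + (ℓ + 1) ≤ len n i.top
    · have h3 := h2 h
      have hb' := (i.down _ h).bounds
      simp only [Idx.down_top, Idx.down_ht] at hb'
      omega
    · omega
  · intro h1
    refine ⟨by omega, fun h => ?_⟩
    have hb' := (i.down _ h).bounds
    simp only [Idx.down_top, Idx.down_ht] at hb'
    omega

theorem skew (u v : E) : Q (stdN c u) v + Q u (stdN c v) = 0 := by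
  have key : ∀ x y,
      Q.baseChange ℂ (stringShift c x) y + Q.baseChange ℂ x (stringShift c y) = 0 := by
    intro x y
    induction x using basis_induction c with
    | zero => simp
    | add x x' hx hx' =>
      simp only [map_add, LinearMap.add_apply]
      linear_combination hx + hx'
    | smul a x hx =>
      simp only [map_smul, LinearMap.smul_apply, smul_eq_mul]
      linear_combination a * hx
    | basis i =>
      induction y using basis_induction c with
      | zero => simp
      | add y y' hy hy' =>
        simp only [map_add]
        linear_combination hy + hy'
      | smul a y hy =>
        simp only [map_smul, smul_eq_mul]
        linear_combination a * hy
      | basis i' =>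
        have hb := i.bounds
        have hb' := i'.bounds
        rw [stringShift_basis, stringShift_basis]
        by_cases hs : i'.top = i.top.swap ∧ i'.str = i.str ∧ i'.ht + i.ht + 1 = len n i.top
        · obtain ⟨h1, h2, h3⟩ := hs
          have h4 : len n i'.top = len n i.top := by rw [h1, Idx.len_swap]
          have l1 : i.ht + 1 ≤ len n i.top := by omega
          have l2 : i'.ht + 1 ≤ len n i'.top := by omega
          have e1 : i' = (i.down 1 l1).refl.swap hg := Idx.ext' h1 h2 (by simp; omega)
          have e2 : i'.down 1 l2 = i.refl.swap hg := Idx.ext' h1 h2 (by simp; omega)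
          rw [dif_pos l1, dif_pos l2, hc.form_basis, hc.form_basis, if_pos e1, if_pos e2, Idx.sgn,
            Idx.sgn, Idx.down_ht, Idx.down_top, pow_succ]
          ring
        · have z1 : ∀ h, Q.baseChange ℂ (c (i.down 1 h)) (c i') = 0 := fun h => by
            rw [hc.form_basis, if_neg]
            rintro rfl
            refine hs ⟨rfl, rfl, ?_⟩
            simp
            omega
          have z2 : ∀ h, Q.baseChange ℂ (c i) (c (i'.down 1 h)) = 0 := fun h => by
            rw [hc.form_basis, if_neg]
            intro he
            have e1 := congrArg Idx.top he
            have e2 := congrArg Idx.str he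
            have e3 := congrArg Idx.ht he
            simp at e1 e2 e3
            refine hs ⟨e1, e2, by omega⟩
          split_ifs <;> simp [z1, z2]
  have := key (1 ⊗ₜ u) (1 ⊗ₜ v)
  rw [← hc.baseChange_stdN, LinearMap.baseChange_tmul, LinearMap.baseChange_tmul,
    baseChange_one_tmul, baseChange_one_tmul] at this
  exact_mod_cast this

theorem nilpotent : stdN c ^ (n + 1) = 0 := by
  ext u
  apply one_tmul_injective
  rw [← LinearMap.baseChange_tmul, hc.baseChange_stdN_pow]
  apply c.repr.injective
  ext i
  have hb := i.bounds
  rw [repr_stringShift_pow, if_neg (by omega)]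
  simp

theorem stdN_mem_stdW {k : ℤ} {v : E} (hv : v ∈ stdW c k) : stdN c v ∈ stdW c (k - 2) := by
  have h : stdW c k ≤ (stdW c (k - 2)).comap (stdN c ^ 1) := by
    intro v hv
    rw [← one_tmul_mem_baseChange, baseChange_comap, hc.baseChange_stdN_pow,
      hc.baseChange_stdW, comap_stringShift_pow]
    rw [← one_tmul_mem_baseChange, hc.baseChange_stdW] at hv
    refine spanPart_mono c ?_ hv
    intro i hi h
    have hb := i.bounds
    have hb' := (i.down _ h).bounds
    simp only [Set.mem_ofPred_eq, Idx.down_top, Idx.down_ht] at hi hb' ⊢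
    omega
  have := h hv
  rwa [pow_one] at this

theorem stdW_gr_injective (ℓ : ℕ) {v : E} (hv : v ∈ stdW c (ℓ + n))
    (hv' : (stdN c ^ ℓ) v ∈ stdW c (-ℓ - 1 + n)) : v ∈ stdW c (ℓ - 1 + n) := by
  have h : v ∈ stdW c (ℓ + n) ⊓ (stdW c (-ℓ - 1 + n)).comap (stdN c ^ ℓ) := ⟨hv, hv'⟩
  rw [← one_tmul_mem_baseChange, baseChange_inf, baseChange_comap, hc.baseChange_stdN_pow,
    hc.baseChange_stdW, hc.baseChange_stdW, comap_stringShift_pow, spanPart_inf] at h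
  rw [← one_tmul_mem_baseChange, hc.baseChange_stdW]
  refine spanPart_mono c (fun i hi => ?_) h
  obtain ⟨hi1, hi2⟩ := hi
  have hb := i.bounds
  simp only [Set.mem_ofPred_eq] at hi1 ⊢
  by_contra hne
  have hl : i.ht + ℓ ≤ len n i.top := by omega
  have hb' := (i.down _ hl).bounds
  have := hi2 hl
  simp only [Set.mem_ofPred_eq, Idx.down_top, Idx.down_ht] at hb' this
  omega

theorem stdW_gr_surjective (ℓ : ℕ) {u : E} (hu : u ∈ stdW c (-ℓ + n)) :
    ∃ v ∈ stdW c (ℓ + n), (stdN c ^ ℓ) v = u := by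
  rw [← one_tmul_mem_baseChange, hc.baseChange_stdW] at hu
  have h : ∃ x ∈ spanPart c {i : Idx n g | i.fst + i.snd ≤ ℓ + n},
      (stringShift c ^ ℓ) x = 1 ⊗ₜ u := by
    rw [← Submodule.mem_map, spanPart, Submodule.map_span]
    refine Submodule.span_mono ?_ hu
    rintro _ ⟨i, hi, rfl⟩
    have hb := i.bounds
    have hb' := (i.up ℓ).bounds
    simp only [Set.mem_ofPred_eq, Idx.up_top, Idx.up_ht] at hi hb'
    refine ⟨c (i.up ℓ), ⟨i.up ℓ, ?_, rfl⟩, ?_⟩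
    · simp only [Set.mem_ofPred_eq]
      omega
    · have hl : (i.up ℓ).ht + ℓ ≤ len n (i.up ℓ).top := by
        simp only [Idx.up_top, Idx.up_ht]
        omega
      rw [stringShift_pow_basis, dif_pos hl]
      congr 1
      exact Idx.ext' rfl rfl (by simp; omega)
  obtain ⟨x, hx, hxu⟩ := h
  rw [← hc.baseChange_stdW, mem_baseChange] at hx
  refine ⟨rePart x, hx.1, ?_⟩
  have e := congrArg rePart hxu
  rwa [← hc.baseChange_stdN_pow, rePart_baseChange, rePart_tmul, Complex.one_re, one_smul] at e

omit hc in
theorem stdW_mono {k l : ℤ} (h : k ≤ l) : stdW c k ≤ stdW c l := fun _ hu =>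
  spanPart_mono c (fun _ (hi : _ ≤ _) => hi.trans h) hu

theorem stdW_eq_bot {k : ℤ} (hk : k < 0) : stdW c k = ⊥ := by
  apply baseChange_injective
  rw [hc.baseChange_stdW, Submodule.baseChange_bot, spanPart_empty]
  intro i
  have := i.bounds
  simp only [Set.mem_ofPred_eq]
  omega

theorem stdW_eq_top {k : ℤ} (hk : 2 * n ≤ k) : stdW c k = ⊤ := by
  apply baseChange_injective
  rw [hc.baseChange_stdW, Submodule.baseChange_top, spanPart_univ]
  intro i
  have := i.bounds
  simp only [Set.mem_ofPred_eq]
  omega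

theorem isJacobsonMorosov : IsJacobsonMorosov (stdN c) (fun ℓ => stdW c (ℓ + n)) where
  mono _ _ hkl := stdW_mono (by omega)
  exists_bot := ⟨-n - 1, hc.stdW_eq_bot (by omega)⟩
  exists_top := ⟨n, hc.stdW_eq_top (by omega)⟩
  shift ℓ v hv := by
    have := hc.stdN_mem_stdW hv
    rwa [show ℓ + n - 2 = ℓ - 2 + n by omega] at this
  gr_injective ℓ v hv hv' := hc.stdW_gr_injective ℓ hv hv'
  gr_surjective ℓ u hu := by
    obtain ⟨v, hv, rfl⟩ := hc.stdW_gr_surjective ℓ hu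
    exact ⟨v, hv, by rw [sub_self]; exact Submodule.zero_mem _⟩

omit hc in
theorem inducedFil_eq {A B : Submodule ℝ E} {a b : Set (Idx n g)}
    (hA : A.baseChange ℂ = spanPart c a) (hB : B.baseChange ℂ = spanPart c b) (p : ℤ) :
    inducedFil A B (stdF c) p = spanPart c ({i | p ≤ i.fst} ∩ b ∪ a) := by
  rw [inducedFil, hA, hB, stdF, spanPart_inf, spanPart_sup]

theorem hodgePiece_eq {A B : Submodule ℝ E} {a b : Set (Idx n g)}
    (hA : A.baseChange ℂ = spanPart c a) (hB : B.baseChange ℂ = spanPart c b) (p q : ℤ) :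
    hodgePiece A B (stdF c) p q = spanPart c (({i | p ≤ i.fst} ∩ b ∪ a) ∩
      {i | i.swap hg ∈ {i | q ≤ i.fst} ∩ b ∪ a}) := by
  rw [hodgePiece, inducedFil_eq hA hB, inducedFil_eq hA hB, hc.conjSub_spanPart,
    spanPart_inf]

/-- The induced Hodge structures on subquotients spanned by basis vectors that all have the
weight `k`. -/
theorem inducesHodgeStructure {A B : Submodule ℝ E} {a b : Set (Idx n g)}
    (hA : A.baseChange ℂ = spanPart c a) (hB : B.baseChange ℂ = spanPart c b) (hab : a ⊆ b)
    (ha : ∀ i, i.swap hg ∈ a ↔ i ∈ a) (hb : ∀ i, i.swap hg ∈ b ↔ i ∈ b) {k : ℤ}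
    (hk : ∀ i ∈ b, i ∉ a → i.fst + i.snd = k) :
    InducesHodgeStructure k A B (stdF c) := by
  intro p
  rw [inducedFil_eq hA hB, inducedFil_eq hA hB, hc.conjSub_spanPart, spanPart_inf,
    spanPart_sup, hA, hB]
  constructor <;> congr 1 <;> ext i <;>
    simp only [Set.mem_inter_iff, Set.mem_union, Set.mem_ofPred_eq, ha, hb, Idx.swap_fst]
  · constructor
    · rintro ⟨⟨h1, h2⟩ | h1, h3⟩
      · rcases h3 with ⟨h3, -⟩ | h3
        · by_contra hia
          have := hk i h2 hia
          omega
        · exact h3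
      · exact h1
    · exact fun h => ⟨Or.inr h, Or.inr h⟩
  · constructor
    · rintro ((⟨-, h⟩ | h) | (⟨-, h⟩ | h))
      · exact h
      · exact hab h
      · exact h
      · exact hab h
    · intro hib
      by_cases hia : i ∈ a
      · exact Or.inl (Or.inr hia)
      · have := hk i hib hia
        by_cases hp : p ≤ i.fst
        · exact Or.inl (Or.inl ⟨hp, hib⟩)
        · exact Or.inr (Or.inl ⟨by omega, hib⟩)

theorem mixed (ℓ : ℤ) : InducesHodgeStructure ℓ (stdW c (ℓ - 1)) (stdW c ℓ) (stdF c) := by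
  refine hc.inducesHodgeStructure (hc.baseChange_stdW _) (hc.baseChange_stdW _) ?_ ?_ ?_ ?_
  · intro i
    simp only [Set.mem_ofPred_eq]
    omega
  all_goals
    intro i
    simp only [Set.mem_ofPred_eq, Idx.swap_fst, Idx.swap_snd]
    omega

theorem primitive_hodge (ℓ : ℕ) : InducesHodgeStructure (n + ℓ) (stdW c (n + ℓ - 1))
    (primitive n (stdW c) (stdN c) ℓ) (stdF c) := by
  refine hc.inducesHodgeStructure (hc.baseChange_stdW _) (hc.baseChange_primitive _) ?_ ?_ ?_ ?_
  · intro i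
    simp only [Set.mem_ofPred_eq]
    omega
  all_goals
    intro i
    simp only [Set.mem_ofPred_eq, Idx.swap_fst, Idx.swap_snd, Idx.swap_ht]
    omega

theorem mem_hodgePiece_primitive {ℓ : ℕ} {p q : ℤ} (hpq : p + q = n + ℓ) {v : Cx E}
    (hv : v ∈ hodgePiece (stdW c (n + ℓ - 1)) (primitive n (stdW c) (stdN c) ℓ) (stdF c) p q)
    {i : Idx n g} (hi : c.repr v i ≠ 0) :
    i.fst + i.snd ≤ n + ℓ - 1 ∨ (i.ht = 0 ∧ i.top.1 = p ∧ i.top.2 = q) := by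
  rw [hc.hodgePiece_eq (hc.baseChange_stdW _) (hc.baseChange_primitive _), mem_spanPart] at hv
  have := hv i hi
  have hb := i.bounds
  simp only [Set.mem_inter_iff, Set.mem_union, Set.mem_ofPred_eq, Idx.swap_fst, Idx.swap_snd,
    Idx.swap_ht] at this
  omega

theorem form_compRight_eq_sum (ℓ : ℕ) (v w : Cx E) :
    LinearMap.BilinForm.baseChange ℂ (Q.compRight (stdN c ^ ℓ)) v w =
      ∑ i : Idx n g, c.repr v i *
        (if ℓ ≤ len n i.top - i.ht then c.repr w ((i.refl.swap hg).up ℓ) else 0) * i.sgn := by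
  rw [form_compRight, hc.baseChange_stdN_pow, hc.form_eq_sum]
  simp only [repr_stringShift_pow]
  rfl

theorem polarized_orthogonal (ℓ : ℕ) (p q r s : ℤ) (hpq : p + q = n + ℓ) (hrs : r + s = n + ℓ)
    (hne : (p, q) ≠ (s, r)) {v w : Cx E}
    (hv : v ∈ hodgePiece (stdW c (n + ℓ - 1)) (primitive n (stdW c) (stdN c) ℓ) (stdF c) p q)
    (hw : w ∈ hodgePiece (stdW c (n + ℓ - 1)) (primitive n (stdW c) (stdN c) ℓ) (stdF c) r s) :
    LinearMap.BilinForm.baseChange ℂ (Q.compRight (stdN c ^ ℓ)) v w = 0 := by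
  rw [hc.form_compRight_eq_sum]
  refine Finset.sum_eq_zero fun i _ => ?_
  split_ifs with hle
  · by_cases hvi : c.repr v i = 0
    · simp [hvi]
    by_cases hwi : c.repr w ((i.refl.swap hg).up ℓ) = 0
    · simp [hwi]
    exfalso
    have h1 := hc.mem_hodgePiece_primitive hpq hv hvi
    have h2 := hc.mem_hodgePiece_primitive hrs hw hwi
    have b1 := i.bounds
    have b2 := ((i.refl.swap hg).up ℓ).bounds
    simp only [Idx.up_top, Idx.up_ht, Idx.swap_top, Idx.swap_ht, Idx.refl_top, Idx.refl_ht,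
      Prod.fst_swap, Prod.snd_swap, Idx.len_swap] at h2 b2
    rw [ne_eq, Prod.mk.injEq] at hne
    omega
  · simp

theorem polarized_eq_sum (ℓ : ℕ) (p q : ℤ) (hpq : p + q = n + ℓ) {v : Cx E}
    (hv : v ∈ hodgePiece (stdW c (n + ℓ - 1)) (primitive n (stdW c) (stdN c) ℓ) (stdF c) p q) :
    Complex.I ^ (p - q) * LinearMap.BilinForm.baseChange ℂ (Q.compRight (stdN c ^ ℓ)) v (conj v) =
      ((∑ i : Idx n g,
        if i.fst + i.snd = n + ℓ then Complex.normSq (c.repr v i) else 0 : ℝ) : ℂ) := by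
  rw [hc.form_compRight_eq_sum, Finset.mul_sum, Complex.ofReal_sum]
  refine Finset.sum_congr rfl fun i _ => ?_
  by_cases hvi : c.repr v i = 0
  · simp [hvi]
  have h1 := hc.mem_hodgePiece_primitive hpq hv hvi
  have b1 := i.bounds
  by_cases hw : i.fst + i.snd = n + ℓ
  · rw [if_pos hw, if_pos (by omega), hc.repr_conj,
      show ((i.refl.swap hg).up ℓ).swap hg = i from Idx.ext' rfl rfl (by simp; omega), Idx.sgn,
      show i.ht = 0 by omega, pow_zero, one_mul, mul_comm, mul_assoc, ← zpow_add₀ Complex.I_ne_zero,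
      show i.top.2 - i.top.1 + (p - q) = 0 by omega, zpow_zero, mul_one, Complex.mul_conj]
  · rw [if_neg hw, Complex.ofReal_zero]
    split_ifs with hle
    · by_cases hwi : c.repr v (((i.refl.swap hg).up ℓ).swap hg) = 0
      · simp [hc.repr_conj, hwi]
      exfalso
      have h2 := hc.mem_hodgePiece_primitive hpq hv hwi
      have b2 := (((i.refl.swap hg).up ℓ).swap hg).bounds
      simp only [Idx.up_top, Idx.up_ht, Idx.swap_top, Idx.swap_ht, Idx.refl_top, Idx.refl_ht,
        Prod.swap_swap] at h2 b2
      omega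
    · simp

theorem primitive_polarized (ℓ : ℕ) : IsPolarizedBy (n + ℓ) (stdW c (n + ℓ - 1))
    (primitive n (stdW c) (stdN c) ℓ) (stdF c) (Q.compRight (stdN c ^ ℓ)) where
  orthogonal p q r s hpq hrs hne v hv w hw := hc.polarized_orthogonal ℓ p q r s hpq hrs hne hv hw
  positive p q hpq v hv hvA := by
    rw [hc.polarized_eq_sum ℓ p q hpq hv, Complex.ofReal_im, Complex.ofReal_re]
    refine ⟨rfl, ?_⟩
    rw [hc.baseChange_stdW, mem_spanPart] at hvA
    push Not at hvA
    obtain ⟨i, hi, hi'⟩ := hvA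
    have h1 := hc.mem_hodgePiece_primitive hpq hv hi
    have b1 := i.bounds
    simp only [Set.mem_ofPred_eq] at hi'
    refine Finset.sum_pos' (fun i _ => ?_) ⟨i, Finset.mem_univ _, ?_⟩
    · split_ifs
      · exact Complex.normSq_nonneg _
      · exact le_rfl
    · rw [if_pos (by omega)]
      exact Complex.normSq_pos.2 hi

theorem mem_compactDual {h : ℤ → ℤ → ℕ} (hh : ∀ r : ℤ, r ≤ n → Idx.col n g r = h r (n - r)) :
    stdF c ∈ compactDual n Q h := by
  refine ⟨?_, ?_, ?_, ?_, ?_⟩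
  · intro p q hpq
    exact spanPart_mono c fun i (hi : _ ≤ _) => hpq.trans hi
  · refine spanPart_univ c fun i => ?_
    have := i.bounds
    simp only [Set.mem_ofPred_eq]
    omega
  · refine spanPart_empty c fun i => ?_
    have := i.bounds
    simp only [Set.mem_ofPred_eq]
    omega
  · intro p
    rw [stdF, finrank_spanPart, Idx.card_le_fst]
    exact Finset.sum_congr rfl fun r hr => hh r (Finset.mem_Icc.1 hr).2
  · intro p q hpq v hv w hw
    rw [stdF, mem_spanPart] at hv hw
    rw [hc.form_eq_sum]
    refine Finset.sum_eq_zero fun i _ => ?_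
    by_cases hvi : c.repr v i = 0
    · simp [hvi]
    by_cases hwi : c.repr w (i.refl.swap hg) = 0
    · simp [hwi]
    exfalso
    have h1 := hv i hvi
    have h2 := hw _ hwi
    have b1 := i.bounds
    have b2 := i.refl.bounds
    simp only [Set.mem_ofPred_eq, Idx.swap_fst, Idx.refl_top, Idx.refl_ht] at h1 h2 b2
    omega

theorem transversal (p : ℤ) (v : Cx E) (hv : v ∈ stdF c p) :
    (stdN c).baseChange ℂ v ∈ stdF c (p - 1) := by
  have h : stdF c p ≤ (stdF c (p - 1)).comap (stringShift c ^ 1) := by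
    rw [stdF, stdF, comap_stringShift_pow]
    refine spanPart_mono c fun i hi h => ?_
    have b1 := i.bounds
    have b2 := (i.down 1 h).bounds
    simp only [Set.mem_ofPred_eq, Idx.down_top, Idx.down_ht] at hi b2 ⊢
    omega
  rw [hc.baseChange_stdN]
  simpa using h hv

theorem isPMHS {h : ℤ → ℤ → ℕ} (hh : ∀ r : ℤ, r ≤ n → Idx.col n g r = h r (n - r)) :
    IsPMHS n Q h (stdW c) (stdF c) (stdN c) where
  skew := hc.skew
  nilpotent := hc.nilpotent
  weight := hc.isJacobsonMorosov
  mem_compactDual := hc.mem_compactDual hh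
  mixed := hc.mixed
  transversal := hc.transversal
  primitive_hodge := hc.primitive_hodge
  primitive_polarized := hc.primitive_polarized

theorem deligneI_eq (p q : ℤ) :
    deligneI (stdW c) (stdF c) p q = spanPart c {i | (i.fst, i.snd) = (p, q)} := by
  simp only [deligneI, deligneU, hc.baseChange_stdW, stdF, spanPart_inf, spanPart_iSup,
    hc.conjSub_spanPart, spanPart_sup]
  congr 1
  ext i
  simp only [Set.mem_inter_iff, Set.mem_union, Set.mem_iUnion, Set.mem_ofPred_eq, Idx.swap_fst,
    Idx.swap_snd, Prod.mk.injEq]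
  constructor
  · rintro ⟨⟨h1, h2⟩, ⟨h3, h4⟩ | ⟨j, h3, h4⟩⟩ <;> omega
  · rintro ⟨h1, h2⟩
    exact ⟨by omega, Or.inl (by omega)⟩

theorem isRSplit : IsRSplit (stdW c) (stdF c) := by
  intro p q
  rw [hc.deligneI_eq, hc.deligneI_eq, hc.conjSub_spanPart]
  congr 1
  ext i
  simp only [Set.mem_ofPred_eq, Idx.swap_fst, Idx.swap_snd, Prod.mk.injEq]
  exact and_comm

theorem hodgeDiamond_eq : hodgeDiamond (stdW c) (stdF c) = Idx.cnt n g := by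
  classical
  funext ⟨a, b⟩
  rw [hodgeDiamond, hc.deligneI_eq, finrank_spanPart, Idx.cnt]

end IsAdapted

end Standard

/-! ### Uniqueness of the Jacobson-Morosov filtration, and transport of Hodge diamonds -/

section JacobsonMorosov

variable {E : Type*} [AddCommGroup E] [Module ℝ E]

namespace IsJacobsonMorosov

variable {N : Module.End ℝ E} {W W' : ℤ → Submodule ℝ E}

theorem shift_pow (h : IsJacobsonMorosov N W) (m : ℕ) {k : ℤ} {v : E} (hv : v ∈ W k) :
    (N ^ m) v ∈ W (k - 2 * m) := by
  induction m with
  | zero => simpa using hv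
  | succ m ih =>
    rw [pow_succ', Module.End.mul_apply]
    have := h.shift _ _ ih
    rwa [show k - 2 * ((m + 1 : ℕ) : ℤ) = k - 2 * m - 2 by push_cast; ring]

/-- The surjectivity of `N ^ m` on graded pieces lifts to the filtration steps themselves, by
induction from the zero end of the filtration. -/
theorem exists_pow_eq (h : IsJacobsonMorosov N W) (m : ℕ) {u : E} (hu : u ∈ W (-m)) :
    ∃ v ∈ W m, (N ^ m) v = u := by
  obtain ⟨a, ha⟩ := h.exists_bot
  have key : ∀ (t m : ℕ), -(m : ℤ) ≤ a + t → ∀ u ∈ W (-m), ∃ v ∈ W m, (N ^ m) v = u := by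
    intro t
    induction t with
    | zero =>
      intro m hm u hu
      have : u = 0 := by
        have := h.mono (show -(m : ℤ) ≤ a by omega) hu
        rwa [ha, Submodule.mem_bot] at this
      exact ⟨0, Submodule.zero_mem _, by rw [map_zero, this]⟩
    | succ t ih =>
      intro m hm u hu
      obtain ⟨v₀, hv₀, hw⟩ := h.gr_surjective m u hu
      rw [show -(m : ℤ) - 1 = -((m + 1 : ℕ) : ℤ) by push_cast; ring] at hw
      obtain ⟨v₁, hv₁, hv₁'⟩ := ih (m + 1) (by push_cast; omega) _ hw
      refine ⟨v₀ + N v₁, Submodule.add_mem _ hv₀ (h.mono ?_ (h.shift _ _ hv₁)), ?_⟩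
      · push_cast
        omega
      · rw [map_add, ← Module.End.mul_apply, ← pow_succ, hv₁']
        abel
  exact key (-(m : ℤ) - a).toNat m (by omega) u hu

theorem mem_iff (h : IsJacobsonMorosov N W) (m : ℕ) (v : E) :
    v ∈ W m ↔ v ∈ W (m + 1 : ℕ) ∧ (N ^ (m + 1)) v ∈ (W (m + 2 : ℕ)).map (N ^ (m + 2)) := by
  constructor
  · intro hv
    refine ⟨h.mono (by push_cast; omega) hv, ?_⟩
    have h1 := h.shift_pow (m + 1) hv
    obtain ⟨w, hw, hw'⟩ := h.exists_pow_eq (m + 2) (h.mono (by push_cast; omega) h1)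
    exact ⟨w, hw, hw'⟩
  · rintro ⟨h1, w, hw, hw'⟩
    have := h.gr_injective (m + 1) v h1 (by
      rw [← hw']
      exact h.mono (by push_cast; omega) (h.shift_pow (m + 2) hw))
    exact h.mono (by push_cast; omega) this

/-- The filtration is determined from the top downwards: `v ∈ W m` means that `v ∈ W (m + 1)` and
`N ^ (m + 1) v ∈ W (-(m + 2)) = N ^ (m + 2) (W (m + 2))`. -/
theorem unique (h : IsJacobsonMorosov N W) (h' : IsJacobsonMorosov N W') : W = W' := by
  -- Both filtrations are everything above some index. From there, `mem_iff` determines `W m` for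
  -- `m ≥ 0` by descending induction, and `W (-m)` is the image of `W m` under `N ^ m`.
  obtain ⟨b, hb⟩ := h.exists_top
  obtain ⟨b', hb'⟩ := h'.exists_top
  have key : ∀ (t m : ℕ), max b b' - m ≤ t → W m = W' m := by
    intro t
    induction t with
    | zero =>
      intro m hm
      have h1 := h.mono (show b ≤ m by have := le_max_left b b'; omega)
      have h2 := h'.mono (show b' ≤ m by have := le_max_right b b'; omega)
      rw [hb, top_le_iff] at h1
      rw [hb', top_le_iff] at h2
      rw [h1, h2]
    | succ t ih =>
      intro m hm
      ext v
      rw [h.mem_iff, h'.mem_iff, ih (m + 1) (by push_cast; omega), ih (m + 2) (by push_cast; omega)]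
  have pos : ∀ m : ℕ, W m = W' m := fun m => key (max b b' - m).toNat m (by omega)
  have neg : ∀ {W : ℤ → Submodule ℝ E}, IsJacobsonMorosov N W → ∀ m : ℕ,
      W (-m) = (W m).map (N ^ m) := fun {W} h m => by
    ext u
    refine ⟨fun hu => h.exists_pow_eq m hu, ?_⟩
    rintro ⟨v, hv, rfl⟩
    exact h.mono (by omega) (h.shift_pow m hv)
  funext k
  obtain ⟨m, rfl | rfl⟩ := k.eq_nat_or_neg
  · exact pos m
  · rw [neg h, neg h', pos]

theorem map (h : IsJacobsonMorosov N W) (e : E ≃ₗ[ℝ] E) :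
    IsJacobsonMorosov (e.toLinearMap ∘ₗ N ∘ₗ e.symm.toLinearMap)
      (fun k => (W k).map e.toLinearMap) := by
  have hp : ∀ (m : ℕ) (v : E), ((e.toLinearMap ∘ₗ N ∘ₗ e.symm.toLinearMap) ^ m) (e v)
      = e ((N ^ m) v) := by
    intro m v
    induction m with
    | zero => simp
    | succ m ih => simp [pow_succ', Module.End.mul_apply, ih]
  have hm : ∀ k v, e v ∈ (W k).map e.toLinearMap ↔ v ∈ W k := fun k v => by
    simp
  refine ⟨fun k l hkl => Submodule.map_mono (h.mono hkl), ?_, ?_, ?_, ?_, ?_⟩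
  · obtain ⟨a, ha⟩ := h.exists_bot
    exact ⟨a, by rw [ha, Submodule.map_bot]⟩
  · obtain ⟨b, hb⟩ := h.exists_top
    exact ⟨b, by rw [hb, Submodule.map_top]; exact e.range⟩
  · rintro ℓ _ ⟨v, hv, rfl⟩
    have := hp 1 v
    rw [pow_one, pow_one] at this
    exact this ▸ (hm _ _).2 (h.shift ℓ v hv)
  · rintro ℓ _ ⟨v, hv, rfl⟩ hv'
    refine (hm _ _).2 (h.gr_injective ℓ v hv ((hm _ _).1 ?_))
    rw [← hp]
    exact hv'
  · rintro ℓ _ ⟨u, hu, rfl⟩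
    obtain ⟨v, hv, hv'⟩ := h.gr_surjective ℓ u hu
    refine ⟨e v, (hm _ _).2 hv, ?_⟩
    rw [hp]
    have := (hm _ _).2 hv'
    rwa [map_sub] at this

end IsJacobsonMorosov

theorem baseChange_map (R : Submodule ℝ E) (e : E ≃ₗ[ℝ] E) :
    (R.map e.toLinearMap).baseChange ℂ = (R.baseChange ℂ).map (e.toLinearMap.baseChange ℂ) := by
  ext x
  constructor
  · intro hx
    rw [mem_baseChange] at hx
    obtain ⟨⟨a, ha, ha'⟩, b, hb, hb'⟩ := hx
    refine ⟨(1 : ℂ) ⊗ₜ a + Complex.I • ((1 : ℂ) ⊗ₜ b), Submodule.add_mem _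
      (one_tmul_mem_baseChange.2 ha) (Submodule.smul_mem _ _ (one_tmul_mem_baseChange.2 hb)), ?_⟩
    rw [map_add, map_smul, LinearMap.baseChange_tmul, LinearMap.baseChange_tmul, ha', hb',
      re_add_im]
  · rintro ⟨y, hy, rfl⟩
    have hy' := mem_baseChange.1 (SetLike.mem_coe.1 hy)
    rw [mem_baseChange]
    exact ⟨⟨_, hy'.1, (rePart_baseChange _ _).symm⟩, ⟨_, hy'.2, (imPart_baseChange _ _).symm⟩⟩

theorem conjSub_map (S : Submodule ℂ (Cx E)) (e : E ≃ₗ[ℝ] E) :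
    conjSub (S.map (e.toLinearMap.baseChange ℂ)) =
      (conjSub S).map (e.toLinearMap.baseChange ℂ) := by
  ext x
  rw [mem_conjSub]
  constructor
  · rintro ⟨_, ⟨y, hy, rfl⟩, rfl⟩
    exact ⟨conj y, mem_conjSub.2 ⟨y, hy, rfl⟩, (conj_baseChange _ _).symm⟩
  · rintro ⟨y, hy, rfl⟩
    exact ⟨_, ⟨conj y, hy, rfl⟩, by rw [conj_baseChange, conj_conj]⟩

theorem baseChange_equiv_injective (e : E ≃ₗ[ℝ] E) :
    Function.Injective (e.toLinearMap.baseChange ℂ) :=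
  (e.baseChange ℝ ℂ E E).injective

theorem deligneI_map (W : ℤ → Submodule ℝ E) (F : ℤ → Submodule ℂ (Cx E)) (e : E ≃ₗ[ℝ] E)
    (p q : ℤ) :
    deligneI (fun k => (W k).map e.toLinearMap) (fun p => (F p).map (e.toLinearMap.baseChange ℂ))
      p q = (deligneI W F p q).map (e.toLinearMap.baseChange ℂ) := by
  simp only [deligneI, deligneU, baseChange_map, conjSub_map, ← Submodule.map_iSup,
    ← Submodule.map_inf _ (baseChange_equiv_injective e), ← Submodule.map_sup]

theorem hodgeDiamond_map (W : ℤ → Submodule ℝ E) (F : ℤ → Submodule ℂ (Cx E)) (e : E ≃ₗ[ℝ] E) :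
    hodgeDiamond (fun k => (W k).map e.toLinearMap)
      (fun p => (F p).map (e.toLinearMap.baseChange ℂ)) = hodgeDiamond W F := by
  funext x
  rw [hodgeDiamond, hodgeDiamond, deligneI_map]
  exact (Submodule.equivMapOfInjective _ (baseChange_equiv_injective e) _).finrank_eq.symm

end JacobsonMorosov

/-! ### The bigrading of a split mixed Hodge structure -/

section Bigrading

variable {E : Type*} [AddCommGroup E] [Module ℝ E]

/-- The space `F^p ∩ conj F^q ∩ W_{p+q}`, which is the summand `I^{p,q}` of the Deligne splitting
when the mixed Hodge structure is split over `ℝ`. -/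
noncomputable def bigrade (W : ℤ → Submodule ℝ E) (F : ℤ → Submodule ℂ (Cx E)) (x : ℤ × ℤ) :
    Submodule ℂ (Cx E) :=
  F x.1 ⊓ conjSub (F x.2) ⊓ (W (x.1 + x.2)).baseChange ℂ

/-- The properties of an `ℝ`-split polarized mixed Hodge structure that determine it up to
isomorphism. Both `ℝ`-split polarized mixed Hodge structures and, with `N = 0`, points of the period
domain have these properties. -/
structure HasBigrading (n : ℕ) (Q : LinearMap.BilinForm ℝ E) (W : ℤ → Submodule ℝ E)
    (F : ℤ → Submodule ℂ (Cx E)) (N : Module.End ℝ E) : Prop where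
  anti : Antitone F
  F_top : F 0 = ⊤
  F_bot : F (n + 1) = ⊥
  skew : ∀ u v, Q (N u) v + Q u (N v) = 0
  weight : IsJacobsonMorosov N (fun ℓ => W (ℓ + n))
  mixed : ∀ ℓ : ℤ, InducesHodgeStructure ℓ (W (ℓ - 1)) (W ℓ) F
  transversal : ∀ p : ℤ, ∀ v ∈ F p, N.baseChange ℂ v ∈ F (p - 1)
  /-- The Hodge summands of the graded pieces lift to the bigrading. -/
  lift : ∀ k p : ℤ, hodgePiece (W (k - 1)) (W k) F p (k - p) ≤
    bigrade W F (p, k - p) ⊔ (W (k - 1)).baseChange ℂ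
  isotropic : ∀ x y : ℤ × ℤ, n < x.1 + y.1 → ∀ v ∈ bigrade W F x, ∀ w ∈ bigrade W F y,
    Q.baseChange ℂ v w = 0
  positive : ∀ (x : ℤ × ℤ), x ∈ tops n → ∀ v ∈ bigrade W F x,
    (N.baseChange ℂ ^ (len n x + 1)) v = 0 → v ∉ (W (x.1 + x.2 - 1)).baseChange ℂ →
    0 < (Complex.I ^ (x.1 - x.2) * Q.baseChange ℂ v ((N.baseChange ℂ ^ len n x) (conj v))).re

variable {n : ℕ} {Q : LinearMap.BilinForm ℝ E} {W : ℤ → Submodule ℝ E}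
    {F : ℤ → Submodule ℂ (Cx E)} {N : Module.End ℝ E}

theorem mem_bigrade {x : ℤ × ℤ} {v : Cx E} : v ∈ bigrade W F x ↔
    v ∈ F x.1 ∧ conj v ∈ F x.2 ∧ v ∈ (W (x.1 + x.2)).baseChange ℂ := by
  rw [bigrade, Submodule.mem_inf, Submodule.mem_inf, and_assoc]
  rfl

theorem conj_mem_bigrade {x : ℤ × ℤ} {v : Cx E} (hv : v ∈ bigrade W F x) :
    conj v ∈ bigrade W F x.swap := by
  rw [mem_bigrade] at hv ⊢
  refine ⟨hv.2.1, by rw [conj_conj]; exact hv.1, conj_mem_baseChange.2 ?_⟩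
  rw [Prod.fst_swap, Prod.snd_swap, add_comm]
  exact hv.2.2

namespace HasBigrading

variable (h : HasBigrading n Q W F N)
include h

theorem W_mono {k l : ℤ} (hkl : k ≤ l) : W k ≤ W l := by
  have := h.weight.mono (show k - n ≤ l - n by omega)
  simpa using this

theorem exists_W_bot : ∃ a, W a = ⊥ := by
  obtain ⟨a, ha⟩ := h.weight.exists_bot
  exact ⟨_, ha⟩

theorem exists_W_top : ∃ b, W b = ⊤ := by
  obtain ⟨b, hb⟩ := h.weight.exists_top
  exact ⟨_, hb⟩

theorem F_eq_bot {p : ℤ} (hp : n < p) : F p = ⊥ := by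
  have := h.anti (show (n : ℤ) + 1 ≤ p by omega)
  rwa [h.F_bot, le_bot_iff] at this

theorem shift_bigrade (m : ℕ) {x : ℤ × ℤ} {v : Cx E} (hv : v ∈ bigrade W F x) :
    (N.baseChange ℂ ^ m) v ∈ bigrade W F (x.1 - m, x.2 - m) := by
  have hF : ∀ (p : ℤ) (v : Cx E), v ∈ F p → (N.baseChange ℂ ^ m) v ∈ F (p - m) := by
    intro p v hv
    induction m with
    | zero => simpa using hv
    | succ m ih =>
      rw [pow_succ', Module.End.mul_apply]
      have := h.transversal _ _ ih
      rwa [show p - ((m + 1 : ℕ) : ℤ) = p - m - 1 by push_cast; ring]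
  have hW : ∀ (k : ℤ) (v : E), v ∈ W k → (N ^ m) v ∈ W (k - 2 * m) := by
    intro k v hv
    have := h.weight.shift_pow m (k := k - n) (v := v) (by simpa using hv)
    rwa [show k - n - 2 * m + n = k - 2 * m by ring] at this
  rw [mem_bigrade] at hv ⊢
  refine ⟨hF _ _ hv.1, ?_, ?_⟩
  · rw [conj_baseChange_pow]
    exact hF _ _ hv.2.1
  · have h3 := mem_baseChange.1 hv.2.2
    rw [mem_baseChange, ← baseChange_pow_apply, rePart_baseChange, imPart_baseChange,
      show x.1 - m + (x.2 - m) = x.1 + x.2 - 2 * m by ring]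
    exact ⟨hW _ _ h3.1, hW _ _ h3.2⟩

/-- A vector of `F^p ∩ conj F^q` of weight less than `p + q` vanishes, because it vanishes in every
graded piece. -/
theorem eq_zero_of_weight_lt {p q k : ℤ} (hk : k < p + q) {v : Cx E} (h1 : v ∈ F p)
    (h2 : conj v ∈ F q) (h3 : v ∈ (W k).baseChange ℂ) : v = 0 := by
  obtain ⟨a, ha⟩ := h.exists_W_bot
  have key : ∀ (t : ℕ) (k : ℤ), k ≤ a + t → k < p + q → v ∈ (W k).baseChange ℂ → v = 0 := by
    intro t
    induction t with
    | zero =>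
      intro k hk _ hv
      have := baseChange_mono (h.W_mono (show k ≤ a by omega)) hv
      rwa [ha, Submodule.baseChange_bot, Submodule.mem_bot] at this
    | succ t ih =>
      intro k hk hk' hv
      refine ih (k - 1) (by push_cast at hk; omega) (by omega) ?_
      rw [← (h.mixed k p).1]
      refine ⟨Submodule.mem_sup_left ⟨h1, hv⟩, Submodule.mem_sup_left ⟨?_, ?_⟩⟩
      · exact h.anti (by omega) h2
      · exact conj_mem_baseChange.2 hv
  exact key (k - a).toNat k (by omega) hk h3

theorem bigrade_eq_bot {x : ℤ × ℤ} (hx : n < x.1 ∨ n < x.2) : bigrade W F x = ⊥ := by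
  rw [eq_bot_iff]
  intro v hv
  rw [mem_bigrade] at hv
  rcases hx with hx | hx
  · have := hv.1
    rwa [h.F_eq_bot hx] at this
  · have := hv.2.1
    rw [h.F_eq_bot hx, Submodule.mem_bot] at this
    rw [Submodule.mem_bot, ← conj_conj v, this, map_zero]

theorem F_inf_W_le (p k : ℤ) : F p ⊓ (W k).baseChange ℂ ≤
    ⨆ x ∈ {x : ℤ × ℤ | p ≤ x.1 ∧ x.1 + x.2 ≤ k}, bigrade W F x := by
  obtain ⟨a, ha⟩ := h.exists_W_bot
  have mono : ∀ {p p' k k' : ℤ}, p ≤ p' → k' ≤ k →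
      (⨆ x ∈ {x : ℤ × ℤ | p' ≤ x.1 ∧ x.1 + x.2 ≤ k'}, bigrade W F x) ≤
      ⨆ x ∈ {x : ℤ × ℤ | p ≤ x.1 ∧ x.1 + x.2 ≤ k}, bigrade W F x := fun hp hk =>
    biSup_mono fun x hx => ⟨hp.trans hx.1, hx.2.trans hk⟩
  have key : ∀ (t : ℕ) (k : ℤ), k ≤ a + t → ∀ p : ℤ, F p ⊓ (W k).baseChange ℂ ≤
      ⨆ x ∈ {x : ℤ × ℤ | p ≤ x.1 ∧ x.1 + x.2 ≤ k}, bigrade W F x := by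
    intro t
    induction t with
    | zero =>
      intro k hk p v hv
      have := baseChange_mono (h.W_mono (show k ≤ a by omega)) hv.2
      rw [ha, Submodule.baseChange_bot, Submodule.mem_bot] at this
      rw [this]
      exact Submodule.zero_mem _
    | succ t ih =>
      intro k hk
      have key' : ∀ (s : ℕ) (p : ℤ), n + 1 - p ≤ s → F p ⊓ (W k).baseChange ℂ ≤
          ⨆ x ∈ {x : ℤ × ℤ | p ≤ x.1 ∧ x.1 + x.2 ≤ k}, bigrade W F x := by
        intro s
        induction s with
        | zero =>
          intro p hp
          rw [h.F_eq_bot (by omega), bot_inf_eq]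
          exact bot_le
        | succ s ih' =>
          intro p hp v hv
          have hvB : v ∈ inducedFil (W (k - 1)) (W k) F p := Submodule.mem_sup_left hv
          have hv' : v ∈ (W k).baseChange ℂ := hv.2
          rw [← (h.mixed k (p + 1)).2, Submodule.mem_sup] at hv'
          obtain ⟨y, hy, z, hz, hyz⟩ := hv'
          have hz' : z ∈ hodgePiece (W (k - 1)) (W k) F p (k - p) := by
            refine ⟨?_, ?_⟩
            · rw [show z = v - y by rw [← hyz, add_sub_cancel_left]]
              refine Submodule.sub_mem _ hvB ?_
              exact sup_le_sup_right (inf_le_inf_right _ (h.anti (by omega))) _ hy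
            · rwa [show k + 1 - (p + 1) = k - p by ring] at hz
          obtain ⟨i, hi, w₁, hw₁, hiw⟩ := Submodule.mem_sup.1 (h.lift k p hz')
          obtain ⟨y', hy', w₂, hw₂, hyw⟩ := Submodule.mem_sup.1 hy
          have e : v = i + y' + (w₁ + w₂) := by
            rw [← hyz, ← hiw, ← hyw]
            abel
          have hw : w₁ + w₂ ∈ F p ⊓ (W (k - 1)).baseChange ℂ := by
            refine ⟨?_, Submodule.add_mem _ hw₁ hw₂⟩
            rw [show w₁ + w₂ = v - i - y' by rw [e]; abel]
            exact Submodule.sub_mem _ (Submodule.sub_mem _ hv.1 (mem_bigrade.1 hi).1)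
              (h.anti (by omega) hy'.1)
          rw [e]
          refine Submodule.add_mem _ (Submodule.add_mem _ ?_ ?_) ?_
          · exact le_biSup (bigrade W F)
              (show (p, k - p) ∈ {x : ℤ × ℤ | p ≤ x.1 ∧ x.1 + x.2 ≤ k} from
                ⟨le_rfl, by dsimp only; omega⟩) hi
          · exact mono (by omega) le_rfl (ih' (p + 1) (by push_cast at hp; omega) hy')
          · exact mono le_rfl (by omega) (ih (k - 1) (by push_cast at hk; omega) p hw)
      intro p
      exact key' (n + 1 - p).toNat p (by omega)
  exact key (k - a).toNat k (by omega) p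

theorem F_le (p : ℤ) : F p ≤ ⨆ x ∈ {x : ℤ × ℤ | p ≤ x.1}, bigrade W F x := by
  obtain ⟨b, hb⟩ := h.exists_W_top
  have := h.F_inf_W_le p b
  rw [hb, Submodule.baseChange_top, inf_top_eq] at this
  exact this.trans (biSup_mono fun x hx => hx.1)

theorem iSup_bigrade : ⨆ x, bigrade W F x = ⊤ := by
  rw [eq_top_iff, ← h.F_top]
  exact (h.F_le 0).trans (iSup₂_le_iSup _ _)

/-- The bigrading is direct: order the bidegrees by weight, and within one weight by decreasing
first entry; then the leading term of a relation vanishes. -/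
theorem iSupIndep_bigrade : iSupIndep (bigrade W F) := by
  classical
  rw [iSupIndep_iff_finsetSum_eq_zero_imp_eq_zero]
  intro s v hv hsum
  by_contra hne
  push Not at hne
  obtain ⟨i, hi, hi'⟩ := hne
  obtain ⟨x, hx, hmax⟩ := Finset.exists_max_image (s.filter fun x => v x ≠ 0)
    (fun x => toLex (x.1 + x.2, -x.1)) ⟨i, Finset.mem_filter.2 ⟨hi, hi'⟩⟩
  obtain ⟨hxs, hx0⟩ := Finset.mem_filter.1 hx
  obtain ⟨h1, h2, h3⟩ := mem_bigrade.1 (hv x hxs)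
  set k := x.1 + x.2 with hk
  -- All other terms lie in `W_{k-1}` or in `F^{x.1+1}`, hence so does `v x`; since `v x` also lies
  -- in `conj F^{x.2}`, it vanishes in the Hodge structure on the graded piece of weight `k`.
  have hv1 : v x ∈ inducedFil (W (k - 1)) (W k) F (x.1 + 1) := by
    rw [← Finset.add_sum_erase s v hxs] at hsum
    rw [eq_neg_of_add_eq_zero_left hsum]
    refine Submodule.neg_mem _ (Submodule.sum_mem _ fun y hy => ?_)
    obtain ⟨hyx, hys⟩ := Finset.mem_erase.1 hy
    by_cases hy0 : v y = 0
    · rw [hy0]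
      exact Submodule.zero_mem _
    have hle := hmax y (Finset.mem_filter.2 ⟨hys, hy0⟩)
    rw [Prod.Lex.toLex_le_toLex] at hle
    obtain ⟨g1, -, g3⟩ := mem_bigrade.1 (hv y hys)
    dsimp only at hle
    rcases hle with hle | ⟨hle, hle'⟩
    · exact Submodule.mem_sup_right (baseChange_mono (h.W_mono (by omega)) g3)
    · refine Submodule.mem_sup_left ⟨h.anti ?_ g1, baseChange_mono (h.W_mono hle.le) g3⟩
      by_contra hlt
      exact hyx (Prod.ext (by omega) (by omega))
  refine hx0 (h.eq_zero_of_weight_lt (k := k - 1) (by omega) h1 h2 ?_)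
  rw [← (h.mixed k (x.1 + 1)).1]
  refine ⟨hv1, Submodule.mem_sup_left ⟨h.anti (by omega) h2, conj_mem_baseChange.2 h3⟩⟩

theorem exists_pow_eq {m : ℕ} {x y : ℤ × ℤ} (hx : x.1 + x.2 = n + m)
    (hxy : y = (x.1 - m, x.2 - m)) {w : Cx E} (hw : w ∈ bigrade W F y) :
    ∃ v ∈ bigrade W F x, (N.baseChange ℂ ^ m) v = w := by
  subst hxy
  have h3 := mem_baseChange.1 (mem_bigrade.1 hw).2.2
  dsimp only at h3
  rw [show x.1 - m + (x.2 - m) = -m + n by omega] at h3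
  obtain ⟨a, -, ha⟩ := h.weight.exists_pow_eq m h3.1
  obtain ⟨b, -, hb⟩ := h.weight.exists_pow_eq m h3.2
  have hu : (N.baseChange ℂ ^ m) ((1 : ℂ) ⊗ₜ a + Complex.I • ((1 : ℂ) ⊗ₜ b)) = w := by
    rw [← baseChange_pow_apply, map_add, map_smul, LinearMap.baseChange_tmul,
      LinearMap.baseChange_tmul, ha, hb, re_add_im]
  set u : Cx E := (1 : ℂ) ⊗ₜ a + Complex.I • ((1 : ℂ) ⊗ₜ b)
  -- The component of the preimage `u` in bidegree `x` is a preimage, as `N` shifts bidegrees.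
  have hu' : u ∈ (⊤ : Submodule ℂ (Cx E)) := Submodule.mem_top
  rw [← h.iSup_bigrade, iSup_split_single _ x, Submodule.mem_sup] at hu'
  obtain ⟨v, hv, v', hv', hvv⟩ := hu'
  refine ⟨v, hv, ?_⟩
  have hr : (N.baseChange ℂ ^ m) v' ∈
      ⨆ (z) (_ : z ≠ ((x.1 - m, x.2 - m) : ℤ × ℤ)), bigrade W F z := by
    have hle : (⨆ (z) (_ : z ≠ x), bigrade W F z) ≤ (⨆ (z) (_ : z ≠ ((x.1 - m, x.2 - m) : ℤ × ℤ)),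
        bigrade W F z).comap (N.baseChange ℂ ^ m) := by
      refine iSup₂_le fun z hz v hv => ?_
      refine (le_biSup (bigrade W F) (i := (z.1 - m, z.2 - m)) ?_) (h.shift_bigrade m hv)
      intro he
      rw [Prod.mk.injEq] at he
      exact hz (Prod.ext (by omega) (by omega))
    exact hle hv'
  have hd := Submodule.disjoint_def.1 (h.iSupIndep_bigrade (x.1 - m, x.2 - m))
    (w - (N.baseChange ℂ ^ m) v) (Submodule.sub_mem _ hw (h.shift_bigrade m hv)) (by
      rwa [← hu, ← hvv, map_add, add_sub_cancel_left])
  exact (sub_eq_zero.1 hd).symm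

end HasBigrading

/-- The primitive part of the bigrading, where the Jordan strings start. -/
noncomputable def primitivePart (n : ℕ) (W : ℤ → Submodule ℝ E) (F : ℤ → Submodule ℂ (Cx E))
    (N : Module.End ℝ E) (x : ℤ × ℤ) : Submodule ℂ (Cx E) :=
  if x ∈ tops n then bigrade W F x ⊓ LinearMap.ker (N.baseChange ℂ ^ (len n x + 1)) else ⊥

theorem primitivePart_of_mem {x : ℤ × ℤ} (hx : x ∈ tops n) : primitivePart n W F N x =
    bigrade W F x ⊓ LinearMap.ker (N.baseChange ℂ ^ (len n x + 1)) := if_pos hx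

theorem primitivePart_of_notMem {x : ℤ × ℤ} (hx : x ∉ tops n) :
    primitivePart n W F N x = ⊥ := if_neg hx

theorem mem_tops {x : ℤ × ℤ} : x ∈ tops n ↔
    0 ≤ x.1 ∧ x.1 ≤ n ∧ 0 ≤ x.2 ∧ x.2 ≤ n ∧ (n : ℤ) ≤ x.1 + x.2 := by
  simp [tops, and_assoc]

theorem swap_mem_tops {x : ℤ × ℤ} : x.swap ∈ tops n ↔ x ∈ tops n := by
  rw [mem_tops, mem_tops, Prod.fst_swap, Prod.snd_swap]
  omega

theorem conj_mem_primitivePart {x : ℤ × ℤ} {v : Cx E} (hv : v ∈ primitivePart n W F N x) :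
    conj v ∈ primitivePart n W F N x.swap := by
  by_cases hx : x ∈ tops n
  · rw [primitivePart_of_mem hx] at hv
    rw [primitivePart_of_mem (swap_mem_tops.2 hx)]
    refine ⟨conj_mem_bigrade hv.1, LinearMap.mem_ker.2 ?_⟩
    rw [Idx.len_swap, ← conj_baseChange_pow, LinearMap.mem_ker.1 hv.2, map_zero]
  · rw [primitivePart_of_notMem hx, Submodule.mem_bot] at hv
    rw [hv, map_zero]
    exact Submodule.zero_mem _

namespace HasBigrading

variable (h : HasBigrading n Q W F N)
include h

/-- The Lefschetz decomposition: the translates `N ^ j P` of the primitive parts span. -/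
theorem span_strings (S : Submodule ℂ (Cx E))
    (hS : ∀ x ∈ tops n, ∀ v ∈ primitivePart n W F N x, ∀ j ≤ len n x,
      (N.baseChange ℂ ^ j) v ∈ S) : S = ⊤ := by
  -- The span `T` of the strings is stable under `N`, whereas `S` need not be.
  let T : Submodule ℂ (Cx E) := Submodule.span ℂ {w | ∃ x ∈ tops n, ∃ v ∈ primitivePart n W F N x,
    ∃ j ≤ len n x, w = (N.baseChange ℂ ^ j) v}
  have hTS : T ≤ S := by
    refine Submodule.span_le.2 ?_
    rintro _ ⟨x, hx, v, hv, j, hj, rfl⟩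
    exact hS x hx v hv j hj
  have hTN : T ≤ T.comap (N.baseChange ℂ) := by
    refine Submodule.span_le.2 ?_
    rintro _ ⟨x, hx, v, hv, j, hj, rfl⟩
    change N.baseChange ℂ ((N.baseChange ℂ ^ j) v) ∈ T
    rw [← Module.End.mul_apply, ← pow_succ']
    rcases hj.lt_or_eq with hlt | rfl
    · exact Submodule.subset_span ⟨x, hx, v, hv, j + 1, hlt, rfl⟩
    · rw [primitivePart_of_mem hx] at hv
      rw [LinearMap.mem_ker.1 hv.2]
      exact Submodule.zero_mem _
  have hTN' : ∀ (m : ℕ) (v : Cx E), v ∈ T → (N.baseChange ℂ ^ m) v ∈ T := by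
    intro m v hv
    induction m with
    | zero => simpa using hv
    | succ m ih =>
      rw [pow_succ', Module.End.mul_apply]
      exact hTN ih
  have hpos : ∀ (t : ℕ) (x : ℤ × ℤ), (n : ℤ) ≤ x.1 + x.2 → n + 1 - x.1 ≤ t →
      bigrade W F x ≤ T := by
    intro t
    induction t with
    | zero =>
      intro x _ hx
      rw [h.bigrade_eq_bot (Or.inl (by omega))]
      exact bot_le
    | succ t ih =>
      intro x hx hxt
      by_cases hxn : n < x.1 ∨ n < x.2
      · rw [h.bigrade_eq_bot hxn]
        exact bot_le
      have hxn' : x ∈ tops n := mem_tops.2 (by omega)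
      have hl := Idx.len_cast hx
      intro v hv
      obtain ⟨y, hy, hy'⟩ := h.exists_pow_eq (m := len n x + 2) (x := (x.1 + 1, x.2 + 1))
        (by dsimp only; push_cast; omega)
        (by push_cast; ring_nf) (h.shift_bigrade (len n x + 1) hv)
      have hyT : y ∈ T := ih (x.1 + 1, x.2 + 1) (by dsimp only; omega) (by dsimp only; omega) hy
      have hNy := h.shift_bigrade 1 hy
      rw [pow_one] at hNy
      have hp : v - N.baseChange ℂ y ∈ primitivePart n W F N x := by
        rw [primitivePart_of_mem hxn']
        refine ⟨Submodule.sub_mem _ hv (by simpa using hNy), LinearMap.mem_ker.2 ?_⟩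
        rw [map_sub, ← hy', ← Module.End.mul_apply, ← pow_succ, sub_self]
      have hpT : v - N.baseChange ℂ y ∈ T :=
        Submodule.subset_span ⟨x, hxn', _, hp, 0, Nat.zero_le _, by simp⟩
      have := Submodule.add_mem _ hpT (hTN hyT)
      rwa [sub_add_cancel] at this
  rw [eq_top_iff, ← h.iSup_bigrade]
  refine iSup_le fun x => le_trans ?_ hTS
  by_cases hx : (n : ℤ) ≤ x.1 + x.2
  · exact hpos (n + 1 - x.1).toNat x hx (by omega)
  · intro v hv
    obtain ⟨m, hm⟩ := Int.eq_ofNat_of_zero_le (show 0 ≤ n - (x.1 + x.2) by omega)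
    obtain ⟨y, hy, rfl⟩ := h.exists_pow_eq (m := m) (x := (x.1 + m, x.2 + m))
      (by dsimp only; omega) (by simp) hv
    exact hTN' m y
      (hpos (n + 1 - (x.1 + m)).toNat _ (by dsimp only; omega) (by dsimp only; omega) hy)

end HasBigrading

end Bigrading

/-! ### Existence of adapted bases -/

section AdaptedBasis

variable {E : Type*} [AddCommGroup E] [Module ℝ E] {n : ℕ} {Q : LinearMap.BilinForm ℝ E}
    {W : ℤ → Submodule ℝ E} {F : ℤ → Submodule ℂ (Cx E)} {N : Module.End ℝ E}

namespace HasBigrading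

variable (h : HasBigrading n Q W F N)
include h

/-- Two strings are orthogonal, except for the pairs of vectors in opposite positions of strings
that start in bidegrees exchanged by conjugation. -/
theorem form_strings_eq_zero {x y : ℤ × ℤ} (hx : x ∈ tops n) (hy : y ∈ tops n) {u v : Cx E}
    (hu : u ∈ primitivePart n W F N x) (hv : v ∈ primitivePart n W F N y) {j j' : ℕ}
    (hne : ¬ (y = x.swap ∧ j + j' = len n x)) :
    Q.baseChange ℂ ((N.baseChange ℂ ^ j) u) ((N.baseChange ℂ ^ j') v) = 0 := by
  rw [primitivePart_of_mem hx] at hu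
  rw [primitivePart_of_mem hy] at hv
  have kill : ∀ {x : ℤ × ℤ} {u : Cx E}, u ∈ bigrade W F x ⊓
      LinearMap.ker (N.baseChange ℂ ^ (len n x + 1)) → ∀ m, len n x < m →
      (N.baseChange ℂ ^ m) u = 0 := fun {x u} hu m hm => by
    obtain ⟨d, rfl⟩ := Nat.exists_eq_add_of_lt hm
    rw [show len n x + d + 1 = d + (len n x + 1) by ring, pow_add, Module.End.mul_apply,
      LinearMap.mem_ker.1 (Submodule.mem_inf.1 hu).2, map_zero]
  have lx := Idx.len_cast (mem_tops.1 hx).2.2.2.2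
  have ly := Idx.len_cast (mem_tops.1 hy).2.2.2.2
  have hu' := h.shift_bigrade j hu.1
  have hv' := h.shift_bigrade j' hv.1
  by_cases h1 : len n y < j + j'
  · rw [form_skew_pow Q h.skew, ← Module.End.mul_apply, ← pow_add, kill hv _ h1, map_zero, mul_zero]
  by_cases h2 : len n x < j + j'
  · have := form_skew_pow Q h.skew j' ((N.baseChange ℂ ^ j) u) v
    rw [← Module.End.mul_apply, ← pow_add, add_comm, kill hu _ h2, map_zero,
      LinearMap.zero_apply] at this
    exact (mul_eq_zero.1 this.symm).resolve_left (pow_ne_zero _ (by norm_num))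
  by_cases h3 : n < x.1 - j + (y.1 - j')
  · exact h.isotropic _ _ h3 _ hu' _ hv'
  by_cases h4 : n < x.2 - j + (y.2 - j')
  · have := h.isotropic _ _ (by simpa using h4) _ (conj_mem_bigrade hu') _ (conj_mem_bigrade hv')
    rwa [form_conj, map_eq_zero] at this
  · exact absurd ⟨Prod.ext (by dsimp only [Prod.fst_swap]; omega)
      (by dsimp only [Prod.snd_swap]; omega), by omega⟩ hne

variable [FiniteDimensional ℝ E]

/-- Bases of the primitive parts that are orthonormal for the polarizations and compatible with
conjugation. -/
theorem exists_primitive_bases (hQ : ∀ u v, Q u v = (-1) ^ n * Q v u) :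
    ∃ (g : ℤ × ℤ → ℕ) (b : ℤ × ℤ → ℕ → Cx E), (∀ x, g x.swap = g x) ∧ (∀ x, x ∉ tops n → g x = 0) ∧
      (∀ x, ∀ k < g x, b x k ∈ primitivePart n W F N x) ∧
      (∀ x, x ∈ tops n → ∀ k < g x, ∀ l < g x, Complex.I ^ (x.1 - x.2) *
        Q.baseChange ℂ (b x k) ((N.baseChange ℂ ^ len n x) (conj (b x l))) =
          if l = k then 1 else 0) ∧
      (∀ x, primitivePart n W F N x ≤ Submodule.span ℂ (b x '' {k | k < g x})) ∧
      ∀ x, ∀ k < g x, conj (b x k) = b x.swap k := by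
  have hI := Complex.I_ne_zero
  have conjI : ∀ d : ℤ, starRingEnd ℂ (Complex.I ^ d) = Complex.I ^ (-d) := fun d => by
    rw [map_zpow₀, Complex.conj_I, ← Complex.inv_I, inv_zpow, ← zpow_neg]
  have hQ' := form_symm Q (ε := (-1) ^ n) hQ
  -- The polarizations `i ^ (p - q) Q(v, N ^ ℓ conj u)`, extended by zero to all bidegrees.
  let B : ℤ × ℤ → Cx E → Cx E → ℂ := fun x u v => if x ∈ tops n then
    Complex.I ^ (x.1 - x.2) * Q.baseChange ℂ v ((N.baseChange ℂ ^ len n x) (conj u)) else 0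
  have hB : ∀ x, x ∈ tops n → ∀ u v, B x u v =
      Complex.I ^ (x.1 - x.2) * Q.baseChange ℂ v ((N.baseChange ℂ ^ len n x) (conj u)) :=
    fun x hx u v => if_pos hx
  have hB0 : ∀ x, x ∉ tops n → ∀ u v, B x u v = 0 := fun x hx u v => if_neg hx
  have herm : ∀ x, IsHermitianForm (B x) := fun x => by
    by_cases hx : x ∈ tops n
    · refine ⟨fun u v => ?_, fun u v w => ?_, fun c u v => ?_⟩
      · have hl := Idx.len_cast (mem_tops.1 hx).2.2.2.2
        rw [hB x hx, hB x hx, map_mul, conjI, ← form_conj, conj_baseChange_pow, conj_conj, hQ',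
          form_skew_pow Q h.skew, ← mul_assoc, ← mul_assoc]
        congr 1
        have e : ((-1 : ℝ) ^ n : ℝ) = ((-1 : ℂ) ^ n) := by push_cast; rfl
        have e2 : (-1 : ℂ) = Complex.I ^ (2 : ℤ) := by
          rw [zpow_ofNat, Complex.I_sq]
        rw [e, e2, ← zpow_natCast, ← zpow_natCast, ← zpow_mul, ← zpow_mul, ← zpow_add₀ hI,
          ← zpow_add₀ hI, hl, show -(x.1 - x.2) + 2 * (n : ℤ) + 2 * (x.1 + x.2 - n) =
          x.1 - x.2 + 4 * x.2 by ring, zpow_add₀ hI, zpow_mul]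
        norm_num [zpow_ofNat]
      · rw [hB x hx, hB x hx, hB x hx, map_add, map_add, map_add, mul_add]
      · rw [hB x hx, hB x hx, LinearMap.map_smulₛₗ, map_smul, map_smul, smul_eq_mul]
        ring
    · exact ⟨fun u v => by rw [hB0 x hx, hB0 x hx, map_zero],
        fun u v w => by simp [hB0 x hx], fun c u v => by simp [hB0 x hx]⟩
  obtain ⟨g, b, hg, hb, ho, hs, hc⟩ := exists_orthonormal_conj (A := ℤ × ℤ) (X := Cx E) conj
    conj_conj Prod.swap Prod.swap_swap (fun x => x.1 < x.2)
    (fun x hx => by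
      have : x.1 ≠ x.2 := fun he => hx (Prod.ext he.symm he)
      simp only [Prod.fst_swap, Prod.snd_swap]
      omega)
    (primitivePart n W F N) (fun x y hy => conj_mem_primitivePart hy) B herm
    (fun x u v => by
      by_cases hx : x ∈ tops n
      · rw [hB x hx, hB _ (swap_mem_tops.2 hx), map_mul, conjI, ← form_conj, conj_baseChange_pow,
          Idx.len_swap, Prod.fst_swap, Prod.snd_swap, neg_sub]
      · rw [hB0 x hx, hB0 _ (fun hh => hx (swap_mem_tops.1 hh)), map_zero])
    (fun x u hu hu0 => by
      by_cases hx : x ∈ tops n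
      · rw [primitivePart_of_mem hx] at hu
        rw [hB x hx]
        have hu' := mem_bigrade.1 hu.1
        exact h.positive x hx u hu.1 (LinearMap.mem_ker.1 hu.2) fun hW =>
          hu0 (h.eq_zero_of_weight_lt (by omega) hu'.1 hu'.2.1 hW)
      · rw [primitivePart_of_notMem hx] at hu
        exact absurd hu hu0)
  refine ⟨g, b, hg, fun x hx => ?_, hb, fun x hx k hk l hl => ?_, hs, hc⟩
  · by_contra hne
    have := ho x 0 (Nat.pos_of_ne_zero hne) 0 (Nat.pos_of_ne_zero hne)
    rw [hB0 x hx, if_pos rfl] at this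
    exact zero_ne_one this
  · rw [← hB x hx]
    exact ho x l hl k hk

/-- The structure theorem: a polarized bigrading admits an adapted basis, on which `N` moves down
the strings and whose bidegrees give the bigrading and the Hodge filtration. -/
theorem exists_isAdapted (hQ : ∀ u v, Q u v = (-1) ^ n * Q v u) :
    ∃ (g : ℤ × ℤ → ℕ) (hg : ∀ x, g x.swap = g x) (c : Module.Basis (Idx n g) ℂ (Cx E)),
      IsAdapted Q hg c ∧ (∀ x, x ∉ tops n → g x = 0) ∧ N.baseChange ℂ = stringShift c ∧
      F = stdF c ∧ ∀ x, bigrade W F x = spanPart c {i | (i.fst, i.snd) = x} := by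
  obtain ⟨g, b, hg, hg0, hb, ho, hs, hconj⟩ := h.exists_primitive_bases hQ
  let v : Idx n g → Cx E := fun i => (N.baseChange ℂ ^ i.ht) (b i.top i.str)
  have hmem : ∀ i : Idx n g, i.top ∈ tops n := fun i =>
    mem_tops.2 ⟨i.spec.1.1.1, i.spec.1.1.2, i.spec.1.2.1.1, i.spec.1.2.1.2, i.spec.1.2.2⟩
  have hP : ∀ i : Idx n g, b i.top i.str ∈ primitivePart n W F N i.top := fun i =>
    hb _ _ i.spec.2.1
  have hv : ∀ i, v i ∈ bigrade W F (i.fst, i.snd) := fun i => by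
    have := hP i
    rw [primitivePart_of_mem (hmem i)] at this
    exact h.shift_bigrade i.ht this.1
  have hvconj : ∀ i, conj (v i) = v (i.swap hg) := fun i => by
    change conj ((N.baseChange ℂ ^ i.ht) (b i.top i.str)) = _
    rw [conj_baseChange_pow, hconj _ _ i.spec.2.1]
    rfl
  have hgram : ∀ i i', Q.baseChange ℂ (v i) (v i') = if i' = i.refl.swap hg then i.sgn else 0 := by
    intro i i'
    by_cases hne : i'.top = i.top.swap ∧ i.ht + i'.ht = len n i.top
    · have hle := i.spec.2.2
      change Q.baseChange ℂ ((N.baseChange ℂ ^ i.ht) (b i.top i.str))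
        ((N.baseChange ℂ ^ i'.ht) (b i'.top i'.str)) = _
      have hk' : i'.str < g i.top := by
        have := i'.spec.2.1
        rwa [hne.1, hg] at this
      rw [form_skew_pow Q h.skew, ← Module.End.mul_apply, ← pow_add, hne.2, hne.1,
        ← hconj _ _ hk']
      have e := ho i.top (hmem i) _ i.spec.2.1 _ hk'
      have e' : Q.baseChange ℂ (b i.top i.str) ((N.baseChange ℂ ^ len n i.top)
          (conj (b i.top i'.str))) = Complex.I ^ (i.top.2 - i.top.1) *
            if i'.str = i.str then 1 else 0 := by
        rw [← e, ← mul_assoc, ← zpow_add₀ Complex.I_ne_zero,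
          show i.top.2 - i.top.1 + (i.top.1 - i.top.2) = 0 by ring, zpow_zero, one_mul]
      rw [e']
      by_cases hs : i'.str = i.str
      · have hi' : i' = i.refl.swap hg := Idx.ext' hne.1 hs (by simp; omega)
        rw [if_pos hs, if_pos hi', mul_one, Idx.sgn]
      · rw [if_neg hs, if_neg (fun he => hs (by rw [he]; rfl)), mul_zero, mul_zero]
    · rw [if_neg]
      · exact h.form_strings_eq_zero (hmem i) (hmem i') (hP i) (hP i') hne
      · rintro rfl
        refine hne ⟨rfl, ?_⟩
        have := i.spec.2.2
        simp
        omega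
  -- The Gram matrix is monomial with nonzero entries.
  have hli : LinearIndependent ℂ v := by
    rw [linearIndependent_iff']
    intro s a ha i hi
    have := congrArg (fun w => Q.baseChange ℂ w (v (i.refl.swap hg))) ha
    simp only [map_sum, map_smul, LinearMap.sum_apply, LinearMap.smul_apply, smul_eq_mul, hgram,
      map_zero, LinearMap.zero_apply, (Idx.swap_injective hg).eq_iff, Idx.refl_injective.eq_iff,
      mul_ite, mul_zero, Finset.sum_ite_eq, if_pos hi] at this
    refine (mul_eq_zero.1 this).resolve_right ?_
    exact mul_ne_zero (pow_ne_zero _ (by norm_num)) (zpow_ne_zero _ Complex.I_ne_zero)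
  have hsp : Submodule.span ℂ (Set.range v) = ⊤ := by
    refine h.span_strings _ fun x hx w hw j hj => ?_
    have hle : Submodule.span ℂ (b x '' {k | k < g x}) ≤
        (Submodule.span ℂ (Set.range v)).comap (N.baseChange ℂ ^ j) := by
      refine Submodule.span_le.2 ?_
      rintro _ ⟨k, hk, rfl⟩
      have ht := mem_tops.1 hx
      exact Submodule.subset_span ⟨⟨⟨x, (k, j)⟩, Idx.mem_idxFinset.2
        ⟨⟨⟨ht.1, ht.2.1⟩, ⟨ht.2.2.1, ht.2.2.2.1⟩, ht.2.2.2.2⟩, hk, hj⟩⟩, rfl⟩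
    exact hle (hs x hw)
  let c : Module.Basis (Idx n g) ℂ (Cx E) := Module.Basis.mk hli hsp.ge
  have hcv : ∀ i, c i = v i := fun i => Module.Basis.mk_apply hli hsp.ge i
  -- Both sides are direct decompositions of `E_ℂ`, and one is contained in the other termwise.
  have hspan : (fun x => spanPart c {i | (i.fst, i.snd) = x}) = bigrade W F := by
    refine (h.iSupIndep_bigrade.le_iff_eq_of_iSup_eq_top ?_).1 fun x => ?_
    · rw [spanPart_iSup]
      exact spanPart_univ c fun i => Set.mem_iUnion.2 ⟨_, rfl⟩
    · refine Submodule.span_le.2 ?_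
      rintro _ ⟨i, rfl, rfl⟩
      rw [hcv]
      exact hv i
  refine ⟨g, hg, c, ⟨fun i => ?_, fun i i' => ?_⟩, hg0, ?_, ?_, fun x => (congrFun hspan x).symm⟩
  · rw [hcv, hcv, hvconj]
  · rw [hcv, hcv, hgram]
  · refine c.ext fun i => ?_
    rw [stringShift_basis, hcv]
    change N.baseChange ℂ ((N.baseChange ℂ ^ i.ht) (b i.top i.str)) = _
    rw [← Module.End.mul_apply, ← pow_succ']
    split_ifs with hle
    · rw [hcv]
      rfl
    · have hp := hP i
      rw [primitivePart_of_mem (hmem i)] at hp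
      have := i.spec.2.2
      rw [show i.ht = len n i.top by omega]
      exact LinearMap.mem_ker.1 hp.2
  · funext p
    refine le_antisymm ((h.F_le p).trans (iSup₂_le fun x hx => ?_)) (Submodule.span_le.2 ?_)
    · rw [← hspan]
      refine spanPart_mono c ?_
      rintro i rfl
      exact hx
    · rintro _ ⟨i, hi, rfl⟩
      rw [hcv]
      exact h.anti hi (mem_bigrade.1 (hv i)).1

end HasBigrading

end AdaptedBasis

/-! ### Polarized bigradings of split mixed Hodge structures and of points of the period domain -/

section Sources

variable {E : Type*} [AddCommGroup E] [Module ℝ E] {n : ℕ} {Q : LinearMap.BilinForm ℝ E}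
    {h : ℤ → ℤ → ℕ} {W : ℤ → Submodule ℝ E} {F : ℤ → Submodule ℂ (Cx E)} {N : Module.End ℝ E}

theorem IsRSplit.deligneI_eq (hs : IsRSplit W F) (p q : ℤ) :
    deligneI W F p q = bigrade W F (p, q) := by
  refine le_antisymm (fun v hv => ?_) (fun v hv => ?_)
  · have hc : conj v ∈ deligneI W F q p := by
      rw [← hs q p] at hv
      exact hv
    exact mem_bigrade.2 ⟨hv.1.1, hc.1.1, hv.1.2⟩
  · obtain ⟨h1, h2, h3⟩ := mem_bigrade.1 hv
    exact ⟨⟨h1, h3⟩, Submodule.mem_sup_left ⟨h2, h3⟩⟩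

namespace IsPMHS

variable (hP : IsPMHS n Q h W F N)
include hP

theorem W_mono {k l : ℤ} (hkl : k ≤ l) : W k ≤ W l := by
  have := hP.weight.mono (show k - n ≤ l - n by omega)
  simpa using this

/-- Deligne's correction argument: below the weight `k`, every vector is the sum of a vector of
`F^p` and of a vector that the definition of `I^{p,k-p}` admits as a correction. -/
theorem W_le_sup_deligneU (k p m : ℤ) (hm : m ≤ k - 1) : (W m).baseChange ℂ ≤
    F p ⊓ (W m).baseChange ℂ ⊔ ((conjSub (F (k - p)) ⊓ (W k).baseChange ℂ) ⊔
      conjSub (deligneU W F (k - p - 1) (k - 2))) := by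
  obtain ⟨a, ha⟩ := hP.weight.exists_bot
  set S := (conjSub (F (k - p)) ⊓ (W k).baseChange ℂ) ⊔ conjSub (deligneU W F (k - p - 1) (k - 2))
  have key : ∀ (t : ℕ) (m : ℤ), m ≤ a + n + t → m ≤ k - 1 →
      (W m).baseChange ℂ ≤ F p ⊓ (W m).baseChange ℂ ⊔ S := by
    intro t
    induction t with
    | zero =>
      intro m hm _
      refine (baseChange_mono (hP.W_mono (show m ≤ a + n by omega))).trans ?_
      rw [ha, Submodule.baseChange_bot]
      exact bot_le
    | succ t ih =>
      intro m hmt hm v hv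
      rw [← (hP.mixed m p).2] at hv
      obtain ⟨y, hy, z, hz, rfl⟩ := Submodule.mem_sup.1 hv
      obtain ⟨y₁, hy₁, w₁, hw₁, rfl⟩ := Submodule.mem_sup.1 hy
      obtain ⟨z₁, hz₁, w₂, hw₂, hzw⟩ := Submodule.mem_sup.1 (show conj z ∈ _ from hz)
      have hz' : z = conj z₁ + conj w₂ := by
        rw [← map_add, hzw, conj_conj]
      -- The error term has weight at most `m - 1`, so that the induction hypothesis applies.
      have hw : w₁ + conj w₂ ∈ F p ⊓ (W m).baseChange ℂ ⊔ S := by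
        refine sup_le_sup_right (inf_le_inf_left _ (baseChange_mono (hP.W_mono
          (show m - 1 ≤ m by omega)))) S (ih (m - 1) (by push_cast at hmt; omega) (by omega) ?_)
        exact Submodule.add_mem _ hw₁ (conj_mem_baseChange.2 hw₂)
      -- For `m = k - 1` the term lies in `conj F^{k-p}`, and for `m ≤ k - 2` in the correction space,
      -- whose Hodge index drops together with the weight.
      have hzS : conj z₁ ∈ S := by
        rcases hm.lt_or_eq with hlt | rfl
        · obtain ⟨j, hj⟩ := Int.eq_ofNat_of_zero_le (show 0 ≤ k - 2 - m by omega)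
          refine Submodule.mem_sup_right ?_
          change conj (conj z₁) ∈ deligneU W F (k - p - 1) (k - 2)
          rw [conj_conj]
          refine Submodule.mem_iSup_of_mem j ?_
          rwa [show k - p - 1 - (j : ℤ) = m + 1 - p by omega,
            show k - 2 - (j : ℤ) = m by omega]
        · refine Submodule.mem_sup_left ⟨?_, conj_mem_baseChange.2
            (baseChange_mono (hP.W_mono (by omega)) hz₁.2)⟩
          change conj (conj z₁) ∈ F (k - p)
          rw [conj_conj, show k - p = k - 1 + 1 - p by ring]
          exact hz₁.1
      rw [hz', show y₁ + w₁ + (conj z₁ + conj w₂) = y₁ + conj z₁ + (w₁ + conj w₂) by abel]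
      exact Submodule.add_mem _ (Submodule.add_mem _ (Submodule.mem_sup_left hy₁)
        (Submodule.mem_sup_right hzS)) hw
  exact key (m - (a + n)).toNat m (by omega) hm

theorem hodgePiece_le (k p : ℤ) : hodgePiece (W (k - 1)) (W k) F p (k - p) ≤
    deligneI W F p (k - p) ⊔ (W (k - 1)).baseChange ℂ := by
  intro x hx
  obtain ⟨a, ha, w₁, hw₁, hx₁⟩ := Submodule.mem_sup.1 hx.1
  obtain ⟨b, hb, w₂, hw₂, hx₂⟩ := Submodule.mem_sup.1 (show conj x ∈ _ from hx.2)
  have hx' : x = conj b + conj w₂ := by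
    rw [← map_add, hx₂, conj_conj]
  have hab : a - conj b ∈ (W (k - 1)).baseChange ℂ := by
    rw [show a - conj b = conj w₂ - w₁ by
      rw [sub_eq_sub_iff_add_eq_add, hx₁, hx', add_comm]]
    exact Submodule.sub_mem _ (conj_mem_baseChange.2 hw₂) hw₁
  obtain ⟨a', ha', s, hs, has⟩ := Submodule.mem_sup.1 (hP.W_le_sup_deligneU k p (k - 1) le_rfl hab)
  have hmem : a - a' ∈ deligneI W F p (k - p) := by
    have hle := baseChange_mono (hP.W_mono (show k - 1 ≤ k by omega))
    rw [deligneI, show p + (k - p) = k by ring]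
    refine ⟨⟨Submodule.sub_mem _ ha.1 ha'.1, Submodule.sub_mem _ ha.2 (hle ha'.2)⟩, ?_⟩
    rw [show a - a' = conj b + s by
      rw [sub_eq_iff_eq_add, add_assoc, add_comm s, has]
      abel]
    refine Submodule.add_mem _ (Submodule.mem_sup_left ⟨?_, conj_mem_baseChange.2 hb.2⟩) hs
    change conj (conj b) ∈ F (k - p)
    rw [conj_conj]
    exact hb.1
  rw [← hx₁, show a + w₁ = (a - a') + (a' + w₁) by abel]
  exact Submodule.add_mem _ (Submodule.mem_sup_left hmem)
    (Submodule.mem_sup_right (Submodule.add_mem _ ha'.2 hw₁))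

theorem hasBigrading (hs : IsRSplit W F) : HasBigrading n Q W F N where
  anti := hP.mem_compactDual.1
  F_top := hP.mem_compactDual.2.1
  F_bot := hP.mem_compactDual.2.2.1
  skew := hP.skew
  weight := hP.weight
  mixed := hP.mixed
  transversal := hP.transversal
  lift k p := by
    rw [← hs.deligneI_eq]
    exact hP.hodgePiece_le k p
  isotropic x y hxy v hv w hw :=
    hP.mem_compactDual.2.2.2.2 x.1 (n + 1 - x.1) (by ring) v (mem_bigrade.1 hv).1 w
      (hP.mem_compactDual.1 (by omega) (mem_bigrade.1 hw).1)
  positive x hx v hv hN hvW := by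
    have hl := Idx.len_cast (mem_tops.1 hx).2.2.2.2
    have hk : x.1 + x.2 = n + len n x := by omega
    obtain ⟨h1, h2, h3⟩ := mem_bigrade.1 hv
    have hprim : v ∈ (primitive n W N (len n x)).baseChange ℂ := by
      rw [primitive, baseChange_inf, baseChange_comap, ← hk]
      refine ⟨h3, ?_⟩
      change (N ^ (len n x + 1)).baseChange ℂ v ∈ (W (n - len n x - 3)).baseChange ℂ
      rw [baseChange_pow_apply, hN]
      exact Submodule.zero_mem _
    rw [hk] at hvW
    have := ((hP.primitive_polarized (len n x)).positive x.1 x.2 hk v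
      ⟨Submodule.mem_sup_left ⟨h1, hprim⟩,
        Submodule.mem_sup_left ⟨h2, conj_mem_baseChange.2 hprim⟩⟩ hvW).2
    rwa [form_compRight, baseChange_pow_apply] at this

end IsPMHS

/-- The weight filtration of a pure Hodge structure of weight `n`. -/
noncomputable def pureW (n : ℕ) (k : ℤ) : Submodule ℝ E := if (n : ℤ) ≤ k then ⊤ else ⊥

theorem pureW_of_le {k : ℤ} (hk : (n : ℤ) ≤ k) : pureW (E := E) n k = ⊤ := if_pos hk

theorem pureW_of_lt {k : ℤ} (hk : k < n) : pureW (E := E) n k = ⊥ := if_neg (not_le.2 hk)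

theorem pureW_sub_one {k : ℤ} (hk : k ≠ n) : pureW (E := E) n (k - 1) = pureW n k := by
  rcases lt_or_gt_of_ne hk with h | h
  · rw [pureW_of_lt h, pureW_of_lt (by omega)]
  · rw [pureW_of_le (by omega), pureW_of_le (by omega)]

theorem isJacobsonMorosov_pureW :
    IsJacobsonMorosov (0 : Module.End ℝ E) (fun ℓ => pureW n (ℓ + n)) where
  mono k l hkl := by
    dsimp only
    by_cases hl : (n : ℤ) ≤ l + n
    · rw [pureW_of_le hl]
      exact le_top
    · rw [pureW_of_lt (k := k + n) (by omega)]
      exact bot_le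
  exists_bot := ⟨-1, pureW_of_lt (by omega)⟩
  exists_top := ⟨0, pureW_of_le (by omega)⟩
  shift ℓ v _ := by
    rw [LinearMap.zero_apply]
    exact Submodule.zero_mem _
  gr_injective ℓ v _ hv' := by
    rcases ℓ.eq_zero_or_pos with rfl | hl
    · simpa using hv'
    · rw [pureW_of_le (by omega)]
      exact Submodule.mem_top
  gr_surjective ℓ u hu := by
    rcases ℓ.eq_zero_or_pos with rfl | hl
    · refine ⟨u, by simpa using hu, ?_⟩
      rw [pow_zero, Module.End.one_apply, sub_self]
      exact Submodule.zero_mem _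
    · rw [pureW_of_lt (by omega), Submodule.mem_bot] at hu
      refine ⟨0, Submodule.zero_mem _, ?_⟩
      rw [hu, map_zero, sub_zero]
      exact Submodule.zero_mem _

section Pure

variable (hF : F ∈ periodDomain n Q h)
include hF

theorem periodDomain_eq_zero {p q : ℤ} (hpq : n < p + q) {v : Cx E} (h1 : v ∈ F p)
    (h2 : conj v ∈ F q) : v = 0 := by
  have h0 := (hF.2.2.2.1 p).1
  rw [inducedFil_bot_top, Submodule.baseChange_bot] at h0
  rw [← Submodule.mem_bot ℂ, ← h0]
  exact ⟨h1, hF.1 (by omega) h2⟩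

theorem bigrade_pureW_eq_bot {x : ℤ × ℤ} (hx : x.1 + x.2 ≠ n) : bigrade (pureW n) F x = ⊥ := by
  rw [eq_bot_iff]
  intro v hv
  obtain ⟨h1, h2, h3⟩ := mem_bigrade.1 hv
  rcases lt_or_gt_of_ne hx with hlt | hgt
  · rwa [pureW_of_lt hlt, Submodule.baseChange_bot] at h3
  · exact periodDomain_eq_zero hF hgt h1 h2

omit hF in
theorem bigrade_pureW_eq_hodgePiece {x : ℤ × ℤ} (hx : x.1 + x.2 = n) :
    bigrade (pureW n) F x = hodgePiece ⊥ ⊤ F x.1 x.2 := by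
  rw [bigrade, pureW_of_le hx.ge, Submodule.baseChange_top, inf_top_eq, hodgePiece,
    inducedFil_bot_top]

/-- A point of the period domain is a polarized bigrading with `N = 0`. -/
theorem hasBigrading_pureW : HasBigrading n Q (pureW n) F 0 where
  anti := hF.1
  F_top := hF.2.1
  F_bot := hF.2.2.1
  skew u v := by simp
  weight := isJacobsonMorosov_pureW
  mixed k p := by
    by_cases hk : k = n
    · subst hk
      rw [pureW_of_lt (by omega), pureW_of_le le_rfl]
      exact hF.2.2.2.1 p
    · rw [pureW_sub_one hk]
      have e : ∀ p, inducedFil (pureW n k) (pureW n k) F p = (pureW n k).baseChange ℂ := fun p =>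
        sup_eq_right.2 inf_le_right
      rw [e, e, conjSub_baseChange, inf_idem, sup_idem]
      exact ⟨rfl, rfl⟩
  transversal p v _ := by
    rw [LinearMap.baseChange_zero, LinearMap.zero_apply]
    exact Submodule.zero_mem _
  lift k p := by
    by_cases hk : k = n
    · subst hk
      rw [bigrade_pureW_eq_hodgePiece (by simp), pureW_of_lt (by omega), pureW_of_le le_rfl]
      exact le_sup_left
    · rw [pureW_sub_one hk]
      exact (inf_le_left.trans (sup_le inf_le_right le_rfl)).trans le_sup_right
  isotropic x y hxy v hv w hw := by
    by_cases hx : x.1 + x.2 = n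
    · by_cases hy : y.1 + y.2 = n
      · rw [bigrade_pureW_eq_hodgePiece hx] at hv
        rw [bigrade_pureW_eq_hodgePiece hy] at hw
        refine hF.2.2.2.2.1.orthogonal x.1 x.2 y.1 y.2 hx hy ?_ v hv w hw
        rw [ne_eq, Prod.mk.injEq]
        omega
      · rw [bigrade_pureW_eq_bot hF hy, Submodule.mem_bot] at hw
        rw [hw, map_zero]
    · rw [bigrade_pureW_eq_bot hF hx, Submodule.mem_bot] at hv
      rw [hv, map_zero, LinearMap.zero_apply]
  positive x hx v hv _ hvW := by
    have hl := Idx.len_cast (mem_tops.1 hx).2.2.2.2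
    by_cases hn : x.1 + x.2 = n
    · rw [bigrade_pureW_eq_hodgePiece hn] at hv
      rw [pureW_of_lt (by omega)] at hvW
      rw [show len n x = 0 by omega, pow_zero, Module.End.one_apply]
      exact (hF.2.2.2.2.1.positive x.1 x.2 hn v hv hvW).2
    · refine absurd ?_ hvW
      rw [pureW_of_le (by omega), Submodule.baseChange_top]
      exact Submodule.mem_top

/-- The Hodge numbers are the column counts of any basis that is adapted to the bigrading. -/
theorem col_of_periodDomain {g : ℤ × ℤ → ℕ} (c : Module.Basis (Idx n g) ℂ (Cx E))
    (hc : ∀ x, bigrade (pureW n) F x = spanPart c {i | (i.fst, i.snd) = x}) (r : ℤ) :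
    Idx.col n g r = h r (n - r) := by
  classical
  have hcnt : ∀ x, Idx.cnt n g x = Module.finrank ℂ (bigrade (pureW n) F x) := fun x => by
    rw [hc, finrank_spanPart, Idx.cnt]
  rw [← hF.2.2.2.2.2 r (n - r) (by ring),
    ← bigrade_pureW_eq_hodgePiece (n := n) (x := (r, (n : ℤ) - r)) (by simp), ← hcnt,
    Idx.col_eq_sum_cnt]
  refine Finset.sum_eq_single _ (fun b _ hb => ?_) (fun hr => ?_)
  · rw [hcnt, bigrade_pureW_eq_bot hF (by dsimp only; omega), finrank_bot]
  · rw [Finset.mem_Icc] at hr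
    exact Idx.cnt_eq_zero (by omega)

end Pure

end Sources

/-! ### Changing the type of an adapted basis

The symmetry `T` below is the composition of the polarization with a positive definite Hermitian
form for which the given basis is orthonormal. Like the Weil operator of a polarized Hodge
structure, it is real and `T ^ 2 = (-1) ^ n`. The form `Q` is determined up to isometry by the
dimensions of the two eigenspaces of `T`, that is, by `dim E` and the trace of `T`. -/

section WeilOperator

variable {X : Type*} [AddCommGroup X] [Module ℂ X] {n : ℕ} {g : ℤ × ℤ → ℕ}
  (hg : ∀ x, g x.swap = g x) (c : Module.Basis (Idx n g) ℂ X)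

theorem repr_equivFun_symm (f : Idx n g → ℂ) (i : Idx n g) :
    c.repr (c.equivFun.symm f) i = f i := by
  rw [← Module.Basis.equivFun_apply, LinearEquiv.apply_symm_apply]

/-- The conjugation that exchanges the strings starting in bidegrees `(p, q)` and `(q, p)`. -/
noncomputable def modelConj : X →ₛₗ[starRingEnd ℂ] X where
  toFun u := c.equivFun.symm fun i => starRingEnd ℂ (c.repr u (i.swap hg))
  map_add' u v := by
    rw [← map_add]
    congr 1
    funext i
    simp
  map_smul' a u := by
    rw [← map_smul]
    congr 1
    funext i
    simp

/-- The operator that reflects the strings, with signs. -/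
noncomputable def modelWeil : X →ₗ[ℂ] X where
  toFun u := c.equivFun.symm fun i => starRingEnd ℂ i.sgn * c.repr u i.refl
  map_add' u v := by
    rw [← map_add]
    congr 1
    funext i
    simp [mul_add]
  map_smul' a u := by
    rw [← map_smul]
    congr 1
    funext i
    simp
    ring

/-- The Hermitian form for which the basis `c` is orthonormal. -/
noncomputable def modelHerm (u v : X) : ℂ := ∑ i, starRingEnd ℂ (c.repr u i) * c.repr v i

theorem repr_modelConj (u : X) (i : Idx n g) :
    c.repr (modelConj hg c u) i = starRingEnd ℂ (c.repr u (i.swap hg)) :=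
  repr_equivFun_symm c _ i

theorem repr_modelWeil (u : X) (i : Idx n g) :
    c.repr (modelWeil c u) i = starRingEnd ℂ i.sgn * c.repr u i.refl :=
  repr_equivFun_symm c _ i

theorem modelConj_modelConj (u : X) : modelConj hg c (modelConj hg c u) = u := by
  apply c.repr.injective
  ext i
  rw [repr_modelConj, repr_modelConj, Idx.swap_swap, Complex.conj_conj]

theorem conj_I_zpow (d : ℤ) : starRingEnd ℂ (Complex.I ^ d) = Complex.I ^ (-d) := by
  rw [map_zpow₀, Complex.conj_I, ← Complex.inv_I, inv_zpow, ← zpow_neg]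

theorem Idx.sgn_swap (i : Idx n g) : (i.swap hg).sgn = starRingEnd ℂ i.sgn := by
  rw [Idx.sgn, Idx.sgn, map_mul, conj_I_zpow, map_pow, map_neg, map_one, Idx.swap_ht, Idx.swap_top,
    Prod.fst_swap, Prod.snd_swap, neg_sub]

theorem Idx.sgn_mul_sgn_refl (i : Idx n g) : i.sgn * i.refl.sgn = (-1) ^ n := by
  have hI := Complex.I_ne_zero
  have hb := i.bounds
  have e2 : (-1 : ℂ) = Complex.I ^ (2 : ℤ) := by
    rw [zpow_ofNat, Complex.I_sq]
  have e4 : Complex.I ^ (4 : ℤ) = 1 := by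
    rw [zpow_ofNat, Complex.I_pow_four]
  rw [Idx.sgn, Idx.sgn, Idx.refl_ht, Idx.refl_top, mul_mul_mul_comm, ← pow_add,
    Nat.add_sub_cancel' hb.2.1, e2, ← zpow_natCast, ← zpow_natCast, ← zpow_mul, ← zpow_mul,
    ← zpow_add₀ hI, ← zpow_add₀ hI, hb.1,
    show 2 * (i.top.1 + i.top.2 - (n : ℤ)) + (i.top.2 - i.top.1 + (i.top.2 - i.top.1)) =
      2 * n + 4 * (i.top.2 - n) by ring, zpow_add₀ hI, zpow_mul _ 4, e4, one_zpow, mul_one]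

theorem Idx.sgn_mul_conj_sgn (i : Idx n g) : i.sgn * starRingEnd ℂ i.sgn = 1 := by
  rw [Idx.sgn, map_mul, conj_I_zpow, map_pow, map_neg, map_one, mul_mul_mul_comm, ← mul_pow,
    ← zpow_add₀ Complex.I_ne_zero]
  simp

theorem modelWeil_modelWeil (u : X) : modelWeil c (modelWeil c u) = (-1 : ℂ) ^ n • u := by
  apply c.repr.injective
  ext i
  rw [repr_modelWeil, repr_modelWeil, Idx.refl_refl, ← mul_assoc, ← map_mul, Idx.sgn_mul_sgn_refl,
    map_smul, Finsupp.smul_apply, smul_eq_mul, map_pow, map_neg, map_one]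

theorem modelWeil_modelConj (u : X) :
    modelWeil c (modelConj hg c u) = modelConj hg c (modelWeil c u) := by
  apply c.repr.injective
  ext i
  rw [repr_modelWeil, repr_modelConj, repr_modelConj, repr_modelWeil, map_mul, Idx.sgn_swap,
    Complex.conj_conj, Idx.refl_swap]

theorem isHermitianForm_modelHerm : IsHermitianForm (modelHerm c) where
  symm u v := by
    simp only [modelHerm, map_sum, map_mul, Complex.conj_conj]
    exact Finset.sum_congr rfl fun i _ => mul_comm _ _
  add_left u v w := by
    simp only [modelHerm, map_add, Finsupp.add_apply, add_mul, Finset.sum_add_distrib]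
  smul_left a u v := by
    simp only [modelHerm, map_smul, Finsupp.smul_apply, smul_eq_mul, map_mul, mul_assoc,
      Finset.mul_sum]

theorem modelHerm_pos {u : X} (hu : u ≠ 0) : 0 < (modelHerm c u u).re := by
  have e : modelHerm c u u = ((∑ i, Complex.normSq (c.repr u i) : ℝ) : ℂ) := by
    rw [modelHerm, Complex.ofReal_sum]
    refine Finset.sum_congr rfl fun i _ => ?_
    rw [mul_comm, Complex.mul_conj]
  rw [e, Complex.ofReal_re]
  have : ∃ i, c.repr u i ≠ 0 := by
    by_contra! hall
    exact hu (c.repr.injective (by ext i; simp [hall]))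
  obtain ⟨i, hi⟩ := this
  exact Finset.sum_pos' (fun i _ => Complex.normSq_nonneg _)
    ⟨i, Finset.mem_univ _, Complex.normSq_pos.2 hi⟩

theorem modelHerm_modelConj (u v : X) : modelHerm c (modelConj hg c u) (modelConj hg c v) =
    starRingEnd ℂ (modelHerm c u v) := by
  simp only [modelHerm, repr_modelConj, map_sum, map_mul]
  exact Equiv.sum_comp (Function.Involutive.toPerm _ (Idx.swap_swap hg))
    (fun i : Idx n g => starRingEnd ℂ (starRingEnd ℂ (c.repr u i)) * starRingEnd ℂ (c.repr v i))

theorem modelHerm_modelWeil (u v : X) :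
    modelHerm c (modelWeil c u) (modelWeil c v) = modelHerm c u v := by
  have e : ∀ i : Idx n g, starRingEnd ℂ (c.repr (modelWeil c u) i) * c.repr (modelWeil c v) i =
      starRingEnd ℂ (c.repr u i.refl) * c.repr v i.refl := fun i => by
    rw [repr_modelWeil, repr_modelWeil, map_mul, Complex.conj_conj, mul_mul_mul_comm,
      Idx.sgn_mul_conj_sgn, one_mul]
  simp only [modelHerm, e]
  exact Equiv.sum_comp (Function.Involutive.toPerm _ Idx.refl_refl)
    (fun i : Idx n g => starRingEnd ℂ (c.repr u i) * c.repr v i)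

theorem modelConj_basis (i : Idx n g) : modelConj hg c (c i) = c (i.swap hg) := by
  classical
  apply c.repr.injective
  ext i'
  rw [repr_modelConj, Module.Basis.repr_self, Module.Basis.repr_self, Finsupp.single_apply,
    Finsupp.single_apply]
  by_cases h : i = i'.swap hg
  · rw [if_pos h, if_pos (by rw [h, Idx.swap_swap]), map_one]
  · rw [if_neg h, if_neg (fun hh => h (by rw [← hh, Idx.swap_swap])), map_zero]

theorem modelHerm_basis_right (u : X) (i : Idx n g) :
    modelHerm c u (c i) = starRingEnd ℂ (c.repr u i) := by
  classical
  simp [modelHerm, Finsupp.single_apply]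

theorem modelHerm_modelWeil_modelConj_basis (i i' : Idx n g) :
    modelHerm c (modelWeil c (modelConj hg c (c i'))) (c i) =
      if i' = i.refl.swap hg then i.sgn else 0 := by
  classical
  rw [modelHerm_basis_right, repr_modelWeil, modelConj_basis, Module.Basis.repr_self,
    Finsupp.single_apply, map_mul, Complex.conj_conj]
  by_cases h : i' = i.refl.swap hg
  · rw [if_pos h, if_pos (by rw [h, Idx.swap_swap]), map_one, mul_one]
  · rw [if_neg h, if_neg (fun hh => h (by rw [← hh, Idx.swap_swap])), map_zero, mul_zero]

theorem trace_modelWeil :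
    LinearMap.trace ℂ X (modelWeil c) = ∑ i : Idx n g, Complex.I ^ (2 * i.fst - n) := by
  classical
  rw [← Idx.sum_sgn_refl, LinearMap.trace_eq_matrix_trace ℂ c, Matrix.trace]
  refine Finset.sum_congr rfl fun i _ => ?_
  rw [Matrix.diag_apply, LinearMap.toMatrix_apply, repr_modelWeil, Module.Basis.repr_self,
    Finsupp.single_apply]
  by_cases h : i.refl = i
  · rw [if_pos h, if_pos h.symm, h, mul_one]
  · rw [if_neg h, if_neg (fun hh => h hh.symm), mul_zero]

/-- The eigenvalues of an operator with square `(-1) ^ n`. -/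
noncomputable def eigSign (n : ℕ) (a : Bool) : ℂ := if a then Complex.I ^ n else -Complex.I ^ n

/-- The permutation of the two eigenvalues by complex conjugation. -/
def eigConj (n : ℕ) (a : Bool) : Bool := if Even n then a else !a

theorem eigConj_eigConj (n : ℕ) (a : Bool) : eigConj n (eigConj n a) = a := by
  unfold eigConj
  split_ifs <;> simp

theorem conj_eigSign (n : ℕ) (a : Bool) :
    starRingEnd ℂ (eigSign n a) = eigSign n (eigConj n a) := by
  have h : starRingEnd ℂ (Complex.I ^ n) = (-1) ^ n * Complex.I ^ n := by
    rw [map_pow, Complex.conj_I, ← mul_pow, neg_one_mul]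
  unfold eigSign eigConj
  by_cases hn : Even n
  · rw [hn.neg_one_pow, one_mul] at h
    cases a <;> simp [hn, h]
  · rw [(Nat.not_even_iff_odd.1 hn).neg_one_pow, neg_one_mul] at h
    cases a <;> simp [hn, h]

theorem eigSign_mul_self (n : ℕ) (a : Bool) : eigSign n a * eigSign n a = (-1) ^ n := by
  unfold eigSign
  cases a <;> simp [← mul_pow]

theorem eigSign_ne_zero (n : ℕ) (a : Bool) : eigSign n a ≠ 0 := fun h => by
  have := eigSign_mul_self n a
  rw [h, zero_mul] at this
  exact pow_ne_zero n (by norm_num) this.symm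

/-- An orthonormal eigenbasis of the symmetry `T` that conjugation permutes. The sizes `m a` of its
two parts depend only on the trace of `T` and on the dimension. -/
theorem exists_weil_eigenbasis : ∃ (m : Bool → ℕ) (b : Bool → ℕ → X)
    (β : Module.Basis (Σ a : Bool, Fin (m a)) ℂ X), (∀ x, β x = b x.1 x.2) ∧
    (∀ a, m (eigConj n a) = m a) ∧
    (∀ a, ∀ k < m a, modelConj hg c (b a k) = b (eigConj n a) k) ∧
    (∀ a, ∀ k < m a, modelWeil c (b a k) = eigSign n a • b a k) ∧
    (∀ x y, modelHerm c (β x) (β y) = if x = y then 1 else 0) ∧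
    ((m true : ℂ) - m false) * Complex.I ^ n = ∑ i : Idx n g, Complex.I ^ (2 * i.fst - n) ∧
    m true + m false = Fintype.card (Idx n g) := by
  classical
  have : FiniteDimensional ℂ X := Module.Finite.of_basis c
  let Y : Bool → Submodule ℂ X := fun a => LinearMap.ker (modelWeil c - eigSign n a • LinearMap.id)
  have hY : ∀ a u, u ∈ Y a ↔ modelWeil c u = eigSign n a • u := fun a u => by
    rw [LinearMap.mem_ker, LinearMap.sub_apply, sub_eq_zero]
    rfl
  have herm := isHermitianForm_modelHerm c
  obtain ⟨m, b, hm, hb, ho, hs, hconj⟩ := exists_orthonormal_conj (modelConj hg c)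
    (modelConj_modelConj hg c) (eigConj n) (eigConj_eigConj n) (fun a => a = true)
    (fun a ha => by
      unfold eigConj at ha ⊢
      split_ifs at ha ⊢ with hn
      · exact absurd rfl ha
      · cases a <;> simp)
    Y (fun a u hu => by
      rw [hY] at hu ⊢
      rw [modelWeil_modelConj, hu, LinearMap.map_smulₛₗ, conj_eigSign])
    (fun _ => modelHerm c) (fun _ => herm) (fun _ => modelHerm_modelConj hg c)
    (fun _ u _ hu => modelHerm_pos c hu)
  have hT : ∀ a, ∀ k < m a, modelWeil c (b a k) = eigSign n a • b a k := fun a k hk =>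
    (hY _ _).1 (hb a k hk)
  let v : (Σ a : Bool, Fin (m a)) → X := fun x => b x.1 x.2
  have hv : ∀ x y, modelHerm c (v x) (v y) = if x = y then 1 else 0 := by
    rintro ⟨a, k⟩ ⟨a', k'⟩
    by_cases haa : a = a'
    · subst haa
      refine (ho a k k.2 k' k'.2).trans ?_
      by_cases hk : k = k'
      · rw [if_pos (by rw [hk]), if_pos (by rw [hk])]
      · rw [if_neg (fun h => hk (Fin.ext h)), if_neg (fun h => hk (by simpa using h))]
    · rw [if_neg (fun h => haa (congrArg Sigma.fst h))]
      -- Eigenvectors of a unitary operator for distinct eigenvalues are orthogonal.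
      have e := modelHerm_modelWeil c (v ⟨a, k⟩) (v ⟨a', k'⟩)
      have e1 : modelWeil c (v ⟨a, k⟩) = eigSign n a • v ⟨a, k⟩ := hT a k k.2
      have e2 : modelWeil c (v ⟨a', k'⟩) = eigSign n a' • v ⟨a', k'⟩ := hT a' k' k'.2
      have e3 : starRingEnd ℂ (eigSign n a) * eigSign n a' = -1 := by
        have h1 : starRingEnd ℂ (Complex.I ^ n) * Complex.I ^ n = 1 := by
          rw [map_pow, Complex.conj_I, ← mul_pow]
          simp
        unfold eigSign
        cases a <;> cases a' <;> simp_all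
      rw [e1, e2, herm.smul_left, herm.smul_right, ← mul_assoc, e3, neg_one_mul] at e
      exact self_eq_neg.1 e.symm
  have hspan : Submodule.span ℂ (Set.range v) = ⊤ := by
    have hle : ∀ a, Y a ≤ Submodule.span ℂ (Set.range v) := fun a => by
      refine (hs a).trans (Submodule.span_le.2 ?_)
      rintro _ ⟨k, hk, rfl⟩
      exact Submodule.subset_span ⟨⟨a, ⟨k, hk⟩⟩, rfl⟩
    rw [eq_top_iff]
    intro u _
    -- As `T ^ 2 = (±λ) ^ 2`, the vectors `T u ± λ u` are eigenvectors, and `u` is a multiple of their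
    -- difference.
    have hYu : ∀ a, eigSign n a • u + modelWeil c u ∈ Y a := fun a => by
      rw [hY, map_add, map_smul, modelWeil_modelWeil, ← eigSign_mul_self n a, smul_add, mul_smul,
        add_comm]
    have e : u = (2 * eigSign n true)⁻¹ •
        ((eigSign n true • u + modelWeil c u) - (eigSign n false • u + modelWeil c u)) := by
      have e1 : eigSign n false = -eigSign n true := by simp [eigSign]
      rw [e1, add_sub_add_right_eq_sub, ← sub_smul, sub_neg_eq_add, ← two_mul, smul_smul,
        inv_mul_cancel₀ (mul_ne_zero two_ne_zero (eigSign_ne_zero n true)), one_smul]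
    rw [e]
    exact Submodule.smul_mem _ _ (Submodule.sub_mem _ (hle _ (hYu true)) (hle _ (hYu false)))
  let β : Module.Basis (Σ a : Bool, Fin (m a)) ℂ X :=
    Module.Basis.mk (herm.linearIndependent hv) hspan.ge
  have hβ : ∀ x, β x = v x := fun x => Module.Basis.mk_apply _ _ x
  refine ⟨m, b, β, hβ, hm, hconj, hT, fun x y => by rw [hβ, hβ, hv], ?_, ?_⟩
  · rw [← trace_modelWeil c, LinearMap.trace_eq_matrix_trace ℂ β, Matrix.trace]
    have e : ∀ x, (LinearMap.toMatrix β β (modelWeil c)).diag x = eigSign n x.1 := fun x => by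
      rw [Matrix.diag_apply, LinearMap.toMatrix_apply]
      have : modelWeil c (β x) = eigSign n x.1 • β x := by
        rw [hβ]
        exact hT x.1 x.2 x.2.2
      rw [this, map_smul, Module.Basis.repr_self]
      simp
    rw [Finset.sum_congr rfl fun x _ => e x, Fintype.sum_sigma, Fintype.sum_bool]
    simp [eigSign]
    ring
  · rw [← Module.finrank_eq_card_basis c, Module.finrank_eq_card_basis β, Fintype.card_sigma]
    simp

end WeilOperator

section Change

variable {E : Type*} [AddCommGroup E] [Module ℝ E] {n : ℕ} {g g' : ℤ × ℤ → ℕ}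
  {Q : LinearMap.BilinForm ℝ E}

namespace IsAdapted

variable {hg : ∀ x, g x.swap = g x} {c : Module.Basis (Idx n g) ℂ (Cx E)} (hc : IsAdapted Q hg c)
include hc

theorem modelConj_eq (u : Cx E) : modelConj hg c u = conj u := by
  apply c.repr.injective
  ext i
  rw [repr_modelConj, hc.repr_conj]

theorem form_eq_modelHerm (u v : Cx E) :
    Q.baseChange ℂ u v = modelHerm c (modelWeil c (conj v)) u := by
  rw [hc.form_eq_sum, modelHerm]
  refine Finset.sum_congr rfl fun i _ => ?_
  rw [repr_modelWeil, hc.repr_conj, map_mul, Complex.conj_conj, Complex.conj_conj]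
  ring

/-- Adapted bases of all types with the same Hodge numbers exist in the same space. -/
theorem exists_of_col_eq (hg' : ∀ x, g' x.swap = g' x)
    (hcol : ∀ r, Idx.col n g' r = Idx.col n g r) :
    ∃ c' : Module.Basis (Idx n g') ℂ (Cx E), IsAdapted Q hg' c' := by
  obtain ⟨m, b, β, hβ, hm, hconj, hT, ho, htr, hcard⟩ := exists_weil_eigenbasis hg c
  set d : Module.Basis (Idx n g') ℂ (Idx n g' → ℂ) := Pi.basisFun ℂ _
  obtain ⟨m', b', β', hβ', hm', hconj', hT', ho', htr', hcard'⟩ := exists_weil_eigenbasis hg' d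
  -- The sum and the difference of the multiplicities of the two eigenvalues are the dimension and,
  -- up to a power of `i`, the trace; both are sums over the columns.
  have hmm : m' = m := by
    have h1 : ((m' true : ℂ) - m' false) = (m true : ℂ) - m false := by
      refine mul_right_cancel₀ (pow_ne_zero n Complex.I_ne_zero) ?_
      rw [htr, htr', Idx.sum_fst (fun r => Complex.I ^ (2 * r - n)),
        Idx.sum_fst (fun r => Complex.I ^ (2 * r - n))]
      simp only [hcol]
    have h2 : m' true + m' false = m true + m false := by
      rw [hcard, hcard', Idx.card_eq_sum_col, Idx.card_eq_sum_col]
      simp only [hcol]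
    have h3 : m' true + m false = m true + m' false := by
      have : (m' true : ℂ) + m false = m true + m' false := by linear_combination h1
      exact_mod_cast this
    funext a
    cases a <;> omega
  subst hmm
  -- Matching the eigenbases transports the model of type `g'` to `E_ℂ`, compatibly with `T`,
  -- conjugation and the Hermitian forms, hence with `Q`.
  let Φ : (Idx n g' → ℂ) ≃ₗ[ℂ] Cx E := β'.equiv β (Equiv.refl _)
  have hΦ : ∀ a, ∀ k < m' a, Φ (b' a k) = b a k := fun a k hk => by
    have := β'.equiv_apply ⟨a, ⟨k, hk⟩⟩ β (Equiv.refl _)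
    rwa [hβ', Equiv.refl_apply, hβ] at this
  have hΦT : ∀ u, Φ (modelWeil d u) = modelWeil c (Φ u) := fun u => by
    induction u using basis_induction β' with
    | zero => simp
    | add u v hu hv => simp only [map_add, hu, hv]
    | smul a u hu => simp only [map_smul, hu]
    | basis x => rw [hβ', hΦ _ _ x.2.2, hT _ _ x.2.2, hT' _ _ x.2.2, map_smul, hΦ _ _ x.2.2]
  have hΦs : ∀ u, Φ (modelConj hg' d u) = conj (Φ u) := fun u => by
    induction u using basis_induction β' with
    | zero => simp
    | add u v hu hv => simp only [map_add, hu, hv]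
    | smul a u hu => simp only [map_smul, LinearMap.map_smulₛₗ, hu]
    | basis x =>
      rw [hβ', hΦ _ _ x.2.2, ← hc.modelConj_eq, hconj _ _ x.2.2, hconj' _ _ x.2.2, hΦ]
      rw [hm]
      exact x.2.2
  have hd := isHermitianForm_modelHerm d
  have hc' := isHermitianForm_modelHerm c
  have hΦB : ∀ u v, modelHerm c (Φ u) (Φ v) = modelHerm d u v := fun u v => by
    induction u using basis_induction β' with
    | zero => rw [map_zero, hc'.zero_left, hd.zero_left]
    | add u u' hu hu' => rw [map_add, hc'.add_left, hd.add_left, hu, hu']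
    | smul a u hu => rw [map_smul, hc'.smul_left, hd.smul_left, hu]
    | basis x =>
      induction v using basis_induction β' with
      | zero => rw [map_zero, hc'.zero_right, hd.zero_right]
      | add u u' hu hu' => rw [map_add, hc'.add_right, hd.add_right, hu, hu']
      | smul a u hu => rw [map_smul, hc'.smul_right, hd.smul_right, hu]
      | basis y =>
        have e : ∀ x, Φ (β' x) = β x := fun x => β'.equiv_apply x β (Equiv.refl _)
        rw [e, e, ho, ho']
  refine ⟨d.map Φ, fun i => ?_, fun i i' => ?_⟩
  · rw [Module.Basis.map_apply, Module.Basis.map_apply, ← hΦs, modelConj_basis]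
  · rw [hc.form_eq_modelHerm, Module.Basis.map_apply, Module.Basis.map_apply, ← hΦs, ← hΦT, hΦB,
      modelHerm_modelWeil_modelConj_basis]

end IsAdapted

/-- Two adapted bases of the same type are related by a real isometry. -/
theorem IsAdapted.exists_isometry {hg : ∀ x, g x.swap = g x}
    {c c' : Module.Basis (Idx n g) ℂ (Cx E)} (hc : IsAdapted Q hg c) (hc' : IsAdapted Q hg c') :
    ∃ e : E ≃ₗ[ℝ] E, (∀ u v, Q (e u) (e v) = Q u v) ∧
      ∀ i, e.toLinearMap.baseChange ℂ (c i) = c' i := by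
  let Φ : Cx E ≃ₗ[ℂ] Cx E := c.equiv c' (Equiv.refl _)
  have hΦ : ∀ i, Φ (c i) = c' i := fun i => c.equiv_apply i c' (Equiv.refl _)
  have hΦr : ∀ u i, c'.repr (Φ u) i = c.repr u i := fun u i => by
    induction u using basis_induction c with
    | zero => simp
    | add u v hu hv => simp only [map_add, Finsupp.add_apply, hu, hv]
    | smul a u hu => simp only [map_smul, Finsupp.smul_apply, hu]
    | basis i' => rw [hΦ, Module.Basis.repr_self, Module.Basis.repr_self]
  have hconj : ∀ u, conj (Φ u) = Φ (conj u) := fun u => by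
    apply c'.repr.injective
    ext i
    rw [hc'.repr_conj, hΦr, hΦr, hc.repr_conj]
  have hbc := baseChange_descendEquiv Φ hconj
  refine ⟨descendEquiv Φ hconj, fun u v => ?_, fun i => by rw [hbc]; exact hΦ i⟩
  have h1 : ∀ u, (1 : ℂ) ⊗ₜ[ℝ] descendEquiv Φ hconj u = Φ (1 ⊗ₜ u) := fun u => by
    have := LinearMap.congr_fun hbc ((1 : ℂ) ⊗ₜ u)
    rwa [LinearMap.baseChange_tmul] at this
  have h2 : Q.baseChange ℂ (Φ (1 ⊗ₜ u)) (Φ (1 ⊗ₜ v)) = Q.baseChange ℂ (1 ⊗ₜ u) (1 ⊗ₜ v) := by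
    rw [hc'.form_eq_sum, hc.form_eq_sum]
    simp only [hΦr]
  rw [← h1, ← h1, baseChange_one_tmul, baseChange_one_tmul] at h2
  exact_mod_cast h2

end Change

/-! ### Classification by Hodge diamonds -/

section Classification

variable {E : Type*} [AddCommGroup E] [Module ℝ E] {n : ℕ} {Q : LinearMap.BilinForm ℝ E}
  {h : ℤ → ℤ → ℕ}

theorem DiamondConditions.eq_zero {f : ℤ × ℤ → ℕ} (hf : DiamondConditions n h f)
    (hh : ∀ r : ℤ, (r < 0 ∨ n < r) → h r (n - r) = 0) (a b : ℤ)
    (hab : a < 0 ∨ n < a ∨ b < 0 ∨ n < b) : f (a, b) = 0 := by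
  have key : ∀ a b : ℤ, (b < 0 ∨ n < b) → f (a, b) = 0 := fun a b hb => by
    have h1 := hf.column_sum b
    have h2 := hh (n - b) (by omega)
    rw [sub_sub_cancel] at h2
    rw [h2] at h1
    have h3 := single_le_finsum a (f := fun p => f (p, b)) (hf.column_finite b)
      (fun _ => Nat.zero_le _)
    omega
  rcases hab with ha | ha | hb | hb
  · rw [hf.symm]
    exact key b a (Or.inl ha)
  · rw [hf.symm]
    exact key b a (Or.inr ha)
  · exact key a b (Or.inl hb)
  · exact key a b (Or.inr hb)

theorem stringsOf_swap {f : ℤ × ℤ → ℕ} (hf : ∀ p q, f (p, q) = f (q, p)) (x : ℤ × ℤ) :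
    Idx.stringsOf n f x.swap = Idx.stringsOf n f x := by
  rw [Idx.stringsOf, Idx.stringsOf, Prod.fst_swap, Prod.snd_swap, hf (x.2 + 1) (x.1 + 1),
    show f x.swap = f x from hf x.2 x.1]
  simp only [swap_mem_tops]

theorem DiamondConditions.col_stringsOf {f : ℤ × ℤ → ℕ} (hf : DiamondConditions n h f)
    (hh : ∀ r : ℤ, (r < 0 ∨ n < r) → h r (n - r) = 0)
    (hcnt : Idx.cnt n (Idx.stringsOf n f) = f) (r : ℤ) :
    Idx.col n (Idx.stringsOf n f) r = h r (n - r) := by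
  have h1 := hf.column_sum (n - r)
  rw [sub_sub_cancel, finsum_eq_sum_of_support_subset (s := Finset.Icc 0 (n : ℤ)) _ (by
    intro p hp
    rw [Finset.coe_Icc, Set.mem_Icc]
    by_contra hc
    exact hp (hf.eq_zero hh _ _ (by omega)))] at h1
  rw [Idx.col_eq_sum_cnt, hcnt, ← h1]
  refine Finset.sum_nbij' (fun b => n - b) (fun p => n - p) ?_ ?_ ?_ ?_ ?_
  · intro b hb
    rw [Finset.mem_Icc] at hb ⊢
    omega
  · intro b hb
    rw [Finset.mem_Icc] at hb ⊢
    omega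
  · intro b _
    ring
  · intro b _
    ring
  · intro b _
    exact hf.antisymm r b

/-- Every function that satisfies the conditions on a Hodge diamond is the diamond of an `ℝ`-split
polarized mixed Hodge structure. -/
theorem exists_isPMHS_of_diamondConditions [FiniteDimensional ℝ E]
    (hQ : ∀ u v, Q u v = (-1) ^ n * Q v u) (hD : (periodDomain n Q h).Nonempty) {f : ℤ × ℤ → ℕ}
    (hf : DiamondConditions n h f) :
    ∃ (W : ℤ → Submodule ℝ E) (F : ℤ → Submodule ℂ (Cx E)) (N : Module.End ℝ E),
      IsPMHS n Q h W F N ∧ IsRSplit W F ∧ hodgeDiamond W F = f := by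
  obtain ⟨F₀, hF₀⟩ := hD
  obtain ⟨g, hg, c, hc, -, -, -, hbig⟩ := (hasBigrading_pureW hF₀).exists_isAdapted hQ
  have hcol := col_of_periodDomain hF₀ c hbig
  have hh : ∀ r : ℤ, (r < 0 ∨ n < r) → h r (n - r) = 0 := fun r hr => by
    rw [← hcol, Idx.col_eq_sum_cnt]
    exact Finset.sum_eq_zero fun b _ => Idx.cnt_eq_zero (by omega)
  have hcnt : Idx.cnt n (Idx.stringsOf n f) = f :=
    Idx.cnt_stringsOf (hf.eq_zero hh) (fun a b => (hf.antisymm a b).symm) hf.mono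
  have hcol' := hf.col_stringsOf hh hcnt
  obtain ⟨c', hc'⟩ := hc.exists_of_col_eq (stringsOf_swap hf.symm)
    (fun r => (hcol' r).trans (hcol r).symm)
  exact ⟨stdW c', stdF c', stdN c', hc'.isPMHS fun r _ => hcol' r, hc'.isRSplit,
    hc'.hodgeDiamond_eq.trans hcnt⟩

/-- An `ℝ`-split polarized mixed Hodge structure has an adapted basis whose type is determined by
the Hodge diamond. -/
theorem IsPMHS.exists_isAdapted [FiniteDimensional ℝ E] (hQ : ∀ u v, Q u v = (-1) ^ n * Q v u)
    {W : ℤ → Submodule ℝ E} {F : ℤ → Submodule ℂ (Cx E)} {N : Module.End ℝ E}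
    (hP : IsPMHS n Q h W F N) (hs : IsRSplit W F) :
    ∃ (hg : ∀ x, Idx.stringsOf n (hodgeDiamond W F) x.swap = Idx.stringsOf n (hodgeDiamond W F) x)
      (c : Module.Basis (Idx n (Idx.stringsOf n (hodgeDiamond W F))) ℂ (Cx E)),
      IsAdapted Q hg c ∧ N.baseChange ℂ = stringShift c ∧ F = stdF c := by
  classical
  obtain ⟨g, hg, c, hc, hg0, hN, hF, hbig⟩ := (hP.hasBigrading hs).exists_isAdapted hQ
  have hd : hodgeDiamond W F = Idx.cnt n g := by
    funext x
    rw [hodgeDiamond, hs.deligneI_eq, hbig, finrank_spanPart, Idx.cnt]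
  rw [hd, Idx.stringsOf_cnt hg0]
  exact ⟨hg, c, hc, hN, hF⟩

theorem exists_isometry_of_hodgeDiamond_eq [FiniteDimensional ℝ E]
    (hQ : ∀ u v, Q u v = (-1) ^ n * Q v u)
    {W₁ W₂ : ℤ → Submodule ℝ E} {F₁ F₂ : ℤ → Submodule ℂ (Cx E)} {N₁ N₂ : Module.End ℝ E}
    (h₁ : IsPMHS n Q h W₁ F₁ N₁) (hs₁ : IsRSplit W₁ F₁) (h₂ : IsPMHS n Q h W₂ F₂ N₂)
    (hs₂ : IsRSplit W₂ F₂) (hd : hodgeDiamond W₁ F₁ = hodgeDiamond W₂ F₂) :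
    ∃ e : E ≃ₗ[ℝ] E, (∀ u v, Q (e u) (e v) = Q u v) ∧
      (∀ p : ℤ, F₂ p = (F₁ p).map (e.toLinearMap.baseChange ℂ)) ∧
      N₂ = e.toLinearMap ∘ₗ N₁ ∘ₗ e.symm.toLinearMap := by
  obtain ⟨hg₁, c₁, hc₁, hN₁, hF₁⟩ := h₁.exists_isAdapted hQ hs₁
  have H₂ := h₂.exists_isAdapted hQ hs₂
  rw [← hd] at H₂
  obtain ⟨hg₂, c₂, hc₂, hN₂, hF₂⟩ := H₂
  obtain ⟨e, heQ, hec⟩ := hc₁.exists_isometry hc₂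
  refine ⟨e, heQ, fun p => ?_, ?_⟩
  · rw [hF₁, hF₂, stdF, stdF, spanPart, spanPart, Submodule.map_span, ← Set.image_comp]
    congr 1
    exact Set.image_congr fun i _ => (hec i).symm
  · have key : N₂.baseChange ℂ ∘ₗ e.toLinearMap.baseChange ℂ =
        e.toLinearMap.baseChange ℂ ∘ₗ N₁.baseChange ℂ := by
      refine c₁.ext fun i => ?_
      rw [LinearMap.comp_apply, LinearMap.comp_apply, hec, hN₁, hN₂, stringShift_basis,
        stringShift_basis]
      split_ifs
      · rw [hec]
      · rw [map_zero]
    ext u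
    apply one_tmul_injective
    have := LinearMap.congr_fun key ((1 : ℂ) ⊗ₜ e.symm u)
    simpa using this

theorem hodgeDiamond_eq_of_isometry
    {W₁ W₂ : ℤ → Submodule ℝ E} {F₁ F₂ : ℤ → Submodule ℂ (Cx E)} {N₁ N₂ : Module.End ℝ E}
    (h₁ : IsPMHS n Q h W₁ F₁ N₁) (h₂ : IsPMHS n Q h W₂ F₂ N₂) (e : E ≃ₗ[ℝ] E)
    (hF : ∀ p : ℤ, F₂ p = (F₁ p).map (e.toLinearMap.baseChange ℂ))
    (hN : N₂ = e.toLinearMap ∘ₗ N₁ ∘ₗ e.symm.toLinearMap) :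
    hodgeDiamond W₁ F₁ = hodgeDiamond W₂ F₂ := by
  have hW : W₂ = fun k => (W₁ k).map e.toLinearMap := by
    have hm := h₁.weight.map e
    rw [← hN] at hm
    funext k
    have := congrFun (h₂.weight.unique hm) (k - n)
    simpa using this
  rw [hW, funext hF, hodgeDiamond_map]

end Classification

end PMHS

theorem theorem4p2 {V : Type*} [AddCommGroup V] [Module ℚ V] [FiniteDimensional ℚ V]
    (n : ℕ) (Q : LinearMap.BilinForm ℚ V) (hQ : Q.Nondegenerate)
    (hQsymm : ∀ u v, Q u v = (-1) ^ n * Q v u)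
    (h : ℤ → ℤ → ℕ)
    (hD : (PMHS.periodDomain n (Q.baseChange ℝ) h).Nonempty) :
    (∀ f : ℤ × ℤ → ℕ, PMHS.DiamondConditions n h f →
      ∃ (W : ℤ → Submodule ℝ (ℝ ⊗[ℚ] V)) (F : ℤ → Submodule ℂ (PMHS.Cx (ℝ ⊗[ℚ] V)))
        (N : Module.End ℝ (ℝ ⊗[ℚ] V)),
        PMHS.IsPMHS n (Q.baseChange ℝ) h W F N ∧ PMHS.IsRSplit W F ∧
          PMHS.hodgeDiamond W F = f) ∧
    (∀ (W₁ W₂ : ℤ → Submodule ℝ (ℝ ⊗[ℚ] V)) (F₁ F₂ : ℤ → Submodule ℂ (PMHS.Cx (ℝ ⊗[ℚ] V)))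
      (N₁ N₂ : Module.End ℝ (ℝ ⊗[ℚ] V)),
      PMHS.IsPMHS n (Q.baseChange ℝ) h W₁ F₁ N₁ → PMHS.IsRSplit W₁ F₁ →
      PMHS.IsPMHS n (Q.baseChange ℝ) h W₂ F₂ N₂ → PMHS.IsRSplit W₂ F₂ →
      (PMHS.hodgeDiamond W₁ F₁ = PMHS.hodgeDiamond W₂ F₂ ↔
        ∃ g : (ℝ ⊗[ℚ] V) ≃ₗ[ℝ] (ℝ ⊗[ℚ] V),
          (∀ u v, Q.baseChange ℝ (g u) (g v) = Q.baseChange ℝ u v) ∧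
          (∀ p : ℤ, F₂ p = (F₁ p).map (g.toLinearMap.baseChange ℂ)) ∧
          N₂ = g.toLinearMap ∘ₗ N₁ ∘ₗ g.symm.toLinearMap)) := by
  have hQR : ∀ u v, Q.baseChange ℝ u v = (-1) ^ n * Q.baseChange ℝ v u := by
    intro u v
    induction u using TensorProduct.induction_on with
    | zero => simp
    | add u u' hu hu' => simp only [map_add, LinearMap.add_apply, hu, hu', mul_add]
    | tmul a x =>
      induction v using TensorProduct.induction_on with
      | zero => simp
      | add v v' hv hv' => simp only [map_add, LinearMap.add_apply, hv, hv', mul_add]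
      | tmul b y =>
        rw [LinearMap.BilinForm.baseChange_tmul, LinearMap.BilinForm.baseChange_tmul, hQsymm x y]
        simp only [Rat.smul_def]
        push_cast
        ring
  refine ⟨fun f hf => PMHS.exists_isPMHS_of_diamondConditions hQR hD hf,
    fun W₁ W₂ F₁ F₂ N₁ N₂ h₁ hs₁ h₂ hs₂ => ⟨fun hd =>
      PMHS.exists_isometry_of_hodgeDiamond_eq hQR h₁ hs₁ h₂ hs₂ hd, ?_⟩⟩
  rintro ⟨g, -, hF, hN⟩
  exact PMHS.hodgeDiamond_eq_of_isometry h₁ h₂ g hF hN
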